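/- Graphs are simple, undirected and possibly infinite; $d_G$ is the graph distance ($\infty$ between different components), and $d_G(Y,Z)\ge K$ for sets (or subgraphs) $Y,Z$ means that $d_G(y,z)\ge K$ for all vertices $y$ of $Y$ and $z$ of $Z$. Multigraphs may be infinite and may have parallel edges, but no loops. A multigraph is *2-connected* if it is connected, has at least two edges, and remains connected and non-empty after the deletion of any single vertex (so two vertices joined by at least two parallel edges count as 2-connected). A *model* of a multigraph $J$ in a graph $G$ consists of pairwise disjoint, non-empty connected sets $U_x\subseteq V(G)$ for $x\in V(J)$ (branch sets), and of paths $E_e$ in $G$, one for each edge $e$ of $J$ (branch paths), pairwise distinct and internally disjoint, such that, if $e$ has ends $x,y$, then $E_e$ meets $U_x$ exactly in its first vertex and $U_y$ exactly in its last vertex, and $E_e$ is disjoint from every $U_z$ with $z\ne x,y$. For $K\in\mathbb N=\{0,1,2,\dots\}$, the model is *$K$-fat* if any two different members of the family of all branch sets and branch paths are at distance at least $K$ in $G$, except possibly a branch path $E_e$ and a branch set $U_x$ with $x$ an end of $e$. The multigraph $J$ is a ($K$-fat) minor of $G$ if $G$ contains a ($K$-fat) model of $J$. A *graph-partition* of $G$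 over a graph $H$ is a partition $(V_h)_{h\in V(H)}$ of $V(G)$ such that whenever $uv\in E(G)$, $u\in V_g$ and $v\in V_h$, then $g=h$ or $gh\in E(H)$. It is *honest* if every $V_h$ is non-empty and for every edge $gh$ of $H$ there is an edge $uv$ of $G$ with $u\in V_g$ and $v\in V_h$. It is *$r$-bounded* if $d_G(u,v)\le r$ whenever $u,v$ lie in the same $V_h$. **Theorem.** For every $t\in\mathbb N$ there is a function $R:\mathbb N\to\mathbb N$ such that for every $K\in\mathbb N$, every graph $G$ with no $K$-fat $K_{2,t}$ minor has an honest, $R(K)$-bounded graph-partition over a graph $H$ such that every 2-connected multigraph that is a minor of $H$ is a $K$-fat minor of $G$, and $H$ has no $K_{2,t}$ minor. -/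

import Mathlib

universe u v w

namespace FatMinor

/-- The vertex sets `A` and `B` are at distance at least `K` in `G`; vertices in different
components are at distance `⊤`. -/
def FarApart {V : Type*} (G : SimpleGraph V) (K : ℕ) (A B : Set V) : Prop :=
  ∀ a ∈ A, ∀ b ∈ B, (K : ℕ∞) ≤ G.edist a b

/-- `P` is an `A`–`B` path of `G`: a path that meets `A` exactly in its first vertex and `B`
exactly in its last vertex. -/
def IsSetPath {V : Type*} (G : SimpleGraph V) (A B : Set V) (P : G.Subgraph) : Prop :=
  ∃ (a b : V) (p : G.Walk a b), p.IsPath ∧ P = p.toSubgraph ∧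
    P.verts ∩ A = {a} ∧ P.verts ∩ B = {b}

/-- A model of the loopless multigraph `J` in the graph `G`. Only the values of `branchSet` on
vertices of `J` and of `branchPath` on edges of `J` matter. -/
structure Model {α β V : Type*} (J : Graph α β) (G : SimpleGraph V) where
  branchSet : α → Set V
  branchPath : β → G.Subgraph
  /-- Branch sets are connected, in particular non-empty. -/
  connected : ∀ x ∈ J.vertexSet, (G.induce (branchSet x)).Connected
  disjoint : ∀ x ∈ J.vertexSet, ∀ y ∈ J.vertexSet, x ≠ y →
    Disjoint (branchSet x) (branchSet y)
  isSetPath : ∀ e x y, J.IsLink e x y →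
    IsSetPath G (branchSet x) (branchSet y) (branchPath e)
  /-- A branch path avoids all branch sets other than those of the ends of its edge. -/
  avoid : ∀ e x y, J.IsLink e x y → ∀ z ∈ J.vertexSet, z ≠ x → z ≠ y →
    Disjoint (branchPath e).verts (branchSet z)
  /-- Different edges, also parallel ones, have different branch paths. -/
  path_ne : ∀ e ∈ J.edgeSet, ∀ f ∈ J.edgeSet, e ≠ f → branchPath e ≠ branchPath f
  /-- Branch paths are internally disjoint: no inner vertex of one of them lies on another. The
  inner vertices of the branch path of an edge `xy` are those outside the branch sets of its ends
  `x` and `y`. -/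
  internally_disjoint : ∀ e x y, J.IsLink e x y → ∀ f ∈ J.edgeSet, e ≠ f →
    Disjoint ((branchPath e).verts \ (branchSet x ∪ branchSet y)) (branchPath f).verts

/-- A model is `K`-fat if any two of its branch sets and branch paths are at distance at least `K`,
except possibly a branch path and the branch set of an end of its edge. -/
structure Model.IsFat {α β V : Type*} {J : Graph α β} {G : SimpleGraph V} (M : Model J G)
    (K : ℕ) : Prop where
  set_set : ∀ x ∈ J.vertexSet, ∀ y ∈ J.vertexSet, x ≠ y →
    FarApart G K (M.branchSet x) (M.branchSet y)
  path_path : ∀ e ∈ J.edgeSet, ∀ f ∈ J.edgeSet, e ≠ f →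
    FarApart G K (M.branchPath e).verts (M.branchPath f).verts
  path_set : ∀ e ∈ J.edgeSet, ∀ z ∈ J.vertexSet, ¬ J.Inc e z →
    FarApart G K (M.branchPath e).verts (M.branchSet z)

/-- The multigraph `J` is a minor of the graph `G`. -/
def IsMinor {α β V : Type*} (J : Graph α β) (G : SimpleGraph V) : Prop :=
  Nonempty (Model J G)

/-- The multigraph `J` is a `K`-fat minor of the graph `G`. -/
def IsFatMinor {α β V : Type*} (K : ℕ) (J : Graph α β) (G : SimpleGraph V) : Prop :=
  ∃ M : Model J G, M.IsFat K

/-- A `2`-connected multigraph: it has no loops, is connected, has at least two edges, and stays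
connected (and non-empty) whenever a single vertex is deleted. On at least three vertices the
condition on the number of edges is automatic; on two vertices it says that there are
at least two parallel edges. -/
structure IsTwoConnected {α β : Type*} (J : Graph α β) : Prop where
  loopless : J.Loopless
  nontrivial_edgeSet : J.edgeSet.Nontrivial
  connected : J.toSimpleGraph.Connected
  connected_delete : ∀ x : J.vertexSet, (J.toSimpleGraph.induce {x}ᶜ).Connected

/-- The complete bipartite graph `K_{2,t}`, as a multigraph. -/
abbrev K2 (t : ℕ) : Graph (Fin 2 ⊕ Fin t) (Sym2 (Fin 2 ⊕ Fin t)) :=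
  Graph.ofSimpleGraph (completeBipartiteGraph (Fin 2) (Fin t))

/-- A graph-partition of `G` over `H`: a partition of the vertices of `G` into bags indexed by the
nodes of `H` such that every edge of `G` lies within a bag or joins bags of adjacent nodes. -/
structure GraphPartition {V W : Type*} (G : SimpleGraph V) (H : SimpleGraph W) where
  bag : W → Set V
  existsUnique_mem_bag : ∀ a : V, ∃! h : W, a ∈ bag h
  eq_or_adj : ∀ a b : V, G.Adj a b → ∀ g h : W, a ∈ bag g → b ∈ bag h → g = h ∨ H.Adj g h

/-- All bags are non-empty and every edge of `H` is witnessed by an edge of `G`. -/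
structure GraphPartition.IsHonest {V W : Type*} {G : SimpleGraph V} {H : SimpleGraph W}
    (P : GraphPartition G H) : Prop where
  nonempty : ∀ h : W, (P.bag h).Nonempty
  exists_adj : ∀ g h : W, H.Adj g h → ∃ a ∈ P.bag g, ∃ b ∈ P.bag h, G.Adj a b

/-- Every bag has diameter at most `R`, measured in `G`. -/
def GraphPartition.IsBounded {V W : Type*} {G : SimpleGraph V} {H : SimpleGraph W}
    (P : GraphPartition G H) (R : ℕ) : Prop :=
  ∀ h : W, ∀ a ∈ P.bag h, ∀ b ∈ P.bag h, G.edist a b ≤ (R : ℕ∞)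

end FatMinor

/-! Layer every component of `G` by the distance `lev` from a root. If `t` vertices of level `n` lie
in one component of the levels `≥ n`, two of them are joined by a short walk near level `n`
(`IsLevel.exists_short`): otherwise that component and the part of the graph well below level `n`
are the hubs of a fat `K_{2,t}`, joined by `t` descending paths. Hence connected sets of bounded
height have bounded diameter (`IsLevel.near_of_conn`), and components of slabs of bounded height can
serve as bags.

The slabs are chosen recursively. A family `F` is a union of components of the levels `≥ F.l`. Its
region reaches up to a cutting level `top F`, and its bags are the traces on the region of the
components of a slightly larger set `OmP F`. Cutting levels and window widths come from a pigeonhole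
argument (`exists_stable`): increasing relations on the bottom vertices, with boundedly many classes
at the start, must stop changing at some step. At such a place, enlarging the set merges nothing, so
distinct bags have connected representatives far apart. Above the cut, a component attached to at
most one bag starts a family of its own. Components attached to several bags number fewer than `t ^
3`, since otherwise `t` of them join the same two bags and give a fat `K_{2,t}` (`WF.mul_card`).
Hence they have a common stable scale, and those connected at that scale are grouped into one
family.

In the quotient graph, a family attached to at most one bag is cut off by at most one node, its
gate. A model of a `2`-connected multigraph therefore essentially lives in one block
(`IsTwoConnected.subset_or_disjoint`, `exists_block`): a family with its gate, followed only through
children attached to several bags. In a block, each node is represented by a core at the bottom of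
its region, each edge by a strand descending from the upper region into the lower one, and the gate
by a connected set of low levels. These sets are `K` apart except for a strand and its ends
(`exists_thick`), so a model in the block lifts to a `K`-fat model in `G` (`Thick.isFatMinor`). For
`t ≥ 2` this applies to `K_{2,t}` itself, so the quotient has no such minor. The cases `K = 0` and
`t ≤ 1` are handled directly. -/

namespace FatMinor

open SimpleGraph

/-! ### Connection inside a set and bounded distance -/

section Conn

variable {V : Type*} {G : SimpleGraph V} {S T A B : Set V} {x y z : V}

/-- `x` and `y` are joined by a walk of `G` all of whose vertices lie in `S`. -/
def Conn (G : SimpleGraph V) (S : Set V) (x y : V) : Prop :=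
  ∃ p : G.Walk x y, ∀ z ∈ p.support, z ∈ S

/-- `x` and `y` are joined by a walk of `G` of length at most `n`. -/
def Near (G : SimpleGraph V) (n : ℕ) (x y : V) : Prop :=
  ∃ p : G.Walk x y, p.length ≤ n

/-- `S` is non-empty and any two of its vertices are joined inside `S`. -/
def SConn (G : SimpleGraph V) (S : Set V) : Prop :=
  S.Nonempty ∧ ∀ x ∈ S, ∀ y ∈ S, Conn G S x y

theorem Conn.refl (h : x ∈ S) : Conn G S x x := ⟨.nil, by simpa using h⟩

theorem Conn.symm (h : Conn G S x y) : Conn G S y x := by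
  obtain ⟨p, hp⟩ := h
  exact ⟨p.reverse, by simpa using hp⟩

theorem Conn.trans (h : Conn G S x y) (h' : Conn G S y z) : Conn G S x z := by
  obtain ⟨p, hp⟩ := h
  obtain ⟨q, hq⟩ := h'
  refine ⟨p.append q, fun w hw => ?_⟩
  rcases (Walk.mem_support_append_iff _ _).1 hw with h | h
  exacts [hp _ h, hq _ h]

theorem Conn.mono (hST : S ⊆ T) (h : Conn G S x y) : Conn G T x y := by
  obtain ⟨p, hp⟩ := h
  exact ⟨p, fun w hw => hST (hp w hw)⟩

theorem Conn.of_adj (h : G.Adj x y) (hx : x ∈ S) (hy : y ∈ S) : Conn G S x y :=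
  ⟨.cons h .nil, by simp [hx, hy]⟩

theorem Conn.left_mem (h : Conn G S x y) : x ∈ S := h.choose_spec _ (Walk.start_mem_support _)

theorem Conn.right_mem (h : Conn G S x y) : y ∈ S := h.choose_spec _ (Walk.end_mem_support _)

theorem Conn.reachable (h : Conn G S x y) : G.Reachable x y := ⟨h.choose⟩

theorem Conn.univ_of_reachable (h : G.Reachable x y) : Conn G Set.univ x y := by
  obtain ⟨p⟩ := h
  exact ⟨p, by simp⟩

/-- A walk inside `S` that starts in a set closed under steps of `G` within `S` stays there. -/
theorem Conn.inter (h : Conn G S x y) (hx : x ∈ T)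
    (hT : ∀ a ∈ T, ∀ b, G.Adj a b → b ∈ S → b ∈ T) : Conn G (S ∩ T) x y := by
  obtain ⟨p, hp⟩ := h
  refine ⟨p, ?_⟩
  induction p with
  | nil => simpa using ⟨by simpa using hp, hx⟩
  | cons h q ih =>
    simp only [Walk.support_cons, List.mem_cons, forall_eq_or_imp] at hp ⊢
    exact ⟨⟨hp.1, hx⟩, ih (hT _ hx _ h (hp.2 _ (Walk.start_mem_support _))) hp.2⟩

theorem Conn.mem_of_closed (h : Conn G S x y) (hx : x ∈ T)
    (hT : ∀ a ∈ T, ∀ b, G.Adj a b → b ∈ S → b ∈ T) : y ∈ T :=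
  (h.inter hx hT).right_mem.2

/-- A walk inside `S` from a vertex of `T` to a vertex outside `T` has a step leaving `T`. -/
theorem Conn.exists_step (h : Conn G S x y) (hx : x ∈ T) (hy : y ∉ T) :
    ∃ a ∈ T, ∃ b, b ∉ T ∧ G.Adj a b ∧ a ∈ S ∧ b ∈ S := by
  by_contra! hc
  refine hy (h.inter (T := {z | z ∈ T ∧ z ∈ S}) ⟨hx, h.left_mem⟩
    fun a ha b hab hb => ?_).right_mem.2.1
  by_contra hb'
  exact hc a ha.1 b (fun h => hb' ⟨h, hb⟩) hab ha.2 hb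

theorem Conn.of_walk (p : G.Walk x y) : Conn G {z | z ∈ p.support} x y := ⟨p, fun _ h => h⟩

theorem Conn.of_mem_support (p : G.Walk x y) (hp : ∀ a ∈ p.support, a ∈ S)
    (hz : z ∈ p.support) : Conn G S x z := by
  classical
  exact ⟨p.takeUntil z hz, fun a ha => hp _ (p.support_takeUntil_subset_support hz ha)⟩

theorem sconn_support (p : G.Walk x y) : SConn G {z | z ∈ p.support} :=
  ⟨⟨x, p.start_mem_support⟩, fun _ ha _ hb =>
    (Conn.of_mem_support p (fun _ h => h) ha).symm.trans (Conn.of_mem_support p (fun _ h => h) hb)⟩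

theorem sconn_iff_connected : SConn G S ↔ (G.induce S).Connected := by
  constructor
  · rintro ⟨⟨s, hs⟩, h⟩
    have : Nonempty S := ⟨⟨s, hs⟩⟩
    refine ⟨fun a b => ?_⟩
    obtain ⟨p, hp⟩ := h a.1 a.2 b.1 b.2
    exact ⟨p.induce S hp⟩
  · intro h
    obtain ⟨s⟩ := h.nonempty
    refine ⟨⟨s.1, s.2⟩, fun a ha b hb => ?_⟩
    obtain ⟨p⟩ := h.preconnected ⟨a, ha⟩ ⟨b, hb⟩
    refine ⟨p.map (Embedding.induce S).toHom, fun z hz => ?_⟩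
    obtain ⟨c, -, rfl⟩ := List.mem_map.1 ((Walk.support_map _ p) ▸ hz)
    exact c.2

theorem SConn.union (hS : SConn G S) (hT : SConn G T) (h : (S ∩ T).Nonempty) :
    SConn G (S ∪ T) := by
  obtain ⟨c, hcS, hcT⟩ := h
  have key : ∀ x ∈ S ∪ T, Conn G (S ∪ T) x c := by
    rintro x (hx | hx)
    · exact (hS.2 x hx c hcS).mono Set.subset_union_left
    · exact (hT.2 x hx c hcT).mono Set.subset_union_right
  exact ⟨⟨c, .inl hcS⟩, fun x hx y hy => (key x hx).trans (key y hy).symm⟩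

theorem Near.symm {n : ℕ} (h : Near G n x y) : Near G n y x := by
  obtain ⟨p, hp⟩ := h
  exact ⟨p.reverse, by simpa using hp⟩

theorem Near.trans {m n : ℕ} (h : Near G m x y) (h' : Near G n y z) : Near G (m + n) x z := by
  obtain ⟨p, hp⟩ := h
  obtain ⟨q, hq⟩ := h'
  exact ⟨p.append q, by simp; omega⟩

theorem Near.mono {m n : ℕ} (hmn : m ≤ n) (h : Near G m x y) : Near G n x y :=
  h.imp fun _ hp => hp.trans hmn

theorem Near.refl (n : ℕ) (x : V) : Near G n x x := ⟨.nil, by simp⟩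

theorem Near.of_adj (h : G.Adj x y) : Near G 1 x y := ⟨.cons h .nil, by simp⟩

theorem Near.edist_le {n : ℕ} (h : Near G n x y) : G.edist x y ≤ n := by
  obtain ⟨p, hp⟩ := h
  exact (SimpleGraph.edist_le p).trans (by exact_mod_cast hp)

theorem near_of_edist_lt {n : ℕ} (h : G.edist x y < n) : ∃ m < n, Near G m x y := by
  obtain ⟨p, hp⟩ := exists_walk_of_edist_ne_top (ne_top_of_lt h)
  exact ⟨p.length, by rw [← hp] at h; exact_mod_cast h, p, le_rfl⟩

theorem farApart_iff {K : ℕ} :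
    FarApart G K A B ↔ ∀ a ∈ A, ∀ b ∈ B, ∀ m < K, ¬ Near G m a b := by
  constructor
  · intro h a ha b hb m hm hn
    have := (h a ha b hb).trans hn.edist_le
    exact absurd (by exact_mod_cast this) (not_le.2 hm)
  · intro h a ha b hb
    by_contra! hc
    obtain ⟨m, hm, hn⟩ := near_of_edist_lt hc
    exact h a ha b hb m hm hn

theorem FarApart.symm {K : ℕ} (h : FarApart G K A B) : FarApart G K B A := fun b hb a ha => by
  rw [edist_comm]; exact h a ha b hb

theorem FarApart.mono {K : ℕ} {A' B' : Set V} (h : FarApart G K A B) (hA : A' ⊆ A) (hB : B' ⊆ B) :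
    FarApart G K A' B' := fun a ha b hb => h a (hA ha) b (hB hb)

theorem FarApart.disjoint {K : ℕ} (hK : 0 < K) (h : FarApart G K A B) : Disjoint A B := by
  rw [Set.disjoint_left]
  intro a ha hb
  exact (farApart_iff.1 h) a ha a hb 0 hK (Near.refl 0 a)

/-- If some walk inside `S` leads from `A` to `B`, then so does a path that meets each of `A` and
`B` in one end only. -/
theorem exists_isPath_of_conn {a b : V} (ha : a ∈ A) (hb : b ∈ B) (h : Conn G S a b) :
    ∃ a ∈ A, ∃ b ∈ B, ∃ p : G.Walk a b, p.IsPath ∧ (∀ x ∈ p.support, x ∈ S) ∧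
      (∀ x ∈ p.support, x ∈ A → x = a) ∧ ∀ x ∈ p.support, x ∈ B → x = b := by
  classical
  have hex : ∃ n, ∃ a ∈ A, ∃ b ∈ B, ∃ p : G.Walk a b, p.length = n ∧ ∀ x ∈ p.support, x ∈ S := by
    obtain ⟨p, hp⟩ := h
    exact ⟨_, a, ha, b, hb, p, rfl, hp⟩
  obtain ⟨a, ha, b, hb, p, hl, hp⟩ := Nat.find_spec hex
  have hmin := fun {m} => Nat.find_min hex (m := m)
  rw [← hl] at hmin
  refine ⟨a, ha, b, hb, p.bypass, p.bypass_isPath,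
    fun x hx => hp x (p.support_bypass_subset_support hx), fun x hx hxA => ?_, fun x hx hxB => ?_⟩
  · have hx := p.support_bypass_subset_support hx
    by_contra hne
    refine hmin (p.length_dropUntil_lt_length hx hne) ⟨x, hxA, b, hb, p.dropUntil x hx, rfl,
      fun y hy => hp y (p.support_dropUntil_subset_support hx hy)⟩
  · have hx := p.support_bypass_subset_support hx
    by_contra hne
    refine hmin (p.length_takeUntil_lt_length hx hne) ⟨a, ha, x, hxB, p.takeUntil x hx, rfl,
      fun y hy => hp y (p.support_takeUntil_subset_support hx hy)⟩

theorem IsSetPath.symm {P : G.Subgraph} (h : IsSetPath G A B P) : IsSetPath G B A P := by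
  obtain ⟨a, b, p, hp, rfl, hA, hB⟩ := h
  exact ⟨b, a, p.reverse, hp.reverse, by simp, hB, hA⟩

theorem exists_isSetPath (hC : SConn G S) (hA : (S ∩ A).Nonempty) (hB : (S ∩ B).Nonempty) :
    ∃ P : G.Subgraph, IsSetPath G A B P ∧ P.verts ⊆ S := by
  obtain ⟨a, haS, ha⟩ := hA
  obtain ⟨b, hbS, hb⟩ := hB
  obtain ⟨a, ha, b, hb, p, hp, hpS, hpA, hpB⟩ := exists_isPath_of_conn ha hb (hC.2 a haS b hbS)
  refine ⟨p.toSubgraph, ⟨a, b, p, hp, rfl, ?_, ?_⟩, fun x hx => hpS x (by simpa using hx)⟩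
  · ext x
    simp only [Walk.verts_toSubgraph, Set.mem_inter_iff, Set.mem_ofPred_eq, Set.mem_singleton_iff]
    exact ⟨fun h => hpA x h.1 h.2, by rintro rfl; exact ⟨p.start_mem_support, ha⟩⟩
  · ext x
    simp only [Walk.verts_toSubgraph, Set.mem_inter_iff, Set.mem_ofPred_eq, Set.mem_singleton_iff]
    exact ⟨fun h => hpB x h.1 h.2, by rintro rfl; exact ⟨p.end_mem_support, hb⟩⟩

end Conn

/-! ### Fat models from connected sets -/

section FatMinorOfSets

variable {α β V : Type*} {J : Graph α β} {G : SimpleGraph V} {K : ℕ}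

/-- To exhibit a fat minor it suffices to find connected sets in place of branch paths, as any
such set contains a path between the two branch sets that it meets. -/
theorem isFatMinor_of_sets (hK : 0 < K) (U : α → Set V) (C : β → Set V)
    (hU : ∀ x ∈ J.vertexSet, SConn G (U x)) (hC : ∀ e ∈ J.edgeSet, SConn G (C e))
    (hCU : ∀ e x, J.Inc e x → (C e ∩ U x).Nonempty)
    (hUU : ∀ x ∈ J.vertexSet, ∀ y ∈ J.vertexSet, x ≠ y → FarApart G K (U x) (U y))
    (hCC : ∀ e ∈ J.edgeSet, ∀ f ∈ J.edgeSet, e ≠ f → FarApart G K (C e) (C f))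
    (hCU' : ∀ e ∈ J.edgeSet, ∀ z ∈ J.vertexSet, ¬ J.Inc e z → FarApart G K (C e) (U z)) :
    IsFatMinor K J G := by
  classical
  have hP : ∀ e, ∃ P : G.Subgraph, P.verts ⊆ C e ∧
      ∀ x y, J.IsLink e x y → IsSetPath G (U x) (U y) P := by
    intro e
    by_cases he : e ∈ J.edgeSet
    · obtain ⟨x, y, hxy⟩ := J.exists_isLink_of_mem_edgeSet he
      obtain ⟨P, hP, hPC⟩ := exists_isSetPath (hC e he) (hCU e x hxy.inc_left)
        (hCU e y hxy.inc_right)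
      refine ⟨P, hPC, fun x' y' h => ?_⟩
      obtain ⟨rfl, rfl⟩ | ⟨rfl, rfl⟩ := hxy.eq_and_eq_or_eq_and_eq h
      exacts [hP, hP.symm]
    · exact ⟨⊥, by simp, fun x y h => absurd h.edge_mem he⟩
  choose P hPC hP using hP
  have hne : ∀ e ∈ J.edgeSet, (P e).verts.Nonempty := by
    intro e he
    obtain ⟨x, y, hxy⟩ := J.exists_isLink_of_mem_edgeSet he
    obtain ⟨a, b, p, -, h, -⟩ := hP e x y hxy
    exact ⟨a, by simp [h]⟩
  have hPP : ∀ e ∈ J.edgeSet, ∀ f ∈ J.edgeSet, e ≠ f → FarApart G K (P e).verts (P f).verts :=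
    fun e he f hf h => (hCC e he f hf h).mono (hPC e) (hPC f)
  refine ⟨⟨U, P, fun x hx => sconn_iff_connected.1 (hU x hx),
    fun x hx y hy h => (hUU x hx y hy h).disjoint hK, hP, ?_, ?_, ?_⟩, hUU, hPP,
    fun e he z hz h => (hCU' e he z hz h).mono (hPC e) subset_rfl⟩
  · intro e x y hxy z hz hzx hzy
    refine ((hCU' e hxy.edge_mem z hz fun h => ?_).disjoint hK).mono_left (hPC e)
    rcases h.eq_or_eq_of_isLink hxy with h | h
    exacts [hzx h, hzy h]
  · intro e he f hf h heq
    have := (hPP e he f hf h).disjoint hK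
    rw [heq, disjoint_self] at this
    exact (hne f hf).ne_empty this
  · intro e x y hxy f hf h
    exact ((hPP e hxy.edge_mem f hf h).disjoint hK).mono_left Set.sdiff_subset

end FatMinorOfSets

end FatMinor

namespace FatMinor

open SimpleGraph

/-! ### A criterion for fat `K_{2,t}` minors -/

section K2

variable {V : Type*} {G : SimpleGraph V} {K t : ℕ}

/-- A set joining two far apart hubs contains a connected set at distance at least `K` from both
hubs, which is joined to either hub by a connected set of small diameter. -/
theorem exists_middle (hK : 0 < K) (H : Fin 2 → Set V)
    (hH : FarApart G (3 * K) (H 0) (H 1)) {P : Set V} {a b : V} (ha : a ∈ H 0) (hb : b ∈ H 1)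
    (hP : Conn G P a b) :
    ∃ (U : Set V) (E : Fin 2 → Set V), SConn G U ∧ U ⊆ P ∧ (∀ i, FarApart G K U (H i)) ∧
      ∀ i, SConn G (E i) ∧ (E i ∩ H i).Nonempty ∧ (E i ∩ U).Nonempty ∧
        (∀ u ∈ E i, ∃ a ∈ H i, Near G K a u) ∧ ∀ u ∈ E i, ∃ x ∈ U, Near G K x u := by
  classical
  set N : Fin 2 → Set V := fun i => {v | ∃ a ∈ H i, Near G K a v} with hN
  have hN01 : ∀ v, v ∈ N 0 → v ∈ N 1 → False := by
    rintro v ⟨a, ha, hav⟩ ⟨b, hb, hbv⟩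
    exact farApart_iff.1 hH a ha b hb _ (by omega) (hav.trans hbv.symm)
  obtain ⟨x, hx, y, hy, p, -, hpP, hpA, hpB⟩ := exists_isPath_of_conn (A := N 0) (B := N 1)
    ⟨a, ha, Near.refl _ _⟩ ⟨b, hb, Near.refl _ _⟩ hP
  -- The path joins the `K`-balls of the two hubs and meets each in one end only. If that end were
  -- nearer than `K` to the hub, its neighbour on the path would lie in the ball as well.
  have first : ∀ {i x y} (p : G.Walk x y), (∀ z ∈ p.support, z ∈ N i → z = x) → y ∉ N i →
      ∀ a ∈ H i, ∀ m < K, ¬ Near G m x a := by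
    intro i x y p hp hy a ha m hm hn
    cases p with
    | nil => exact hy ⟨a, ha, (hn.mono hm.le).symm⟩
    | cons h q =>
      rename_i z
      have hz : z ∈ N i := ⟨a, ha, (hn.symm.trans (Near.of_adj h)).mono hm⟩
      exact h.ne' (hp z (by simp) hz)
  have arm : ∀ {i x}, x ∈ N i → x ∈ p.support → ∃ E : Set V, SConn G E ∧ (E ∩ H i).Nonempty ∧
      (E ∩ {z | z ∈ p.support}).Nonempty ∧ (∀ u ∈ E, ∃ a ∈ H i, Near G K a u) ∧
        ∀ u ∈ E, ∃ x ∈ {z | z ∈ p.support}, Near G K x u := by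
    rintro i x ⟨a, ha, q, hq⟩ hxp
    refine ⟨{z | z ∈ q.support}, sconn_support q, ⟨a, q.start_mem_support, ha⟩,
      ⟨x, q.end_mem_support, hxp⟩, fun u hu => ⟨a, ha, q.takeUntil u hu, ?_⟩,
      fun u hu => ⟨x, hxp, Near.symm ⟨q.dropUntil u hu, ?_⟩⟩⟩
    · exact (q.length_takeUntil_le_length hu).trans hq
    · exact (q.length_dropUntil_le_length hu).trans hq
  obtain ⟨E0, h0⟩ := arm hx p.start_mem_support
  obtain ⟨E1, h1⟩ := arm hy p.end_mem_support
  refine ⟨{z | z ∈ p.support}, ![E0, E1], sconn_support p, hpP, ?_, ?_⟩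
  · intro i
    rw [farApart_iff]
    intro u hu a ha m hm hn
    fin_cases i
    · have hu0 := hpA u hu ⟨a, ha, (hn.mono hm.le).symm⟩
      subst hu0
      exact first p hpA (fun h => hN01 _ h hy) a ha m hm hn
    · have hu1 := hpB u hu ⟨a, ha, (hn.mono hm.le).symm⟩
      subst hu1
      exact first p.reverse (by simpa using hpB) (fun h => hN01 _ hx h) a ha m hm hn
  · intro i
    fin_cases i
    exacts [h0, h1]

theorem K2_mem_edgeSet {e : Sym2 (Fin 2 ⊕ Fin t)} :
    e ∈ (K2 t).edgeSet ↔ ∃ i j, e = s(.inl i, .inr j) := by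
  constructor
  · induction e with
    | h x y =>
      intro h
      replace h : (completeBipartiteGraph (Fin 2) (Fin t)).Adj x y := h
      rcases x with i | j <;> rcases y with i' | j' <;> simp at h
      · exact ⟨i, j', rfl⟩
      · exact ⟨i', j, Sym2.eq_swap⟩
  · rintro ⟨i, j, rfl⟩
    change (completeBipartiteGraph (Fin 2) (Fin t)).Adj _ _
    simp

theorem K2_inc {i : Fin 2} {j : Fin t} {x : Fin 2 ⊕ Fin t} :
    (K2 t).Inc s(.inl i, .inr j) x ↔ x = .inl i ∨ x = .inr j := by
  have hl : (K2 t).IsLink s(.inl i, .inr j) (.inl i) (.inr j) :=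
    ⟨rfl, K2_mem_edgeSet.2 ⟨i, j, rfl⟩⟩
  constructor
  · intro h; exact h.eq_or_eq_of_isLink hl
  · rintro (rfl | rfl)
    exacts [hl.inc_left, hl.inc_right]

/-- Two far apart hubs joined by `t` sets that are far apart outside the hubs yield a fat
`K_{2,t}` minor. -/
theorem isFatMinor_K2 (hK : 0 < K) {A B : Set V} (hA : SConn G A) (hB : SConn G B)
    (hAB : FarApart G (3 * K) A B) (P : Fin t → Set V)
    (hP : ∀ j, ∃ a ∈ A, ∃ b ∈ B, Conn G (P j) a b)
    (hPP : ∀ j k, j ≠ k → FarApart G (3 * K) (P j \ (A ∪ B)) (P k \ (A ∪ B))) :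
    IsFatMinor K (K2 t) G := by
  classical
  set H : Fin 2 → Set V := ![A, B] with hHdef
  have hHc : ∀ i, SConn G (H i) := by
    intro i; fin_cases i
    exacts [hA, hB]
  have hHH : ∀ i i', i ≠ i' → FarApart G (3 * K) (H i) (H i') := by
    intro i i' h
    fin_cases i <;> fin_cases i' <;> first | exact absurd rfl h | exact hAB | exact hAB.symm
  choose x hx y hy hxy using hP
  have hmid := fun j => exists_middle hK H hAB (hx j) (hy j) (hxy j)
  choose U E hU hUP hUH hE using hmid
  choose hE hEH hEU hEH' hEU' using hE
  have hUsub : ∀ j, U j ⊆ P j \ (A ∪ B) := fun j u hu => ⟨hUP j hu, by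
    rintro (h | h)
    · exact Set.disjoint_left.1 ((hUH j 0).disjoint hK) hu h
    · exact Set.disjoint_left.1 ((hUH j 1).disjoint hK) hu h⟩
  have hUU : ∀ j k, j ≠ k → FarApart G (3 * K) (U j) (U k) := fun j k h =>
    (hPP j k h).mono (hUsub j) (hUsub k)
  set C : Sym2 (Fin 2 ⊕ Fin t) → Set V := fun e => {v | ∃ i j, e = s(.inl i, .inr j) ∧ v ∈ E j i}
    with hCdef
  have hC : ∀ i j, C s(.inl i, .inr j) = E j i := by
    intro i j
    ext v
    constructor
    · rintro ⟨i', j', h, hv⟩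
      rw [Sym2.eq_iff] at h
      simp only [Sum.inl.injEq, Sum.inr.injEq, reduceCtorEq, and_self, or_false] at h
      obtain ⟨rfl, rfl⟩ := h
      exact hv
    · intro hv
      exact ⟨i, j, rfl, hv⟩
  refine isFatMinor_of_sets hK (Sum.elim H U) C ?_ ?_ ?_ ?_ ?_ ?_
  · rintro (i | j) -
    exacts [hHc i, hU j]
  · intro e he
    obtain ⟨i, j, rfl⟩ := K2_mem_edgeSet.1 he
    rw [hC]; exact hE j i
  · intro e x hx
    obtain ⟨i, j, rfl⟩ := K2_mem_edgeSet.1 hx.edge_mem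
    rw [hC]
    rcases K2_inc.1 hx with rfl | rfl
    exacts [hEH j i, hEU j i]
  · rintro (i | j) - (i' | j') - h
    · exact fun a ha b hb => le_trans (by norm_cast; omega)
        (hHH i i' (fun h' => h (by rw [h'])) a ha b hb)
    · exact (hUH j' i).symm
    · exact hUH j i'
    · exact fun a ha b hb => le_trans (by norm_cast; omega)
        (hUU j j' (fun h' => h (by rw [h'])) a ha b hb)
  · intro e he f hf hef
    obtain ⟨i, j, rfl⟩ := K2_mem_edgeSet.1 he
    obtain ⟨i', j', rfl⟩ := K2_mem_edgeSet.1 hf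
    rw [hC, hC, farApart_iff]
    intro u hu v hv m hm hn
    -- Arms at the same middle piece lie within `K` of different hubs, and other arms within `K` of
    -- different middle pieces. Either way `K + m + K < 3 * K` contradicts the assumed separation.
    by_cases hj : j = j'
    · subst hj
      have hi : i ≠ i' := fun h => hef (by rw [h])
      obtain ⟨a, ha, hau⟩ := hEH' j i u hu
      obtain ⟨b, hb, hbv⟩ := hEH' j i' v hv
      exact farApart_iff.1 (hHH i i' hi) a ha b hb _ (by omega) ((hau.trans hn).trans hbv.symm)
    · obtain ⟨a, ha, hau⟩ := hEU' j i u hu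
      obtain ⟨b, hb, hbv⟩ := hEU' j' i' v hv
      exact farApart_iff.1 (hUU j j' hj) a ha b hb _ (by omega) ((hau.trans hn).trans hbv.symm)
  · intro e he z hz hez
    obtain ⟨i, j, rfl⟩ := K2_mem_edgeSet.1 he
    rw [K2_inc] at hez
    push Not at hez
    rw [hC, farApart_iff]
    intro u hu v hv m hm hn
    rcases z with i' | j'
    · obtain ⟨a, ha, hau⟩ := hEH' j i u hu
      exact farApart_iff.1 (hHH i i' (fun h => hez.1 (by rw [h]))) a ha v hv _ (by omega)
        (hau.trans hn)
    · obtain ⟨a, ha, hau⟩ := hEU' j i u hu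
      exact farApart_iff.1 (hUU j j' (fun h => hez.2 (by rw [h]))) a ha v hv _ (by omega)
        (hau.trans hn)

end K2

/-! ### Distance levels -/

section Level

variable {V : Type*} {G : SimpleGraph V}

/-- `lev` is the distance to a root chosen in each component of `G`. -/
structure IsLevel (G : SimpleGraph V) (lev : V → ℕ) : Prop where
  adj : ∀ x y, G.Adj x y → lev y ≤ lev x + 1
  down : ∀ x, lev x ≠ 0 → ∃ y, G.Adj x y ∧ lev y + 1 = lev x
  root : ∀ x y, G.Reachable x y → lev x = 0 → lev y = 0 → x = y

theorem exists_isLevel (G : SimpleGraph V) : ∃ lev, IsLevel G lev := by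
  classical
  let r : V → V := fun v => (G.connectedComponentMk v).out
  have hr : ∀ v, G.Reachable (r v) v := fun v =>
    ConnectedComponent.exact (Quot.out_eq (G.connectedComponentMk v))
  have hr' : ∀ x y, G.Reachable x y → r x = r y := fun x y h => by
    simp only [r, ConnectedComponent.sound h]
  refine ⟨fun v => G.dist (r v) v, ⟨fun x y h => ?_, fun x hx => ?_, fun x y h hx hy => ?_⟩⟩
  · obtain ⟨p, hp⟩ := (hr x).exists_walk_length_eq_dist
    rw [← hr' x y h.reachable, ← hp]
    simpa using dist_le (p.concat h)
  · obtain ⟨p, hp⟩ := (hr x).symm.exists_walk_length_eq_dist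
    rw [SimpleGraph.dist_comm] at hp
    generalize hrx : r x = z at p hp hx
    cases p with
    | nil => exact absurd hp.symm hx
    | cons h q =>
      rename_i y
      subst hrx
      refine ⟨y, h, ?_⟩
      have h1 : r x = r y := hr' x y h.reachable
      have h2 : G.dist (r x) y ≤ q.length := by rw [SimpleGraph.dist_comm]; exact dist_le q
      obtain ⟨p', hp'⟩ := (hr y).exists_walk_length_eq_dist
      have h3 : G.dist (r x) x ≤ G.dist (r y) y + 1 := by
        rw [h1, ← hp']
        simpa using dist_le (p'.concat h.symm)
      simp only [Walk.length_cons] at hp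
      rw [← h1] at h3 ⊢
      omega
  · have hx' : r x = x := ((hr x).dist_eq_zero_iff).1 hx
    have hy' : r y = y := ((hr y).dist_eq_zero_iff).1 hy
    rw [← hx', ← hy', hr' x y h]

/-- The vertices of level at least `n`. -/
def Above (lev : V → ℕ) (n : ℕ) : Set V := {x | n ≤ lev x}

/-- The vertices of level between `m` and `n`. -/
def Slab (lev : V → ℕ) (m n : ℕ) : Set V := {x | m ≤ lev x ∧ lev x ≤ n}

theorem slab_subset {lev : V → ℕ} {m n m' n' : ℕ} (hm : m' ≤ m) (hn : n ≤ n') :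
    Slab lev m n ⊆ Slab lev m' n' := fun _ h => ⟨hm.trans h.1, h.2.trans hn⟩

theorem above_subset {lev : V → ℕ} {m m' : ℕ} (hm : m' ≤ m) :
    Above lev m ⊆ Above lev m' := fun _ h => hm.trans h

variable {lev : V → ℕ} (hlev : IsLevel G lev)
include hlev

theorem IsLevel.descent {n : ℕ} {x : V} (h : n ≤ lev x) :
    ∃ y, lev y = n ∧ ∃ p : G.Walk x y, p.length = lev x - n ∧
      ∀ z ∈ p.support, z ∈ Slab lev n (lev x) := by
  obtain ⟨k, hk⟩ := Nat.exists_eq_add_of_le h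
  induction k generalizing x with
  | zero => exact ⟨x, by simpa using hk, .nil, by simp [hk], by simp [hk, Slab]⟩
  | succ k ih =>
    obtain ⟨y, hxy, hy⟩ := hlev.down x (by omega)
    obtain ⟨z, hz, p, hp, hps⟩ := ih (x := y) (by omega) (by omega)
    refine ⟨z, hz, .cons hxy p, by simp; omega, ?_⟩
    simp only [Walk.support_cons, List.mem_cons, forall_eq_or_imp]
    exact ⟨⟨h, le_rfl⟩, fun w hw => slab_subset le_rfl (by omega) (hps w hw)⟩

theorem IsLevel.le_of_mem_support {x y z : V} (p : G.Walk x y) (hz : z ∈ p.support) :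
    lev z ≤ lev x + p.length ∧ lev x ≤ lev z + p.length := by
  induction p with
  | nil => simp at hz; simp [hz]
  | cons h q ih =>
    rename_i a b c
    have h1 := hlev.adj _ _ h
    have h2 := hlev.adj _ _ h.symm
    simp only [Walk.support_cons, List.mem_cons, Walk.length_cons] at hz ⊢
    rcases hz with rfl | hz
    · omega
    · have := ih hz
      omega

theorem IsLevel.near {m : ℕ} {x y : V} (h : Near G m x y) :
    lev y ≤ lev x + m ∧ lev x ≤ lev y + m := by
  obtain ⟨p, hp⟩ := h
  have := hlev.le_of_mem_support p p.end_mem_support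
  omega

theorem IsLevel.conn_of_near {m : ℕ} {x y : V} (h : Near G m x y) :
    Conn G (Slab lev (lev x - m) (lev x + m)) x y := by
  obtain ⟨p, hp⟩ := h
  refine ⟨p, fun z hz => ?_⟩
  have := hlev.le_of_mem_support p hz
  exact ⟨by omega, by omega⟩

/-- Both vertices descend to the only vertex of level zero in their component. -/
theorem IsLevel.conn_low {n : ℕ} {x y : V} (hxy : G.Reachable x y) (hx : lev x ≤ n)
    (hy : lev y ≤ n) : Conn G (Slab lev 0 n) x y := by
  obtain ⟨x', hx', p, -, hp⟩ := hlev.descent (Nat.zero_le (lev x))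
  obtain ⟨y', hy', q, -, hq⟩ := hlev.descent (Nat.zero_le (lev y))
  obtain rfl := hlev.root x' y' ((p.reachable.symm.trans hxy).trans q.reachable) hx' hy'
  have h1 : Conn G (Slab lev 0 n) x x' := ⟨p, fun z hz => slab_subset le_rfl hx (hp z hz)⟩
  have h2 : Conn G (Slab lev 0 n) y x' := ⟨q, fun z hz => slab_subset le_rfl hy (hq z hz)⟩
  exact h1.trans h2.symm

theorem IsLevel.sconn_low {n : ℕ} {x : V} (hx : lev x ≤ n) :
    SConn G {y | lev y ≤ n ∧ G.Reachable x y} := by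
  refine ⟨⟨x, hx, .refl _⟩, fun y hy z hz => ?_⟩
  have h := (hlev.conn_low (hy.2.symm.trans hz.2) hy.1 hz.1).inter
    (T := {w | G.Reachable x w}) hy.2 fun a ha b hab _ => ha.trans hab.reachable
  exact h.mono fun w hw => ⟨hw.1.2, hw.2⟩

/-- Among `t` vertices of level `n` in the same component of the graph above level `n`, some two
are joined by a short walk that stays near level `n`. -/
theorem IsLevel.exists_short {K t n : ℕ} (hK : 0 < K) (ht : 2 ≤ t)
    (hG : ¬ IsFatMinor K (K2 t) G) (z : Fin t → V) (hz : ∀ j, lev (z j) = n)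
    (hc : ∀ j k, Conn G (Above lev n) (z j) (z k)) :
    ∃ j k, j ≠ k ∧ ∃ p : G.Walk (z j) (z k), p.length < 9 * K ∧
      ∀ x ∈ p.support, x ∈ Slab lev (n - 6 * K) (n + 3 * K) := by
  by_cases hn : 3 * K ≤ n
  · have hd : ∀ j, ∃ y, lev y = n - 3 * K ∧ ∃ p : G.Walk (z j) y, p.length = 3 * K ∧
        ∀ x ∈ p.support, x ∈ Slab lev (n - 3 * K) n := by
      intro j
      obtain ⟨y, hy, p, hp, hps⟩ := hlev.descent (n := n - 3 * K) (x := z j) (by rw [hz]; omega)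
      rw [hz] at hp hps
      exact ⟨y, hy, p, by omega, hps⟩
    choose y hy p hp hps using hd
    let j₀ : Fin t := ⟨0, by omega⟩
    by_contra! hcon
    -- The hubs are the component above level `n` and the low part up to level `n - 3 * K`, joined
    -- by descents of length `3 * K`. If two descents come nearer than `3 * K` to each other,
    -- following one, crossing over and returning along the other takes fewer than `9 * K` steps.
    refine hG (isFatMinor_K2 hK (A := {x | Conn G (Above lev n) (z j₀) x})
      (B := {x | lev x ≤ n - 3 * K ∧ G.Reachable (y j₀) x}) ⟨⟨z j₀, hc _ _⟩, fun a ha b hb => ?_⟩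
      (hlev.sconn_low (hy _).le) ?_ (fun j => {x | x ∈ (p j).support})
      (fun j => ⟨z j, hc _ _, y j, ⟨(hy j).le, ?_⟩, Conn.of_walk _⟩) ?_)
    · have h : ∀ a, Conn G (Above lev n) (z j₀) a →
          Conn G {x | Conn G (Above lev n) (z j₀) x} (z j₀) a := fun a ha =>
        (ha.inter (T := {x | Conn G (Above lev n) (z j₀) x}) (Conn.refl (hz j₀).ge)
          fun c hc d hcd hd => hc.trans (Conn.of_adj hcd hc.right_mem hd)).mono
          Set.inter_subset_right
      exact (h a ha).symm.trans (h b hb)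
    · rw [farApart_iff]
      intro a ha b hb m hm hn'
      have h1 := hlev.near hn'
      have h2 : a ∈ Above lev n := Conn.right_mem (S := Above lev n) ha
      simp only [Above, Set.mem_ofPred_eq] at h2
      have h3 := hb.1
      omega
    · exact ((p j₀).reachable.symm.trans (hc _ _).reachable).trans (p j).reachable
    · intro j k hjk
      rw [farApart_iff]
      rintro u ⟨hu, -⟩ v ⟨hv, -⟩ m hm ⟨q, hq⟩
      classical
      obtain ⟨x, hx, hx'⟩ := hcon j k hjk
        ((((p j).takeUntil u hu).append q).append ((p k).takeUntil v hv).reverse) (by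
          have h1 := (p j).length_takeUntil_le_length hu
          have h2 := (p k).length_takeUntil_le_length hv
          rw [hp] at h1 h2
          simp only [Walk.length_append, Walk.length_reverse]
          omega)
      apply hx'
      rw [Walk.mem_support_append_iff, Walk.mem_support_append_iff, Walk.support_reverse,
        List.mem_reverse] at hx
      rcases hx with (hx | hx) | hx
      · exact slab_subset (by omega) (by omega)
          (hps j x ((p j).support_takeUntil_subset_support hu hx))
      · have h1 := hlev.le_of_mem_support q hx
        have h2 := hps j u hu
        exact ⟨by have := h2.1; omega, by have := h2.2; omega⟩
      · exact slab_subset (by omega) (by omega)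
          (hps k x ((p k).support_takeUntil_subset_support hv hx))
  -- Near the root there is no room for a lower hub, but any two of the vertices are joined through
  -- the root by `2 * n < 6 * K` steps.
  · refine ⟨⟨0, by omega⟩, ⟨1, by omega⟩, by simp, ?_⟩
    generalize (⟨0, by omega⟩ : Fin t) = j
    generalize (⟨1, by omega⟩ : Fin t) = k
    obtain ⟨x, hx, p, hpl, hp⟩ := hlev.descent (Nat.zero_le (lev (z j)))
    obtain ⟨y, hy, q, hql, hq⟩ := hlev.descent (Nat.zero_le (lev (z k)))
    obtain rfl := hlev.root x y ((p.reachable.symm.trans (hc j k).reachable).trans q.reachable)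
      hx hy
    rw [hz] at hpl hp hql hq
    refine ⟨p.append q.reverse, by simp; omega, fun w hw => ?_⟩
    rw [Walk.mem_support_append_iff, Walk.support_reverse, List.mem_reverse] at hw
    rcases hw with hw | hw
    · exact slab_subset (by omega) (by omega) (hp w hw)
    · exact slab_subset (by omega) (by omega) (hq w hw)

end Level

end FatMinor

namespace FatMinor

open SimpleGraph

/-! ### Lifting models along far apart representatives -/

section Thick

variable {V W : Type*} {G : SimpleGraph V} {H : SimpleGraph W} {K : ℕ} {N : Set W}
  {U : W → Set V} {E : Sym2 W → Set V}

/-- A family of sets of vertices of `G` that are far apart and represent the nodes in `N` of a graph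
`H` and the edges between them. -/
structure Thick (G : SimpleGraph V) (H : SimpleGraph W) (K : ℕ) (N : Set W)
    (U : W → Set V) (E : Sym2 W → Set V) : Prop where
  sconn_set : ∀ h ∈ N, SConn G (U h)
  sconn_strand : ∀ g ∈ N, ∀ h ∈ N, H.Adj g h → SConn G (E s(g, h))
  inter : ∀ g ∈ N, ∀ h ∈ N, H.Adj g h → (E s(g, h) ∩ U g).Nonempty
  set_set : ∀ g ∈ N, ∀ h ∈ N, g ≠ h → FarApart G K (U g) (U h)
  strand_set : ∀ g ∈ N, ∀ h ∈ N, H.Adj g h → ∀ k ∈ N, k ≠ g → k ≠ h →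
    FarApart G K (E s(g, h)) (U k)
  strand_strand : ∀ g ∈ N, ∀ h ∈ N, H.Adj g h → ∀ g' ∈ N, ∀ h' ∈ N, H.Adj g' h' →
    s(g, h) ≠ s(g', h') → FarApart G K (E s(g, h)) (E s(g', h'))

/-- The union of the sets that represent the nodes in `A` and the edges in `B`. -/
def realize (U : W → Set V) (E : Sym2 W → Set V) (A : Set W) (B : Set (Sym2 W)) : Set V :=
  {z | (∃ h ∈ A, z ∈ U h) ∨ ∃ e ∈ B, z ∈ E e}

theorem set_subset_realize {A : Set W} {B : Set (Sym2 W)} {h : W} (hh : h ∈ A) :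
    U h ⊆ realize U E A B := fun _ hz => .inl ⟨h, hh, hz⟩

theorem strand_subset_realize {A : Set W} {B : Set (Sym2 W)} {e : Sym2 W} (he : e ∈ B) :
    E e ⊆ realize U E A B := fun _ hz => .inr ⟨e, he, hz⟩

theorem Thick.inter_right (hT : Thick G H K N U E) {g h : W} (hg : g ∈ N) (hh : h ∈ N)
    (hgh : H.Adj g h) : (E s(g, h) ∩ U h).Nonempty := by
  rw [Sym2.eq_swap]
  exact hT.inter h hh g hg hgh.symm

/-- The assumptions `hBA` and `hAB` exclude the pairs about which `Thick` says nothing: a strand and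
the set of one of its own ends. -/
theorem Thick.realize_farApart (hT : Thick G H K N U E) {A A' : Set W} {B B' : Set (Sym2 W)}
    (hA : A ⊆ N) (hA' : A' ⊆ N) (hB : ∀ g h, s(g, h) ∈ B → H.Adj g h ∧ g ∈ N ∧ h ∈ N)
    (hB' : ∀ g h, s(g, h) ∈ B' → H.Adj g h ∧ g ∈ N ∧ h ∈ N) (hAA : Disjoint A A')
    (hBB : Disjoint B B') (hBA : ∀ e ∈ B, ∀ h ∈ A', h ∉ e) (hAB : ∀ e ∈ B', ∀ h ∈ A, h ∉ e) :
    FarApart G K (realize U E A B) (realize U E A' B') := by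
  rintro a (⟨h, hh, ha⟩ | ⟨e, he, ha⟩) b (⟨k, hk, hb⟩ | ⟨f, hf, hb⟩)
  · exact hT.set_set h (hA hh) k (hA' hk) (fun h => Set.disjoint_left.1 hAA hh (h ▸ hk)) a ha b hb
  · induction f with
    | h g k =>
      obtain ⟨h1, h2, h3⟩ := hB' g k hf
      have hn := hAB _ hf h hh
      simp only [Sym2.mem_iff, not_or] at hn
      exact (hT.strand_set g h2 k h3 h1 h (hA hh) hn.1 hn.2).symm a ha b hb
  · induction e with
    | h g h =>
      obtain ⟨h1, h2, h3⟩ := hB g h he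
      have hn := hBA _ he k hk
      simp only [Sym2.mem_iff, not_or] at hn
      exact hT.strand_set g h2 h h3 h1 k (hA' hk) hn.1 hn.2 a ha b hb
  · induction e with
    | h g h =>
    induction f with
    | h g' h' =>
      obtain ⟨h1, h2, h3⟩ := hB g h he
      obtain ⟨h1', h2', h3'⟩ := hB' g' h' hf
      exact hT.strand_strand g h2 h h3 h1 g' h2' h' h3' h1'
        (fun h => Set.disjoint_left.1 hBB he (h ▸ hf)) a ha b hb

theorem Thick.sconn_realize (hT : Thick G H K N U E) {A : Set W} (hA : SConn H A) (hAN : A ⊆ N) :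
    SConn G (realize U E A {e | e ∈ H.edgeSet ∧ ∀ h ∈ e, h ∈ A}) := by
  set R := realize U E A {e | e ∈ H.edgeSet ∧ ∀ h ∈ e, h ∈ A} with hR
  have hU : ∀ h ∈ A, ∀ x ∈ U h, ∀ y ∈ U h, Conn G R x y := fun h hh x hx y hy =>
    ((hT.sconn_set h (hAN hh)).2 x hx y hy).mono (set_subset_realize hh)
  have hstep : ∀ g ∈ A, ∀ h ∈ A, H.Adj g h → ∃ x ∈ U g, ∃ y ∈ U h, Conn G R x y := by
    intro g hg h hh hgh
    obtain ⟨x, hx, hxU⟩ := hT.inter g (hAN hg) h (hAN hh) hgh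
    obtain ⟨y, hy, hyU⟩ := hT.inter_right (hAN hg) (hAN hh) hgh
    refine ⟨x, hxU, y, hyU, ((hT.sconn_strand g (hAN hg) h (hAN hh) hgh).2 x hx y hy).mono
      (strand_subset_realize ⟨hgh, ?_⟩)⟩
    simp [hg, hh]
  obtain ⟨h₀, hh₀⟩ := hA.1
  obtain ⟨x₀, hx₀⟩ := (hT.sconn_set h₀ (hAN hh₀)).1
  have hall : ∀ h ∈ A, ∀ y ∈ U h, Conn G R x₀ y := by
    intro h hh
    refine ((hA.2 h₀ hh₀ h hh).mem_of_closed (T := {h | h ∈ A ∧ ∀ y ∈ U h, Conn G R x₀ y})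
      ⟨hh₀, hU h₀ hh₀ x₀ hx₀⟩ ?_).2
    rintro a ⟨ha, ha'⟩ b hab hb
    obtain ⟨x, hx, y, hy, hxy⟩ := hstep a ha b hb hab
    exact ⟨hb, fun z hz => ((ha' x hx).trans hxy).trans (hU b hb y hy z hz)⟩
  have hall' : ∀ z ∈ R, Conn G R x₀ z := by
    rintro z (⟨h, hh, hz⟩ | ⟨e, he, hz⟩)
    · exact hall h hh z hz
    · induction e with
      | h g h =>
        obtain ⟨hgh, hmem⟩ := he
        have hg : g ∈ A := hmem g (by simp)
        have hh : h ∈ A := hmem h (by simp)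
        obtain ⟨x, hx, hxU⟩ := hT.inter g (hAN hg) h (hAN hh) hgh
        exact (hall g hg x hxU).trans
          (((hT.sconn_strand g (hAN hg) h (hAN hh) hgh).2 x hx z hz).mono
          (strand_subset_realize ⟨hgh, hmem⟩))
  exact ⟨⟨x₀, .inl ⟨h₀, hh₀, hx₀⟩⟩, fun x hx y hy => (hall' x hx).symm.trans (hall' y hy)⟩

/-- The sets representing the edges and inner vertices of a path form a connected set. -/
theorem Thick.sconn_path (hT : Thick G H K N U E) {a b : W} (p : H.Walk a b) (hp : p.IsPath)
    (hab : a ≠ b) (hN : ∀ h ∈ p.support, h ∈ N) :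
    SConn G (realize U E {h | h ∈ p.support ∧ h ≠ a ∧ h ≠ b} {e | e ∈ p.edges}) ∧
      (realize U E {h | h ∈ p.support ∧ h ≠ a ∧ h ≠ b} {e | e ∈ p.edges} ∩ U a).Nonempty := by
  induction p with
  | nil => exact absurd rfl hab
  | @cons a d b h q ih =>
    have ha : a ∈ N := hN a (by simp)
    have hd : d ∈ N := hN d (by simp)
    have hE := hT.sconn_strand a ha d hd h
    obtain ⟨hq, haq⟩ := (Walk.cons_isPath_iff _ _).1 hp
    have hsub : E s(a, d) ⊆ realize U E {k | k ∈ (Walk.cons h q).support ∧ k ≠ a ∧ k ≠ b}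
        {e | e ∈ (Walk.cons h q).edges} := strand_subset_realize (by simp)
    refine ⟨?_, (hT.inter a ha d hd h).mono (Set.inter_subset_inter_left _ hsub)⟩
    by_cases hdb : d = b
    · subst hdb
      obtain rfl := Walk.eq_nil_iff_nil.2 (Walk.isPath_iff_nil.1 hq)
      convert hE using 1
      ext z
      constructor
      · rintro (⟨k, ⟨hk, hka, hkd⟩, hz⟩ | ⟨e, he, hz⟩)
        · simp at hk
          tauto
        · simp at he
          rwa [← he]
      · exact fun hz => hsub hz
    · obtain ⟨h1, h2⟩ := ih hq hdb fun k hk => hN k (by simp [hk])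
      have h3 := (hE.union (hT.sconn_set d hd) (hT.inter_right ha hd h)).union h1
        (h2.mono fun z hz => ⟨.inr hz.2, hz.1⟩)
      convert h3 using 1
      ext z
      constructor
      · rintro (⟨k, ⟨hk, hka, hkb⟩, hz⟩ | ⟨e, he, hz⟩)
        · simp only [Walk.support_cons, List.mem_cons] at hk
          by_cases hkd : k = d
          · exact .inl (.inr (hkd ▸ hz))
          · exact .inr (.inl ⟨k, ⟨hk.resolve_left hka, hkd, hkb⟩, hz⟩)
        · simp only [Walk.edges_cons, List.mem_cons, Set.mem_ofPred_eq] at he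
          rcases he with rfl | he
          · exact .inl (.inl hz)
          · exact .inr (.inr ⟨e, he, hz⟩)
      · rintro ((hz | hz) | (⟨k, ⟨hk, hkd, hkb⟩, hz⟩ | ⟨e, he, hz⟩))
        · exact hsub hz
        · exact .inl ⟨d, ⟨by simp, h.ne', hdb⟩, hz⟩
        · exact .inl ⟨k, ⟨by simp [hk], fun h => haq (h ▸ hk), hkb⟩, hz⟩
        · exact .inr ⟨e, List.mem_cons_of_mem _ he, hz⟩

/-- A path does not return to its first vertex, so an edge between its two ends is all of it. This
rules out branch paths with a common edge: the ends of that edge would be the ends of both paths,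
which would then coincide. -/
theorem toSubgraph_eq_of_mem_edges {a b : W} (p : H.Walk a b) (hp : p.IsPath) {x y : W}
    (hxy : H.Adj x y) (he : s(x, y) ∈ p.edges) (hx : x = a ∨ x = b) (hy : y = a ∨ y = b) :
    p.toSubgraph = H.subgraphOfAdj hxy := by
  have key : s(a, b) ∈ p.edges → a ≠ b → ∃ h : H.Adj a b, p.toSubgraph = H.subgraphOfAdj h := by
    intro he hab
    cases p with
    | nil => exact absurd rfl hab
    | @cons _ d _ h q =>
      obtain ⟨hq, haq⟩ := (Walk.cons_isPath_iff _ _).1 hp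
      simp only [Walk.edges_cons, List.mem_cons] at he
      rcases he with he | he
      · obtain rfl : d = b := by
          rcases Sym2.eq_iff.1 he with ⟨-, h'⟩ | ⟨h', h''⟩
          exacts [h'.symm, absurd h'' hab.symm]
        obtain rfl := Walk.eq_nil_iff_nil.2 (Walk.isPath_iff_nil.1 hq)
        exact ⟨h, by simp⟩
      · exact absurd (q.fst_mem_support_of_mem_edges he) haq
  rcases hx with rfl | rfl <;> rcases hy with rfl | rfl
  · exact absurd rfl hxy.ne
  · exact (key he hxy.ne).2
  · rw [Sym2.eq_swap] at he
    rw [(key he hxy.ne').2]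
    exact subgraphOfAdj_symm hxy
  · exact absurd rfl hxy.ne

theorem Model.exists_path {α β : Type*} {J : Graph α β} (M : Model J H) (hJ : J.Loopless)
    {e : β} {x y : α} (hxy : J.IsLink e x y) : ∃ (a b : W) (p : H.Walk a b), p.IsPath ∧ a ≠ b ∧
      M.branchPath e = p.toSubgraph ∧ (∀ h ∈ p.support, h ∈ M.branchSet x ↔ h = a) ∧
      (∀ h ∈ p.support, h ∈ M.branchSet y ↔ h = b) := by
  obtain ⟨a, b, p, hp, hpe, ha, hb⟩ := M.isSetPath e x y hxy
  have hax : ∀ h ∈ p.support, h ∈ M.branchSet x ↔ h = a := by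
    intro h hh
    rw [hpe, Walk.verts_toSubgraph] at ha
    rw [← Set.mem_singleton_iff, ← ha]
    exact ⟨fun h' => ⟨hh, h'⟩, fun h' => h'.2⟩
  have hbx : ∀ h ∈ p.support, h ∈ M.branchSet y ↔ h = b := by
    intro h hh
    rw [hpe, Walk.verts_toSubgraph] at hb
    rw [← Set.mem_singleton_iff, ← hb]
    exact ⟨fun h' => ⟨hh, h'⟩, fun h' => h'.2⟩
  refine ⟨a, b, p, hp, ?_, hpe, hax, hbx⟩
  rintro rfl
  have hne : x ≠ y := fun h => by
    subst h
    exact (hJ.not_isLoopAt e x) hxy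
  exact Set.disjoint_left.1 (M.disjoint x hxy.left_mem y hxy.right_mem hne)
    ((hax a p.start_mem_support).2 rfl) ((hbx a p.start_mem_support).2 rfl)

/-- If a model of a multigraph in `H` runs within a set of nodes that are represented by sets of
vertices of `G` far apart, then it gives rise to a fat model in `G`. -/
theorem Thick.isFatMinor (hT : Thick G H K N U E) (hK : 0 < K) {α β : Type*} {J : Graph α β}
    (M : Model J H) (hJ : J.Loopless) (hP : ∀ e ∈ J.edgeSet, (M.branchPath e).verts ⊆ N)
    (hU : ∀ x ∈ J.vertexSet, SConn H (M.branchSet x ∩ N)) : IsFatMinor K J G := by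
  have hPB : ∀ e ∈ J.edgeSet, ∀ g h, s(g, h) ∈ (M.branchPath e).edgeSet →
      H.Adj g h ∧ g ∈ N ∧ h ∈ N := fun e he g h hgh =>
    ⟨(M.branchPath e).adj_sub hgh, hP e he ((M.branchPath e).edge_vert hgh),
      hP e he ((M.branchPath e).edge_vert hgh.symm)⟩
  have hmem : ∀ e, ∀ s ∈ (M.branchPath e).edgeSet, ∀ h ∈ s, h ∈ (M.branchPath e).verts := by
    intro e s hs h hh
    exact (M.branchPath e).mem_verts_of_mem_edge hs hh
  have hUB : ∀ x g h, s(g, h) ∈ {e | e ∈ H.edgeSet ∧ ∀ h ∈ e, h ∈ M.branchSet x ∩ N} →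
      H.Adj g h ∧ g ∈ N ∧ h ∈ N := by
    rintro x g h ⟨hgh, hm⟩
    exact ⟨hgh, (hm g (by simp)).2, (hm h (by simp)).2⟩
  -- A branch set takes the sets of its nodes in `N` and all strands between them. A branch path
  -- takes its strands and the sets of its inner nodes only, since those of its end nodes belong to
  -- the branch sets.
  refine isFatMinor_of_sets hK
    (fun x => realize U E (M.branchSet x ∩ N) {e | e ∈ H.edgeSet ∧ ∀ h ∈ e, h ∈ M.branchSet x ∩ N})
    (fun e => realize U E {h | h ∈ (M.branchPath e).verts ∧ ∀ x, J.Inc e x → h ∉ M.branchSet x}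
      (M.branchPath e).edgeSet)
    (fun x hx => hT.sconn_realize (hU x hx) Set.inter_subset_right) ?_ ?_ ?_ ?_ ?_
  · intro e he
    obtain ⟨x, y, hxy⟩ := J.exists_isLink_of_mem_edgeSet he
    obtain ⟨a, b, p, hp, hab, hpe, ha, hb⟩ := M.exists_path hJ hxy
    convert (hT.sconn_path p hp hab fun h hh => hP e he (by simpa [hpe] using hh)).1 using 2
    · ext h
      simp only [hpe, Walk.verts_toSubgraph, Set.mem_ofPred_eq]
      refine and_congr_right fun hh => ?_
      rw [Ne, Ne, ← not_iff_not.2 (ha h hh), ← not_iff_not.2 (hb h hh)]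
      constructor
      · exact fun h => ⟨h x hxy.inc_left, h y hxy.inc_right⟩
      · rintro ⟨h1, h2⟩ z hz
        rcases hz.eq_or_eq_of_isLink hxy with rfl | rfl
        exacts [h1, h2]
    · rw [hpe]
      ext s
      simp
  · intro e x hx
    obtain ⟨y, hxy⟩ := hx
    obtain ⟨a, b, p, hp, hab, hpe, ha, hb⟩ := M.exists_path hJ hxy
    have hN : ∀ h ∈ p.support, h ∈ N := fun h hh => hP e hxy.edge_mem (by simpa [hpe] using hh)
    cases p with
    | nil => exact absurd rfl hab
    | @cons _ d _ h q =>
      have haN := hN a (by simp)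
      obtain ⟨z, hz, hzU⟩ := hT.inter a haN d (hN d (by simp)) h
      refine ⟨z, strand_subset_realize (e := s(a, d)) ?_ hz,
        set_subset_realize (A := M.branchSet x ∩ N) (h := a) ⟨(ha a (by simp)).2 rfl, haN⟩ hzU⟩
      rw [hpe]
      simp
  · intro x hx y hy hne
    have hd := M.disjoint x hx y hy hne
    refine hT.realize_farApart Set.inter_subset_right Set.inter_subset_right (hUB x) (hUB y)
      (hd.mono Set.inter_subset_left Set.inter_subset_left) ?_ ?_ ?_
    · rw [Set.disjoint_left]
      rintro s ⟨-, hs⟩ ⟨-, hs'⟩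
      induction s with
      | h g h => exact Set.disjoint_left.1 hd (hs g (by simp)).1 (hs' g (by simp)).1
    · rintro s ⟨-, hs⟩ h hh hhs
      exact Set.disjoint_left.1 hd (hs h hhs).1 hh.1
    · rintro s ⟨-, hs⟩ h hh hhs
      exact Set.disjoint_left.1 hd hh.1 (hs h hhs).1
  · intro e he f hf hef
    have hin : ∀ e ∈ J.edgeSet, ∀ f ∈ J.edgeSet, e ≠ f → ∀ h ∈ (M.branchPath e).verts,
        h ∈ (M.branchPath f).verts → ∃ x, J.Inc e x ∧ h ∈ M.branchSet x := by
      intro e he f hf hef h hh hh'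
      obtain ⟨x, y, hxy⟩ := J.exists_isLink_of_mem_edgeSet he
      by_contra! hcon
      refine Set.disjoint_left.1 (M.internally_disjoint e x y hxy f hf hef) ⟨hh, ?_⟩ hh'
      rintro (hx | hy)
      exacts [hcon x hxy.inc_left hx, hcon y hxy.inc_right hy]
    refine hT.realize_farApart (fun h hh => hP e he hh.1) (fun h hh => hP f hf hh.1) (hPB e he)
      (hPB f hf) ?_ ?_ ?_ ?_
    · rw [Set.disjoint_left]
      rintro h ⟨hh, hhx⟩ ⟨hh', -⟩
      obtain ⟨x, hx, hx'⟩ := hin e he f hf hef h hh hh'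
      exact hhx x hx hx'
    · rw [Set.disjoint_left]
      intro s hs hs'
      induction s with
      | h g h =>
      have key : ∀ e ∈ J.edgeSet, ∀ f ∈ J.edgeSet, e ≠ f → s(g, h) ∈ (M.branchPath e).edgeSet →
          s(g, h) ∈ (M.branchPath f).edgeSet → ∀ hgh : H.Adj g h,
          M.branchPath e = H.subgraphOfAdj hgh := by
        intro e he f hf hef hs hs' hgh
        obtain ⟨x, y, hxy⟩ := J.exists_isLink_of_mem_edgeSet he
        obtain ⟨a, b, p, hp, hab, hpe, ha, hb⟩ := M.exists_path hJ hxy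
        have hends : ∀ k ∈ s(g, h), k = a ∨ k = b := by
          intro k hk
          have hkp := hmem e _ hs k hk
          obtain ⟨z, hz, hkz⟩ := hin e he f hf hef k hkp (hmem f _ hs' k hk)
          rw [hpe, Walk.verts_toSubgraph] at hkp
          rcases hz.eq_or_eq_of_isLink hxy with rfl | rfl
          exacts [.inl ((ha k hkp).1 hkz), .inr ((hb k hkp).1 hkz)]
        rw [hpe] at hs ⊢
        exact toSubgraph_eq_of_mem_edges p hp hgh (by simpa using hs) (hends g (by simp))
          (hends h (by simp))
      have hgh : H.Adj g h := (M.branchPath e).adj_sub hs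
      exact M.path_ne e he f hf hef ((key e he f hf hef hs hs' hgh).trans
        (key f hf e he hef.symm hs' hs hgh).symm)
    · rintro s hs h ⟨hh, hhx⟩ hhs
      obtain ⟨x, hx, hx'⟩ := hin f hf e he hef.symm h hh (hmem e s hs h hhs)
      exact hhx x hx hx'
    · rintro s hs h ⟨hh, hhx⟩ hhs
      obtain ⟨x, hx, hx'⟩ := hin e he f hf hef h hh (hmem f s hs h hhs)
      exact hhx x hx hx'
  · intro e he z hz hez
    obtain ⟨x, y, hxy⟩ := J.exists_isLink_of_mem_edgeSet he
    have hd := M.avoid e x y hxy z hz (fun h => hez (h ▸ hxy.inc_left))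
      (fun h => hez (h ▸ hxy.inc_right))
    refine hT.realize_farApart (fun h hh => hP e he hh.1) Set.inter_subset_right (hPB e he) (hUB z)
      ?_ ?_ ?_ ?_
    · exact hd.mono (fun h hh => hh.1) Set.inter_subset_left
    · rw [Set.disjoint_left]
      rintro s hs ⟨-, hs'⟩
      induction s with
      | h g h => exact Set.disjoint_left.1 hd (hmem e _ hs g (by simp)) (hs' g (by simp)).1
    · rintro s hs h hh hhs
      exact Set.disjoint_left.1 hd (hmem e s hs h hhs) hh.1
    · rintro s ⟨-, hs⟩ h ⟨hh, -⟩ hhs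
      exact Set.disjoint_left.1 hd hh (hs h hhs).1

end Thick

end FatMinor

namespace FatMinor

open SimpleGraph

/-! ### Pigeonhole principles for equivalence relations -/

section Pigeonhole

variable {X : Type*}

/-- In an increasing chain of `T + 1` equivalence relations some relation agrees with the next one
on `S`, provided `S` has no `T` elements that are pairwise unrelated at the start. -/
theorem exists_stable (S : Set X) (r : ℕ → X → X → Prop) (refl : ∀ x ∈ S, r 0 x x)
    (symm : ∀ k x y, r k x y → r k y x) (trans : ∀ k x y z, r k x y → r k y z → r k x z)
    (mono : ∀ k x y, r k x y → r (k + 1) x y) (T : ℕ)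
    (hT : ∀ I : Finset X, (∀ x ∈ I, x ∈ S) → I.card = T → ∃ x ∈ I, ∃ y ∈ I, x ≠ y ∧ r 0 x y) :
    ∃ k < T, ∀ x ∈ S, ∀ y ∈ S, r (k + 1) x y → r k x y := by
  classical
  by_contra! hc
  have refl' : ∀ k, ∀ x ∈ S, r k x x := by
    intro k x hx
    induction k with
    | zero => exact refl x hx
    | succ k ih => exact mono _ _ _ ih
  have ins : ∀ k x (I : Finset X), (∀ a ∈ I, ∀ b ∈ I, a ≠ b → ¬ r k a b) → (∀ a ∈ I, ¬ r k x a) →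
      ∀ a ∈ insert x I, ∀ b ∈ insert x I, a ≠ b → ¬ r k a b := by
    intro k x I hI hx a ha b hb hab h
    rw [Finset.mem_insert] at ha hb
    rcases ha with rfl | ha <;> rcases hb with rfl | hb
    exacts [hab rfl, hx b hb h, hx a ha (symm _ _ _ h), hI a ha b hb hab h]
  -- If every relation differs from the next, there are `T - k` elements pairwise unrelated at stage
  -- `k`, by downward induction on `k`. Given such elements for `k + 1` and a pair `x`, `y` merged
  -- between the two stages, an element related to `x` at stage `k + 1` is replaced by both `x` and
  -- `y`; if there is none, `x` is added.
  have key : ∀ j k, j + k = T → ∃ I : Finset X, (∀ x ∈ I, x ∈ S) ∧ I.card = j ∧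
      ∀ x ∈ I, ∀ y ∈ I, x ≠ y → ¬ r k x y := by
    intro j
    induction j with
    | zero => exact fun k _ => ⟨∅, by simp, by simp, by simp⟩
    | succ j ih =>
      intro k hk
      obtain ⟨I, hIS, hIj, hI⟩ := ih (k + 1) (by omega)
      obtain ⟨x, hx, y, hy, hxy, hxy'⟩ := hc k (by omega)
      have hI' : ∀ a ∈ I, ∀ b ∈ I, a ≠ b → ¬ r k a b := fun a ha b hb h h' =>
        hI a ha b hb h (mono _ _ _ h')
      by_cases h : ∃ i ∈ I, r (k + 1) x i
      · obtain ⟨i, hi, hxi⟩ := h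
        have hyi : r (k + 1) y i := trans _ _ _ _ (symm _ _ _ hxy) hxi
        have h1 : ∀ z, r (k + 1) z i → ∀ a ∈ I.erase i, ¬ r k z a := fun z hz a ha h =>
          hI i hi a (Finset.mem_of_mem_erase ha) (Finset.ne_of_mem_erase ha).symm
            (trans _ _ _ _ (symm _ _ _ hz) (mono _ _ _ h))
        have hym : y ∉ I.erase i := fun h => h1 y hyi y h (refl' k y hy)
        have hx1 : ∀ a ∈ insert y (I.erase i), ¬ r k x a := by
          intro a ha
          rw [Finset.mem_insert] at ha
          rcases ha with rfl | ha
          exacts [hxy', h1 x hxi a ha]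
        have hxm : x ∉ insert y (I.erase i) := fun h => hx1 x h (refl' k x hx)
        refine ⟨insert x (insert y (I.erase i)), ?_, ?_, ins _ _ _ (ins _ _ _ ?_ (h1 y hyi)) hx1⟩
        · intro a ha
          rw [Finset.mem_insert, Finset.mem_insert] at ha
          rcases ha with rfl | rfl | ha
          exacts [hx, hy, hIS a (Finset.mem_of_mem_erase ha)]
        · rw [Finset.card_insert_of_notMem hxm, Finset.card_insert_of_notMem hym,
            Finset.card_erase_of_mem hi]
          have := Finset.card_pos.2 ⟨i, hi⟩
          omega
        · exact fun a ha b hb => hI' a (Finset.mem_of_mem_erase ha) b (Finset.mem_of_mem_erase hb)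
      · push Not at h
        have hx1 : ∀ a ∈ I, ¬ r k x a := fun a ha h' => h a ha (mono _ _ _ h')
        have hxm : x ∉ I := fun h => hx1 x h (refl' k x hx)
        refine ⟨insert x I, ?_, by rw [Finset.card_insert_of_notMem hxm, hIj], ins _ _ _ hI' hx1⟩
        intro a ha
        rw [Finset.mem_insert] at ha
        rcases ha with rfl | ha
        exacts [hx, hIS a ha]
  obtain ⟨I, hIS, hIT, hI⟩ := key T 0 (by omega)
  obtain ⟨x, hx, y, hy, hne, hxy⟩ := hT I hIS hIT
  exact hI x hx y hy hne hxy

/-- A set of `m * n` elements contains `m` pairwise unrelated or `n` pairwise related elements. -/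
theorem exists_unrelated_or_related {E : X → X → Prop} (symm : ∀ x y, E x y → E y x)
    (trans : ∀ x y z, E x y → E y z → E x z) {m n : ℕ} (hn : 0 < n) (I : Finset X)
    (hI : m * n ≤ I.card) :
    (∃ I' ⊆ I, I'.card = m ∧ ∀ x ∈ I', ∀ y ∈ I', x ≠ y → ¬ E x y) ∨
      ∃ I' ⊆ I, I'.card = n ∧ ∀ x ∈ I', ∀ y ∈ I', x ≠ y → E x y := by
  classical
  by_cases hbig : ∃ x ∈ I, n ≤ (I.filter fun y => y = x ∨ E x y).card
  · right
    obtain ⟨x, hx, h⟩ := hbig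
    obtain ⟨I', hI', hc⟩ := Finset.exists_subset_card_eq h
    refine ⟨I', hI'.trans (Finset.filter_subset _ _), hc, fun a ha b hb hab => ?_⟩
    have h1 := (Finset.mem_filter.1 (hI' ha)).2
    have h2 := (Finset.mem_filter.1 (hI' hb)).2
    rcases h1 with rfl | h1 <;> rcases h2 with rfl | h2
    exacts [absurd rfl hab, h2, symm _ _ h1, trans _ _ _ (symm _ _ h1) h2]
  · left
    push Not at hbig
    induction m generalizing I with
    | zero => exact ⟨∅, by simp, by simp, by simp⟩
    | succ m ih =>
      rw [Nat.succ_mul] at hI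
      obtain ⟨x, hx⟩ := Finset.card_pos.1 (show 0 < I.card by omega)
      have hx' := hbig x hx
      set c := I.filter fun y => y = x ∨ E x y with hc
      have hcI : (I \ c).card = I.card - c.card :=
        Finset.card_sdiff_of_subset (Finset.filter_subset _ _)
      obtain ⟨I', hI', hcard, hun⟩ := ih (I \ c) (by omega) (by
          intro y hy
          exact (Finset.card_le_card (Finset.filter_subset_filter _ Finset.sdiff_subset)).trans_lt
            (hbig y (Finset.mem_sdiff.1 hy).1))
      have hxI : ∀ y ∈ I', y ≠ x ∧ ¬ E x y := by
        intro y hy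
        have := Finset.mem_sdiff.1 (hI' hy)
        simpa [hc, this.1] using this.2
      refine ⟨insert x I', ?_, ?_, ?_⟩
      · rw [Finset.insert_subset_iff]
        exact ⟨hx, hI'.trans Finset.sdiff_subset⟩
      · rw [Finset.card_insert_of_notMem fun h => (hxI x h).1 rfl, hcard]
      · intro a ha b hb hab h
        rw [Finset.mem_insert] at ha hb
        rcases ha with rfl | ha <;> rcases hb with rfl | hb
        exacts [hab rfl, (hxI b hb).2 h, (hxI a ha).2 (symm _ _ h), hun a ha b hb hab h]

end Pigeonhole

/-! ### Consequences for slabs: few classes, bounded diameter -/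

section Aux

variable {V : Type*} {G : SimpleGraph V} {S : Set V}

theorem sconn_component {x : V} (hx : x ∈ S) : SConn G {y | Conn G S x y} := by
  have h : ∀ a, Conn G S x a → Conn G {y | Conn G S x y} x a := fun a ha =>
    (ha.inter (T := {y | Conn G S x y}) (Conn.refl hx)
      fun c hc d hcd hd => hc.trans (Conn.of_adj hcd (Conn.right_mem (S := S) hc) hd)).mono
      Set.inter_subset_right
  exact ⟨⟨x, Conn.refl hx⟩, fun a ha b hb => (h a ha).symm.trans (h b hb)⟩

/-- Some segment of a walk between unrelated elements of `L` joins unrelated elements of `L` and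
avoids `L` otherwise. -/
theorem Conn.exists_segment {L : Set V} {R : V → V → Prop}
    (trans : ∀ x y z, R x y → R y z → R x z) {x y : V} (hx : x ∈ L) (hy : y ∈ L) (hxy : ¬ R x y)
    (h : Conn G S x y) : ∃ p ∈ L, ∃ q ∈ L, ¬ R p q ∧ ∃ P ⊆ S, Conn G P p q ∧
      ∀ z ∈ P, z ∈ L → z = p ∨ z = q := by
  classical
  have hex : ∃ n, ∃ p ∈ L, ∃ q ∈ L, ¬ R p q ∧ ∃ w : G.Walk p q, w.length = n ∧
      ∀ z ∈ w.support, z ∈ S := by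
    obtain ⟨w, hw⟩ := h
    exact ⟨_, x, hx, y, hy, hxy, w, rfl, hw⟩
  obtain ⟨p, hp, q, hq, hpq, w, hl, hw⟩ := Nat.find_spec hex
  have hmin := fun {m} => Nat.find_min hex (m := m)
  rw [← hl] at hmin
  refine ⟨p, hp, q, hq, hpq, {z | z ∈ w.support}, hw, Conn.of_walk w, fun z hz hzL => ?_⟩
  by_contra! hne
  by_cases hpz : R p z
  · refine hmin (w.length_dropUntil_lt_length hz hne.1) ⟨z, hzL, q, hq,
      fun h => hpq (trans _ _ _ hpz h), _, rfl,
      fun a ha => hw a (w.support_dropUntil_subset_support hz ha)⟩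
  · exact hmin (w.length_takeUntil_lt_length hz hne.2) ⟨p, hp, z, hzL, hpz, _, rfl,
      fun a ha => hw a (w.support_takeUntil_subset_support hz ha)⟩

variable {lev : V → ℕ} {K t : ℕ}

/-- Descend from the given vertices to level `n` and apply `exists_short` there. -/
theorem IsLevel.exists_conn_slab (hlev : IsLevel G lev) (hK : 0 < K) (ht : 2 ≤ t)
    (hG : ¬ IsFatMinor K (K2 t) G) {ι : Type*} {n l : ℕ} (I : Finset ι) (hI : I.card = t)
    (s : ι → V) (hn : n ≤ l) (hs : ∀ i ∈ I, lev (s i) = l)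
    (hc : ∀ i ∈ I, ∀ j ∈ I, Conn G (Above lev n) (s i) (s j)) :
    ∃ i ∈ I, ∃ j ∈ I, i ≠ j ∧ Conn G (Slab lev (n - 6 * K) (l + 3 * K)) (s i) (s j) := by
  have hd : ∀ i : I, ∃ y, lev y = n ∧ Conn G (Slab lev n l) (s i) y := by
    rintro ⟨i, hi⟩
    obtain ⟨y, hy, p, -, hp⟩ := hlev.descent (n := n) (x := s i) (by rw [hs i hi]; exact hn)
    rw [hs i hi] at hp
    exact ⟨y, hy, p, hp⟩
  choose y hy hys using hd
  let e := (I.equivFinOfCardEq hI).symm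
  have hsub : Slab lev n l ⊆ Above lev n := fun x hx => hx.1
  obtain ⟨j, k, hjk, p, -, hp⟩ := hlev.exists_short hK ht hG (fun j => y (e j)) (fun j => hy _)
    fun j k => ((hys _).symm.mono hsub).trans
      ((hc _ (e j).2 _ (e k).2).trans ((hys _).mono hsub))
  refine ⟨e j, (e j).2, e k, (e k).2, fun h => hjk (e.injective (Subtype.ext h)), ?_⟩
  have hsub' : Slab lev n l ⊆ Slab lev (n - 6 * K) (l + 3 * K) :=
    slab_subset (by omega) (by omega)
  refine ((hys _).mono hsub').trans (Conn.trans ⟨p, fun x hx => ?_⟩ ((hys _).symm.mono hsub'))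
  exact slab_subset (by omega) (by omega) (hp x hx)

/-- A connected set of bounded height has bounded diameter. -/
theorem IsLevel.near_of_conn (hlev : IsLevel G lev) (hK : 0 < K) (ht : 2 ≤ t)
    (hG : ¬ IsFatMinor K (K2 t) G) {n h : ℕ} {x y : V} (hxy : Conn G (Slab lev n (n + h)) x y) :
    Near G (t * (9 * K + 2 * h)) x y := by
  by_contra hcon
  have hfar : t * (9 * K + 2 * h) ≤ G.dist x y := by
    by_contra! hlt
    obtain ⟨p, hp⟩ := hxy.reachable.exists_walk_length_eq_dist
    exact hcon ⟨p, by omega⟩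
  set S := Slab lev n (n + h)
  have hdist : ∀ {a b}, Conn G S x a → G.Adj a b → G.dist x b ≤ G.dist x a + 1 := by
    intro a b ha hab
    obtain ⟨p, hp⟩ := ha.reachable.exists_walk_length_eq_dist
    rw [← hp]
    simpa using dist_le (p.concat hab)
  -- The distance from `x` grows by at most one per step inside `S`, so it attains all these values.
  -- Two of the `t` points have descents to level `n` with nearby ends, and are then themselves at
  -- distance at most `9 * K - 1 + 2 * h`, less than the spacing.
  have hpts : ∀ j : Fin t, ∃ z, Conn G S x z ∧ G.dist x z = j * (9 * K + 2 * h) := by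
    intro j
    rcases Nat.eq_zero_or_pos (j * (9 * K + 2 * h)) with h0 | h0
    · exact ⟨x, Conn.refl hxy.left_mem, by rw [h0]; simp⟩
    have hj : (j + 1) * (9 * K + 2 * h) ≤ t * (9 * K + 2 * h) := Nat.mul_le_mul_right _ j.2
    rw [Nat.succ_mul] at hj
    obtain ⟨a, ha, b, hb, hab, haS, hbS⟩ := ((sconn_component (G := G) hxy.left_mem).2 x
      (Conn.refl hxy.left_mem) y hxy).exists_step
      (T := {z | G.dist x z < j * (9 * K + 2 * h)}) (by simpa using h0)
      (by simp only [Set.mem_ofPred_eq, not_lt]; omega)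
    refine ⟨b, hbS, ?_⟩
    have := hdist haS hab
    simp only [Set.mem_ofPred_eq, not_lt] at ha hb
    omega
  choose z hz hzd using hpts
  have hd : ∀ j, ∃ w, lev w = n ∧ Near G h (z j) w ∧ Conn G S (z j) w := by
    intro j
    have h1 := (hz j).right_mem
    obtain ⟨w, hw, p, hpl, hp⟩ := hlev.descent h1.1
    have h2 := h1.2
    exact ⟨w, hw, ⟨p, by omega⟩, p, fun a ha => slab_subset le_rfl h2 (hp a ha)⟩
  choose w hw hzw hzw' using hd
  have hxw : ∀ j, Conn G (Above lev n) x (w j) := fun j =>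
    ((hz j).trans (hzw' j)).mono fun a ha => ha.1
  obtain ⟨j, k, hjk, p, hp, -⟩ := hlev.exists_short hK ht hG w hw
    fun j k => (hxw j).symm.trans (hxw k)
  have hnear : Near G (9 * K - 1 + 2 * h) (z j) (z k) :=
    (((hzw j).trans ⟨p, (show p.length ≤ 9 * K - 1 by omega)⟩).trans (hzw k).symm).mono (by omega)
  have hle : ∀ j k : Fin t, j < k → Near G (9 * K - 1 + 2 * h) (z j) (z k) → False := by
    rintro j k hjk ⟨q, hq⟩
    obtain ⟨p, hp⟩ := (hz j).reachable.exists_walk_length_eq_dist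
    have h1 : G.dist x (z k) ≤ (p.append q).length := dist_le _
    rw [Walk.length_append, hp, hzd, hzd] at h1
    have h2 : ((j : ℕ) + 1) * (9 * K + 2 * h) ≤ k * (9 * K + 2 * h) := Nat.mul_le_mul_right _ hjk
    rw [Nat.succ_mul] at h2
    omega
  rcases lt_or_gt_of_ne hjk with h' | h'
  exacts [hle j k h' hnear, hle k j h' hnear.symm]

end Aux

end FatMinor

/-! ### Families, scales and cutting levels -/

namespace FatMinor

open SimpleGraph

/-- A graph without `K`-fat `K_{2,t}` minor together with its distance levels. -/
structure Frame (V : Type*) where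
  G : SimpleGraph V
  lev : V → ℕ
  K : ℕ
  t : ℕ
  isLevel : IsLevel G lev
  pos : 0 < K
  two_le : 2 ≤ t
  not_minor : ¬ IsFatMinor K (K2 t) G

/-- A set `Q` of vertices of level at least `l` together with the index `i` of a scale. -/
structure Fam (V : Type*) where
  Q : Set V
  l : ℕ
  i : ℕ

namespace Frame

variable {V : Type*} (c : Frame V)

/-- The number of available scales. -/
def num : ℕ := c.t * (c.t * c.t) * c.t

/-- The scales, an arithmetic progression. -/
def sc (i : ℕ) : ℕ := 10 * c.K * (i + 1)

/-- Half the width of the windows around cutting levels in which nothing merges. -/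
def wid : ℕ := 10 * c.K * (c.num + 3)

/-- The minimum difference between consecutive cutting levels. -/
def gap : ℕ := 2 * c.wid * (c.t + 3)

theorem sc_succ (i : ℕ) : c.sc (i + 1) = c.sc i + 10 * c.K := by
  simp only [sc]; ring

theorem sc_zero : c.sc 0 = 10 * c.K := by simp [sc]

theorem sc_mono {i j : ℕ} (h : i ≤ j) : c.sc i ≤ c.sc j := by
  simp only [sc]; gcongr

theorem le_sc (i : ℕ) : 10 * c.K ≤ c.sc i := by
  rw [← c.sc_zero]; exact c.sc_mono (Nat.zero_le _)

theorem sc_le_wid {i : ℕ} (h : i < c.num) : c.sc i + 30 * c.K ≤ c.wid := by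
  have h1 : c.sc i ≤ 10 * c.K * c.num := by simp only [sc]; gcongr; omega
  have h2 : c.wid = 10 * c.K * c.num + 30 * c.K := by simp only [wid]; ring
  omega

theorem num_pos : 0 < c.num := by
  have := c.two_le
  unfold num; positivity

theorem t_le_num : c.t ≤ c.num := by
  have := c.two_le
  exact Nat.le_mul_of_pos_left _ (by positivity)

theorem wid_le_gap : 10 * c.wid ≤ c.gap := by
  have h : 5 ≤ c.t + 3 := by have := c.two_le; omega
  calc 10 * c.wid = 2 * c.wid * 5 := by ring
    _ ≤ c.gap := by unfold gap; gcongr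

theorem steps_le_gap {k : ℕ} (h : k < c.t) : 2 * c.wid * k + 2 * c.wid ≤ c.gap := by
  calc 2 * c.wid * k + 2 * c.wid = 2 * c.wid * (k + 1) := by ring
    _ ≤ c.gap := by unfold gap; gcongr; omega

/-- The part of the graph that determines the connectivity of the region starting at `F`: a window
around the bottom level of `F`, and the part of `F` below level `m`. -/
def Om (F : Fam V) (m a : ℕ) : Set V :=
  Slab c.lev (F.l - a) (F.l + a) ∪ {x | x ∈ F.Q ∧ c.lev x < m}

theorem om_mono {F : Fam V} {m m' a a' : ℕ} (hm : m ≤ m') (ha : a ≤ a') :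
    c.Om F m a ⊆ c.Om F m' a' :=
  Set.union_subset_union (slab_subset (by omega) (by omega)) fun _ h => ⟨h.1, h.2.trans_le hm⟩

/-- Well-formed families. -/
structure WF (F : Fam V) : Prop where
  nonempty : F.Q.Nonempty
  above : ∀ x ∈ F.Q, F.l ≤ c.lev x
  closed : ∀ x ∈ F.Q, ∀ y, c.G.Adj x y → F.l ≤ c.lev y → y ∈ F.Q
  conn : ∀ x ∈ F.Q, ∀ y ∈ F.Q, Conn c.G (Above c.lev (F.l - c.sc F.i)) x y
  stable : ∀ x ∈ F.Q, c.lev x = F.l → ∀ y ∈ F.Q, c.lev y = F.l →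
    Conn c.G (Slab c.lev (F.l - c.sc (F.i + 1)) (F.l + c.sc (F.i + 1))) x y →
    Conn c.G (Slab c.lev (F.l - c.sc F.i) (F.l + c.sc F.i)) x y
  lt_num : F.i < c.num

variable {c} {F : Fam V}

theorem WF.mem_of_conn (hF : c.WF F) {x y : V} (hx : x ∈ F.Q)
    (h : Conn c.G (Above c.lev F.l) x y) : y ∈ F.Q :=
  h.mem_of_closed hx fun a ha b hab hb => hF.closed a ha b hab hb

theorem WF.exists_bottom (hF : c.WF F) {x : V} (hx : x ∈ F.Q) :
    ∃ s ∈ F.Q, c.lev s = F.l ∧ Conn c.G {y | y ∈ F.Q ∧ c.lev y ≤ c.lev x} x s := by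
  obtain ⟨s, hs, p, -, hp⟩ := c.isLevel.descent (hF.above x hx)
  have h : Conn c.G (Slab c.lev F.l (c.lev x)) x s := ⟨p, hp⟩
  have h' := h.inter hx fun a ha b hab hb => hF.closed a ha b hab hb.1
  exact ⟨s, h'.right_mem.2, hs, h'.mono fun y hy => ⟨hy.2, hy.1.2⟩⟩

theorem WF.exists_bottom_om (hF : c.WF F) {x : V} (hx : x ∈ F.Q) {m a : ℕ} (hm : c.lev x < m) :
    ∃ s ∈ F.Q, c.lev s = F.l ∧ Conn c.G (c.Om F m a) x s := by
  obtain ⟨s, hs, hsl, h⟩ := hF.exists_bottom hx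
  exact ⟨s, hs, hsl, h.mono fun y hy => .inr ⟨hy.1, hy.2.trans_lt hm⟩⟩

/-- At radius `sc (F.i + 1)` the bottom of a family has fewer than `t` classes, which starts the
pigeonhole argument for cutting levels. The step of `10 * K` between scales has room for the `6 * K`
by which `exists_conn_slab` reaches down. -/
theorem WF.exists_conn (hF : c.WF F) {ι : Type*} (I : Finset ι) (hI : I.card = c.t) (s : ι → V)
    (hs : ∀ i ∈ I, s i ∈ F.Q ∧ c.lev (s i) = F.l) :
    ∃ i ∈ I, ∃ j ∈ I, i ≠ j ∧
      Conn c.G (Slab c.lev (F.l - c.sc (F.i + 1)) (F.l + c.sc (F.i + 1))) (s i) (s j) := by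
  obtain ⟨i, hi, j, hj, hij, h⟩ := c.isLevel.exists_conn_slab c.pos c.two_le c.not_minor I hI s
    (n := F.l - c.sc F.i) (l := F.l) (by omega) (fun i hi => (hs i hi).2)
    fun i hi j hj => hF.conn _ (hs i hi).1 _ (hs j hj).1
  refine ⟨i, hi, j, hj, hij, h.mono ?_⟩
  rw [c.sc_succ]
  have := c.le_sc F.i
  exact slab_subset (by omega) (by omega)

/-- Enlarging the window at the bottom of a family to the next scale does not merge anything. -/
theorem WF.conn_window (hF : c.WF F) {m : ℕ} (hm : F.l + c.sc (F.i + 1) < m) {x y : V}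
    (hx : x ∈ F.Q) (hxl : c.lev x = F.l) (hy : y ∈ F.Q) (hyl : c.lev y = F.l)
    (h : Conn c.G (c.Om F m (c.sc (F.i + 1))) x y) : Conn c.G (c.Om F m (c.sc F.i)) x y := by
  -- A walk in the wide region leaves and re-enters `F.Q` only at level `F.l`, and its excursions
  -- outside `F.Q` stay in the window. While it is outside, `T` remembers the vertex `s` of the last
  -- exit; on return, `stable` replaces the excursion by a connection in the narrow window.
  set T : Set V := {v | (v ∈ F.Q ∧ Conn c.G (c.Om F m (c.sc F.i)) x v) ∨
    (v ∉ F.Q ∧ ∃ s ∈ F.Q, c.lev s = F.l ∧ Conn c.G (c.Om F m (c.sc F.i)) x s ∧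
      Conn c.G (Slab c.lev (F.l - c.sc (F.i + 1)) (F.l + c.sc (F.i + 1))) s v)}
  have hsub : Slab c.lev (F.l - c.sc F.i) (F.l + c.sc F.i) ⊆ c.Om F m (c.sc F.i) :=
    Set.subset_union_left
  have hlow : ∀ v ∈ F.Q, v ∈ c.Om F m (c.sc (F.i + 1)) → c.lev v < m := by
    rintro v - (hv | hv)
    exacts [hv.2.trans_lt hm, hv.2]
  have hy' : y ∈ T := by
    refine h.mem_of_closed (T := T) (.inl ⟨hx, Conn.refl (.inr ⟨hx, by omega⟩)⟩) ?_
    rintro a (⟨ha, hxa⟩ | ⟨ha, s, hs, hsl, hxs, hsa⟩) b hab hb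
    · have haL := hF.above a ha
      by_cases hbQ : b ∈ F.Q
      · have ha' : a ∈ c.Om F m (c.sc F.i) := hxa.right_mem
        exact .inl ⟨hbQ, hxa.trans (Conn.of_adj hab ha' (.inr ⟨hbQ, hlow b hbQ hb⟩))⟩
      · have hbl : c.lev b < F.l := by
          by_contra! hb'
          exact hbQ (hF.closed a ha b hab hb')
        have h1 := c.isLevel.adj _ _ hab.symm
        have h2 := c.le_sc (F.i + 1)
        have h3 := c.pos
        refine .inr ⟨hbQ, a, ha, by omega, hxa, Conn.of_adj hab ⟨by omega, by omega⟩
          ⟨by omega, by omega⟩⟩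
    · have hbs : b ∈ Slab c.lev (F.l - c.sc (F.i + 1)) (F.l + c.sc (F.i + 1)) ∨ b ∈ F.Q := by
        rcases hb with hb | hb
        exacts [.inl hb, .inr hb.1]
      by_cases hbQ : b ∈ F.Q
      · have hal : c.lev a < F.l := by
          by_contra! ha'
          exact ha (hF.closed b hbQ a hab.symm ha')
        have h1 := c.isLevel.adj _ _ hab
        have h2 := hF.above b hbQ
        have hbl : c.lev b = F.l := by omega
        have hsb := hF.stable s hs hsl b hbQ hbl
          (hsa.trans (Conn.of_adj hab hsa.right_mem ⟨by omega, by omega⟩))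
        exact .inl ⟨hbQ, hxs.trans (hsb.mono hsub)⟩
      · exact .inr ⟨hbQ, s, hs, hsl, hxs,
          hsa.trans (Conn.of_adj hab hsa.right_mem (hbs.resolve_right hbQ))⟩
  rcases hy' with hy' | hy'
  exacts [hy'.2, absurd hy hy'.1]

variable (c)

/-- `m` is a level at which the region starting at `F` may be cut off. -/
structure CutLevel (F : Fam V) (m : ℕ) : Prop where
  le : F.l + c.gap ≤ m
  le_add : m ≤ F.l + 2 * c.gap
  stable : ∀ x ∈ F.Q, c.lev x = F.l → ∀ y ∈ F.Q, c.lev y = F.l →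
    Conn c.G (c.Om F (m + c.wid) (c.sc (F.i + 1))) x y →
    Conn c.G (c.Om F (m - c.wid) (c.sc F.i)) x y

variable {c}

/-- Raise the upper bound of the region from `F.l + gap` in steps of `2 * wid`. The bottom vertices
have fewer than `t` classes from the start, so one of the first `t` steps merges none; its midpoint
is the cutting level. Finally `conn_window` narrows the window at the bottom. -/
theorem WF.exists_cutLevel (hF : c.WF F) : ∃ m, c.CutLevel F m := by
  have h1 := c.wid_le_gap
  have h2 := c.sc_le_wid hF.lt_num
  have h3 := c.sc_succ F.i
  obtain ⟨k, hk, hst⟩ := exists_stable {x | x ∈ F.Q ∧ c.lev x = F.l}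
    (fun k => Conn c.G (c.Om F (F.l + c.gap + 2 * c.wid * k) (c.sc (F.i + 1))))
    (fun x hx => Conn.refl (.inr ⟨hx.1, by rw [hx.2]; have := c.pos; omega⟩))
    (fun k x y h => h.symm) (fun k x y z h h' => h.trans h')
    (fun k x y h => h.mono (c.om_mono (by gcongr; omega) le_rfl)) c.t (by
      intro I hIS hI
      obtain ⟨i, hi, j, hj, hij, h⟩ := hF.exists_conn I hI id hIS
      exact ⟨i, hi, j, hj, hij, h.mono Set.subset_union_left⟩)
  have h4 := c.steps_le_gap hk
  have h5 := c.pos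
  refine ⟨F.l + c.gap + 2 * c.wid * k + c.wid, by omega, by omega, ?_⟩
  intro x hx hxl y hy hyl h
  rw [show F.l + c.gap + 2 * c.wid * k + c.wid - c.wid = F.l + c.gap + 2 * c.wid * k by omega]
  refine hF.conn_window (by omega) hx hxl hy hyl (hst x ⟨hx, hxl⟩ y ⟨hy, hyl⟩ ?_)
  rw [show 2 * c.wid * (k + 1) = 2 * c.wid * k + 2 * c.wid by ring]
  exact h.mono (c.om_mono (by omega) le_rfl)

open Classical in
/-- The level at which the region starting at `F` is cut off. -/
noncomputable def top (c : Frame V) (F : Fam V) : ℕ :=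
  if h : ∃ m, c.CutLevel F m then h.choose else F.l

theorem WF.cutLevel (hF : c.WF F) : c.CutLevel F (c.top F) := by
  have h := hF.exists_cutLevel
  rw [top, dif_pos h]
  exact h.choose_spec

/-- The part of the graph whose components determine the bags of the region starting at `F`. -/
noncomputable def OmP (c : Frame V) (F : Fam V) : Set V :=
  c.Om F (c.top F + c.wid) (c.sc (F.i + 1))

/-- The part of `F` above its cutting level formed by the components that attach to at least two
bags. -/
def Mul (c : Frame V) (F : Fam V) : Set V :=
  {v | v ∈ F.Q ∧ c.top F ≤ c.lev v ∧ ∃ x y, c.lev x = c.top F ∧ c.lev y = c.top F ∧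
    Conn c.G (Above c.lev (c.top F)) v x ∧ Conn c.G (Above c.lev (c.top F)) v y ∧
    ¬ Conn c.G (c.OmP F) x y}

/-- This turns different components into distance: a short walk from the region shrunk by `m` stays
in `OmP F`. Near the bottom level it stays in the window; higher up it cannot leave `F.Q` without
passing below `F.l`. -/
theorem WF.conn_of_near (hF : c.WF F) {m k : ℕ} (hkm : k ≤ m) (hm : m ≤ 4 * c.K) {x y : V}
    (hx : x ∈ c.Om F (c.top F + c.wid - m) (c.sc (F.i + 1) - m)) (h : Near c.G k x y) :
    Conn c.G (c.OmP F) x y := by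
  have h0 := c.isLevel.conn_of_near (h.mono hkm)
  have h1 := c.le_sc (F.i + 1)
  have h2 := c.sc_le_wid hF.lt_num
  rcases hx with hx | hx
  · exact h0.mono ((slab_subset (by have := hx.1; omega) (by have := hx.2; omega)).trans
      Set.subset_union_left)
  · by_cases hl : c.lev x ≤ F.l + m
    · have := hF.above x hx.1
      exact h0.mono ((slab_subset (by omega) (by omega)).trans Set.subset_union_left)
    · refine (h0.inter hx.1 fun a ha b hab hb => hF.closed a ha b hab ?_).mono ?_
      · have := hb.1
        omega
      · rintro z ⟨hz, hzQ⟩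
        refine .inr ⟨hzQ, ?_⟩
        have := hz.2
        have := hx.2
        omega

/-- Representatives may be built in a low region with a narrow window, while their separation is
measured in the larger `OmP F`: both give the same classes of bottom vertices. -/
theorem WF.stable_omP (hF : c.WF F) {x y : V} (hx : x ∈ F.Q) (hxl : c.lev x = F.l)
    (hy : y ∈ F.Q) (hyl : c.lev y = F.l) (h : Conn c.G (c.OmP F) x y) {m a : ℕ}
    (hm : c.top F - c.wid ≤ m) (ha : c.sc F.i ≤ a) : Conn c.G (c.Om F m a) x y :=
  (hF.cutLevel.stable x hx hxl y hy hyl h).mono (c.om_mono hm ha)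

/-- Each of these components contains a segment between different components of `OmP F`. Only fewer
than `t` such components are available as ends, so pigeonholing over first ends and then over second
ends leaves `t` segments between the same two: a fat `K_{2,t}`. -/
theorem WF.mul_card (hF : c.WF F) (I : Finset V) (hI : ∀ x ∈ I, x ∈ c.Mul F)
    (hcard : I.card = c.t * (c.t * c.t))
    (hne : ∀ x ∈ I, ∀ y ∈ I, x ≠ y → ¬ Conn c.G (Above c.lev (c.top F)) x y) : False := by
  classical
  have hpos := c.pos
  have hw := c.sc_le_wid hF.lt_num
  have hs0 := c.le_sc F.i
  have hss := c.sc_succ F.i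
  have hgap := c.wid_le_gap
  have hcut := hF.cutLevel
  have hcle := hcut.le
  set m := c.top F with hm
  -- Low enough below the top of `OmP F` for `conn_of_near` to put the hubs `3 * K` apart, and high
  -- enough above `m` that a walk of length less than `3 * K` between segments outside the hubs
  -- remains above `m` and so joins their components.
  set θ := m + c.wid - 3 * c.K with hθ
  set L : Set V := {v | v ∈ F.Q ∧ c.lev v < θ}
  have hseg : ∀ x : I, ∃ p ∈ L, ∃ q ∈ L, ¬ Conn c.G (c.OmP F) p q ∧
      ∃ P ⊆ {v | Conn c.G (Above c.lev m) x v}, Conn c.G P p q ∧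
        ∀ z ∈ P, z ∈ L → z = p ∨ z = q := by
    rintro ⟨v, hv⟩
    obtain ⟨hvQ, hvm, x, y, hx, hy, hvx, hvy, hxy⟩ := hI v hv
    have hsub : Above c.lev m ⊆ Above c.lev F.l := above_subset (by omega)
    exact Conn.exists_segment (fun x y z h h' => h.trans h')
      ⟨hF.mem_of_conn hvQ (hvx.mono hsub), by omega⟩ ⟨hF.mem_of_conn hvQ (hvy.mono hsub), by omega⟩
      hxy ((sconn_component (S := Above c.lev m) hvm).2 x hvx y hvy)
  choose p hp q hq hpq P hPsub hP hPL using hseg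
  have hbot : ∀ v ∈ L, ∃ s ∈ F.Q, c.lev s = F.l ∧ Conn c.G (c.Om F θ (c.sc F.i)) v s :=
    fun v hv => hF.exists_bottom_om hv.1 hv.2
  have hOm : c.Om F θ (c.sc F.i) ⊆ c.OmP F := c.om_mono (by omega) (by omega)
  have hmany : ∀ f : I → V, (∀ x, f x ∈ L) → ∀ I' : Finset I, I'.card = c.t →
      (∀ x ∈ I', ∀ y ∈ I', x ≠ y → ¬ Conn c.G (c.OmP F) (f x) (f y)) → False := by
    intro f hf I' hI' hun
    choose s hs hsl hfs using fun x => hbot (f x) (hf x)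
    obtain ⟨i, hi, j, hj, hij, h⟩ := hF.exists_conn I' hI' s fun i _ => ⟨hs i, hsl i⟩
    refine hun i hi j hj hij (((hfs i).mono hOm).trans ((h.mono ?_).trans ((hfs j).symm.mono hOm)))
    exact Set.subset_union_left
  have htpos : 0 < c.t := by have := c.two_le; omega
  obtain ⟨I₁, -, hI₁, h₁⟩ | ⟨I₁, -, hI₁, h₁⟩ := exists_unrelated_or_related
    (E := fun x y : I => Conn c.G (c.OmP F) (p x) (p y)) (fun x y h => h.symm)
    (fun x y z h h' => h.trans h') (m := c.t) (n := c.t * c.t) (by positivity) Finset.univ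
    (by rw [Finset.card_univ, Fintype.card_coe, hcard])
  · exact hmany p hp I₁ hI₁ h₁
  obtain ⟨I₂, -, hI₂, h₂⟩ | ⟨I₂, hI₂s, hI₂, h₂⟩ := exists_unrelated_or_related
    (E := fun x y : I => Conn c.G (c.OmP F) (q x) (q y)) (fun x y h => h.symm)
    (fun x y z h h' => h.trans h') (m := c.t) (n := c.t) (by positivity) I₁ hI₁.ge
  · exact hmany q hq I₂ hI₂ h₂
  obtain ⟨x₀, hx₀⟩ := Finset.card_pos.1 (show 0 < I₂.card by omega)
  have hrel : ∀ f : I → V, (∀ x, f x ∈ L) → (∀ x ∈ I₂, ∀ y ∈ I₂, x ≠ y →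
      Conn c.G (c.OmP F) (f x) (f y)) → ∀ x ∈ I₂, Conn c.G (c.Om F θ (c.sc F.i)) (f x₀) (f x) := by
    intro f hf h x hx
    by_cases hxx : x₀ = x
    · subst hxx
      exact Conn.refl (.inr (hf x₀))
    obtain ⟨s, hs, hsl, hfs⟩ := hbot _ (hf x₀)
    obtain ⟨s', hs', hsl', hfs'⟩ := hbot _ (hf x)
    refine hfs.trans ((hF.stable_omP hs hsl hs' hsl' ?_ (by omega) le_rfl).trans hfs'.symm)
    exact ((hfs.mono hOm).symm.trans (h x₀ hx₀ x hx hxx)).trans (hfs'.mono hOm)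
  have hpp := hrel p hp fun x hx y hy h => h₁ x (hI₂s hx) y (hI₂s hy) h
  have hqq := hrel q hq h₂
  let e := (I₂.equivFinOfCardEq hI₂).symm
  refine c.not_minor (isFatMinor_K2 hpos (sconn_component (Conn.left_mem (hpp x₀ hx₀)))
    (sconn_component (Conn.left_mem (hqq x₀ hx₀))) ?_ (fun j => P (e j))
    (fun j => ⟨_, hpp _ (e j).2, _, hqq _ (e j).2, hP _⟩) ?_)
  · rw [farApart_iff]
    intro a ha b hb k hk hn
    have ha' : a ∈ c.Om F θ (c.sc F.i) := Conn.right_mem ha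
    refine hpq x₀ ((Conn.mono hOm ha).trans ((hF.conn_of_near hk.le (by omega) ?_ hn).trans
      (Conn.mono hOm hb).symm))
    exact c.om_mono (by omega) (by omega) ha'
  · intro j k hjk
    rw [farApart_iff]
    have hhigh : ∀ i, ∀ z ∈ P (e i) \ ({y | Conn c.G (c.Om F θ (c.sc F.i)) (p x₀) y} ∪
        {y | Conn c.G (c.Om F θ (c.sc F.i)) (q x₀) y}), θ ≤ c.lev z := by
      rintro i z ⟨hz, hz'⟩
      by_contra! hlt
      have hzm : Conn c.G (Above c.lev m) _ z := hPsub _ hz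
      have hzQ : z ∈ F.Q := hF.mem_of_conn (hI _ (e i).1.2).1
        (hzm.mono (above_subset (by omega)))
      rcases hPL _ z hz ⟨hzQ, hlt⟩ with rfl | rfl
      exacts [hz' (.inl (hpp _ (e i).2)), hz' (.inr (hqq _ (e i).2))]
    intro a ha b hb n hn hnear
    have h1 := hhigh j a ha
    have h2 : Conn c.G (Above c.lev m) a b :=
      (c.isLevel.conn_of_near hnear).mono fun z hz => by
        have := hz.1
        simp only [Above, Set.mem_ofPred_eq]
        omega
    have h3 : Conn c.G (Above c.lev m) _ a := hPsub _ ha.1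
    have h4 : Conn c.G (Above c.lev m) _ b := hPsub _ hb.1
    refine hne _ (e j).1.2 _ (e k).1.2 (fun h => hjk ?_) ((h3.trans h2).trans h4.symm)
    exact e.injective (Subtype.ext (Subtype.ext h))

/-- Each family has a scale at which the components above its cutting level that attach to several
bags are stable. -/
theorem WF.exists_scale (hF : c.WF F) : ∃ k < c.num,
    ∀ x ∈ {x | x ∈ c.Mul F ∧ c.lev x = c.top F}, ∀ y ∈ {x | x ∈ c.Mul F ∧ c.lev x = c.top F},
    Conn c.G (Slab c.lev (c.top F - c.sc (k + 1)) (c.top F + c.sc (k + 1))) x y →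
      Conn c.G (Slab c.lev (c.top F - c.sc k) (c.top F + c.sc k)) x y := by
  refine exists_stable _ (fun k => Conn c.G (Slab c.lev (c.top F - c.sc k) (c.top F + c.sc k)))
    (fun x hx => Conn.refl ⟨by have := hx.2; omega, by have := hx.2; omega⟩)
    (fun k x y h => h.symm) (fun k x y z h h' => h.trans h') (fun k x y h => h.mono ?_) _ ?_
  · have := c.sc_succ k
    exact slab_subset (by omega) (by omega)
  · intro I hIS hI
    have htpos : 0 < c.t := by have := c.two_le; omega
    -- The value of `num` comes from here: `t * (t * t)` vertices in different components contradict
    -- `mul_card`, and among `t` vertices in one component two are joined already at the smallest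
    -- scale.
    obtain ⟨I₁, hs, hI₁, h₁⟩ | ⟨I₁, hs, hI₁, h₁⟩ := exists_unrelated_or_related
      (E := fun x y => Conn c.G (Above c.lev (c.top F)) x y) (fun x y h => h.symm)
      (fun x y z h h' => h.trans h') (m := c.t * (c.t * c.t)) (n := c.t) htpos I hI.ge
    · exact (hF.mul_card I₁ (fun x hx => (hIS x (hs hx)).1) hI₁ h₁).elim
    · obtain ⟨i, hi, j, hj, hij, h⟩ := c.isLevel.exists_conn_slab c.pos c.two_le c.not_minor I₁
        hI₁ id (n := c.top F) (l := c.top F) le_rfl (fun i hi => (hIS i (hs hi)).2)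
        fun i hi j hj => by
          by_cases hij : i = j
          · subst hij
            exact Conn.refl (hIS i (hs hi)).2.ge
          · exact h₁ i hi j hj hij
      refine ⟨i, hs hi, j, hs hj, hij, h.mono ?_⟩
      have := c.sc_zero
      exact slab_subset (by omega) (by omega)

/-- Components attached to at most one bag are not bounded in number by `mul_card`, so each of them
gets a scale of its own. Within one component, `t` stages suffice. -/
theorem exists_scale_component (c : Frame V) (l : ℕ) (v : V) : ∃ k < c.num,
    ∀ x ∈ {x | Conn c.G (Above c.lev l) v x ∧ c.lev x = l},
    ∀ y ∈ {x | Conn c.G (Above c.lev l) v x ∧ c.lev x = l},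
    Conn c.G (Slab c.lev (l - c.sc (k + 1)) (l + c.sc (k + 1))) x y →
      Conn c.G (Slab c.lev (l - c.sc k) (l + c.sc k)) x y := by
  obtain ⟨k, hk, h⟩ := exists_stable {x | Conn c.G (Above c.lev l) v x ∧ c.lev x = l}
    (fun k => Conn c.G (Slab c.lev (l - c.sc k) (l + c.sc k)))
    (fun x hx => Conn.refl ⟨by have := hx.2; omega, by have := hx.2; omega⟩)
    (fun k x y h => h.symm) (fun k x y z h h' => h.trans h') (fun k x y h => h.mono (by
      have := c.sc_succ k
      exact slab_subset (by omega) (by omega))) c.t (by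
      intro I hIS hI
      obtain ⟨i, hi, j, hj, hij, h⟩ := c.isLevel.exists_conn_slab c.pos c.two_le c.not_minor I
        hI id (n := l) (l := l) le_rfl (fun i hi => (hIS i hi).2)
        fun i hi j hj => (hIS i hi).1.symm.trans (hIS j hj).1
      refine ⟨i, hi, j, hj, hij, h.mono ?_⟩
      have := c.sc_zero
      exact slab_subset (by omega) (by omega))
  exact ⟨k, hk.trans_le c.t_le_num, h⟩

end Frame

end FatMinor

/-! ### The forest of families and the quotient graph -/

namespace FatMinor

open SimpleGraph Relation

namespace Frame

variable {V : Type*} (c : Frame V)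

/-- At scale `k` the window around level `l` already joins those vertices of `S` on level `l` that
the next scale joins. -/
def StableAt (S : Set V) (l k : ℕ) : Prop :=
  ∀ x ∈ {x | x ∈ S ∧ c.lev x = l}, ∀ y ∈ {x | x ∈ S ∧ c.lev x = l},
    Conn c.G (Slab c.lev (l - c.sc (k + 1)) (l + c.sc (k + 1))) x y →
      Conn c.G (Slab c.lev (l - c.sc k) (l + c.sc k)) x y

open Classical in
/-- A stable scale for `S` at level `l`. -/
noncomputable def scale (S : Set V) (l : ℕ) : ℕ :=
  if h : ∃ k < c.num, c.StableAt S l k then h.choose else 0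

open Classical in
/-- The family following `F` that contains the vertex `v`. -/
noncomputable def nxt (F : Fam V) (v : V) : Fam V :=
  if v ∈ c.Mul F then
    ⟨{w | w ∈ c.Mul F ∧
      Conn c.G (Above c.lev (c.top F - c.sc (c.scale (c.Mul F) (c.top F)))) v w},
      c.top F, c.scale (c.Mul F) (c.top F)⟩
  else ⟨{w | Conn c.G (Above c.lev (c.top F)) v w}, c.top F,
    c.scale {w | Conn c.G (Above c.lev (c.top F)) v w} (c.top F)⟩

/-- The family consisting of the component of `v`. -/
def root (v : V) : Fam V := ⟨{w | c.G.Reachable v w}, 0, 0⟩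

/-- `F'` is one of the families following `F`. -/
def Child (F F' : Fam V) : Prop :=
  c.WF F ∧ ∃ v ∈ F.Q, c.top F ≤ c.lev v ∧ F' = c.nxt F v

/-- `F'` is one of the families following `F` that attach to several bags. -/
def MChild (F F' : Fam V) : Prop := c.Child F F' ∧ F'.Q ⊆ c.Mul F

variable {c} {F F' : Fam V} {v x y : V}

theorem scale_spec {S : Set V} {l : ℕ} (h : ∃ k < c.num, c.StableAt S l k) :
    c.scale S l < c.num ∧ c.StableAt S l (c.scale S l) := by
  rw [scale, dif_pos h]
  exact h.choose_spec

theorem nxt_l : (c.nxt F v).l = c.top F := by unfold nxt; split_ifs <;> rfl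

theorem nxt_of_mem (h : v ∈ c.Mul F) : c.nxt F v =
    ⟨{w | w ∈ c.Mul F ∧
      Conn c.G (Above c.lev (c.top F - c.sc (c.scale (c.Mul F) (c.top F)))) v w},
      c.top F, c.scale (c.Mul F) (c.top F)⟩ := by rw [nxt, if_pos h]

theorem nxt_of_notMem (h : v ∉ c.Mul F) : c.nxt F v =
    ⟨{w | Conn c.G (Above c.lev (c.top F)) v w}, c.top F,
      c.scale {w | Conn c.G (Above c.lev (c.top F)) v w} (c.top F)⟩ := by rw [nxt, if_neg h]

theorem WF.le_top (hF : c.WF F) : F.l + c.gap ≤ c.top F := hF.cutLevel.le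

theorem WF.mem_of_conn_top (hF : c.WF F) (hx : x ∈ F.Q)
    (h : Conn c.G (Above c.lev (c.top F)) x y) : y ∈ F.Q :=
  hF.mem_of_conn hx (h.mono (above_subset (by have := hF.le_top; omega)))

theorem WF.mul_of_conn (hF : c.WF F) (hx : x ∈ c.Mul F)
    (h : Conn c.G (Above c.lev (c.top F)) x y) : y ∈ c.Mul F := by
  obtain ⟨hxQ, -, a, b, ha, hb, hxa, hxb, hab⟩ := hx
  exact ⟨hF.mem_of_conn_top hxQ h, h.right_mem, a, b, ha, hb, h.symm.trans hxa,
    h.symm.trans hxb, hab⟩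

theorem mem_nxt (h : c.top F ≤ c.lev v) : v ∈ (c.nxt F v).Q := by
  by_cases hv : v ∈ c.Mul F
  · rw [nxt_of_mem hv]
    exact ⟨hv, Conn.refl ((Nat.sub_le _ _).trans h)⟩
  · rw [nxt_of_notMem hv]
    exact Conn.refl h

theorem Child.wf_left (h : c.Child F F') : c.WF F := h.1

theorem Child.l_eq (h : c.Child F F') : F'.l = c.top F := by
  obtain ⟨-, v, -, -, rfl⟩ := h
  exact nxt_l

/-- A child is determined by any of its vertices, so different children of one family are disjoint.
The tree structure rests on this. -/
theorem Child.nxt_eq (h : c.Child F F') (hx : x ∈ F'.Q) :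
    x ∈ F.Q ∧ c.top F ≤ c.lev x ∧ F' = c.nxt F x := by
  obtain ⟨hF, v, hv, hvl, rfl⟩ := h
  by_cases hm : v ∈ c.Mul F
  · rw [nxt_of_mem hm] at hx ⊢
    obtain ⟨hxm, hvx⟩ := hx
    refine ⟨hxm.1, hxm.2.1, ?_⟩
    rw [nxt_of_mem hxm]
    congr 1
    ext w
    exact ⟨fun h => ⟨h.1, hvx.symm.trans h.2⟩, fun h => ⟨h.1, hvx.trans h.2⟩⟩
  · rw [nxt_of_notMem hm] at hx ⊢
    have hvx : Conn c.G (Above c.lev (c.top F)) v x := hx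
    refine ⟨hF.mem_of_conn_top hv hvx, hvx.right_mem, ?_⟩
    rw [nxt_of_notMem fun h => hm (hF.mul_of_conn h hvx.symm)]
    have : {w | Conn c.G (Above c.lev (c.top F)) v w} =
        {w | Conn c.G (Above c.lev (c.top F)) x w} := by
      ext w
      exact ⟨fun h => hvx.symm.trans h, fun h => hvx.trans h⟩
    rw [this]

theorem Child.mul_iff (h : c.Child F F') (hx : x ∈ F'.Q) : x ∈ c.Mul F ↔ F'.Q ⊆ c.Mul F := by
  refine ⟨fun hm => ?_, fun hs => hs hx⟩
  rw [(h.nxt_eq hx).2.2, nxt_of_mem hm]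
  exact fun w hw => hw.1

/-- Stability is the choice of `scale`. Connectedness slightly below the bottom level is, for
children inside `Mul F`, the relation by which their components were grouped. -/
theorem Child.wf (h : c.Child F F') : c.WF F' := by
  obtain ⟨hF, v, hv, hvl, rfl⟩ := h
  by_cases hm : v ∈ c.Mul F
  · have hs := scale_spec hF.exists_scale
    have hmem := mem_nxt (c := c) (F := F) hvl
    rw [nxt_of_mem hm] at hmem ⊢
    refine ⟨⟨v, hmem⟩, fun x hx => hx.1.2.1, ?_, fun x hx y hy => hx.2.symm.trans hy.2, ?_, hs.1⟩
    · intro x hx y hxy hy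
      have hxy' : Conn c.G (Above c.lev (c.top F)) x y := Conn.of_adj hxy hx.1.2.1 hy
      exact ⟨hF.mul_of_conn hx.1 hxy',
        hx.2.trans (hxy'.mono (above_subset (Nat.sub_le _ _)))⟩
    · exact fun x hx hxl y hy hyl => hs.2 x ⟨hx.1, hxl⟩ y ⟨hy.1, hyl⟩
  · have hs := scale_spec (c := c) (S := {w | Conn c.G (Above c.lev (c.top F)) v w})
      (l := c.top F) (exists_scale_component c _ _)
    have hmem := mem_nxt (c := c) (F := F) hvl
    rw [nxt_of_notMem hm] at hmem ⊢
    refine ⟨⟨v, hmem⟩, fun x hx => Conn.right_mem (S := Above _ _) hx, ?_, fun x hx y hy => ?_, ?_,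
      hs.1⟩
    · intro x hx y hxy hy
      exact Conn.trans hx (Conn.of_adj hxy (Conn.right_mem (S := Above _ _) hx) hy)
    · exact (Conn.trans (Conn.symm hx) hy).mono (above_subset (Nat.sub_le _ _))
    · exact fun x hx hxl y hy hyl => hs.2 x ⟨hx, hxl⟩ y ⟨hy, hyl⟩

/-- Stability is trivial, as a component has only one vertex of level zero. -/
theorem wf_root (v : V) : c.WF (c.root v) := by
  refine ⟨⟨v, .refl v⟩, fun _ _ => Nat.zero_le _, fun x hx y hxy _ => hx.trans hxy.reachable,
    fun x hx y hy => (Conn.univ_of_reachable (hx.symm.trans hy)).mono ?_, ?_, c.num_pos⟩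
  · simp [root, Above]
  · intro x hx hxl y hy hyl _
    obtain rfl := c.isLevel.root x y (hx.symm.trans hy) hxl hyl
    exact Conn.refl ⟨by simp [root], by omega⟩

theorem wf_of_desc (hF : c.WF F) (h : ReflTransGen c.Child F F') : c.WF F' := by
  cases h with
  | refl => exact hF
  | tail _ h => exact h.wf

theorem subset_of_desc (h : ReflTransGen c.Child F F') : F'.Q ⊆ F.Q := by
  induction h with
  | refl => rfl
  | tail _ h ih => exact fun x hx => ih (h.nxt_eq hx).1

theorem l_le_of_desc (h : ReflTransGen c.Child F F') : F.l ≤ F'.l := by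
  induction h with
  | refl => rfl
  | tail _ h ih =>
    have := h.wf_left.le_top
    rw [h.l_eq]
    omega

theorem top_le_of_desc (h : TransGen c.Child F F') : c.top F ≤ F'.l := by
  obtain ⟨F₁, h1, h2⟩ := TransGen.head'_iff.1 h
  exact h1.l_eq.symm.le.trans (l_le_of_desc h2)

/-- Two families that descend from a common family are comparable if they meet. -/
theorem desc_total {A B : Fam V} (hA : ReflTransGen c.Child F A) (hB : ReflTransGen c.Child F B)
    (hvA : v ∈ A.Q) (hvB : v ∈ B.Q) :
    ReflTransGen c.Child A B ∨ ReflTransGen c.Child B A := by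
  induction hA using ReflTransGen.head_induction_on with
  | refl => exact .inl hB
  | head h hA ih =>
    rcases ReflTransGen.cases_head hB with rfl | ⟨G, hG, hGB⟩
    · exact .inr (.head h hA)
    · have h1 := (h.nxt_eq (subset_of_desc hA hvA)).2.2
      have h2 := (hG.nxt_eq (subset_of_desc hGB hvB)).2.2
      exact ih (by rwa [h1, ← h2])

variable (c) in
/-- A family that occurs in the decomposition. -/
def Occ (F : Fam V) : Prop := ∃ v, ReflTransGen c.Child (c.root v) F

theorem root_eq (h : c.G.Reachable x y) : c.root x = c.root y := by
  simp only [root, Fam.mk.injEq, and_true]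
  ext w
  exact ⟨h.symm.trans, h.trans⟩

theorem occ_root (v : V) : c.Occ (c.root v) := ⟨v, .refl⟩

theorem Occ.desc (h : c.Occ F) (h' : ReflTransGen c.Child F F') : c.Occ F' := by
  obtain ⟨v, hv⟩ := h
  exact ⟨v, hv.trans h'⟩

theorem Occ.wf (h : c.Occ F) : c.WF F := by
  obtain ⟨v, hv⟩ := h
  exact wf_of_desc (wf_root v) hv

theorem Occ.root_desc (h : c.Occ F) (hv : v ∈ F.Q) : ReflTransGen c.Child (c.root v) F := by
  obtain ⟨w, hw⟩ := h
  rwa [← root_eq (subset_of_desc hw hv)]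

theorem Occ.total {A B : Fam V} (hA : c.Occ A) (hB : c.Occ B) (hvA : v ∈ A.Q) (hvB : v ∈ B.Q) :
    ReflTransGen c.Child A B ∨ ReflTransGen c.Child B A :=
  desc_total (hA.root_desc hvA) (hB.root_desc hvB) hvA hvB

theorem WF.exists_desc (hF : c.WF F) (hv : v ∈ F.Q) :
    ∃ A, ReflTransGen c.Child F A ∧ v ∈ A.Q ∧ c.lev v < c.top A := by
  induction h : c.lev v - F.l using Nat.strong_induction_on generalizing F with
  | _ n ih =>
    by_cases hlt : c.lev v < c.top F
    · exact ⟨F, .refl, hv, hlt⟩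
    · push Not at hlt
      have hch : c.Child F (c.nxt F v) := ⟨hF, v, hv, hlt, rfl⟩
      have h1 := hF.le_top
      have h2 := c.wid_le_gap
      have h3 := c.sc_le_wid hF.lt_num
      have h4 := c.pos
      obtain ⟨A, hA, h⟩ := ih _ (by rw [← h, nxt_l]; omega) hch.wf (mem_nxt hlt) rfl
      exact ⟨A, .head hch hA, h⟩

variable (c) in
/-- The family in whose region `v` lies. -/
noncomputable def fam (v : V) : Fam V :=
  ((wf_root (c := c) v).exists_desc (v := v) (SimpleGraph.Reachable.refl v)).choose

theorem fam_spec (v : V) :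
    ReflTransGen c.Child (c.root v) (c.fam v) ∧ v ∈ (c.fam v).Q ∧ c.lev v < c.top (c.fam v) :=
  ((wf_root (c := c) v).exists_desc (v := v) (SimpleGraph.Reachable.refl v)).choose_spec

theorem occ_fam (v : V) : c.Occ (c.fam v) := ⟨v, (fam_spec v).1⟩

theorem wf_fam (v : V) : c.WF (c.fam v) := (occ_fam v).wf

theorem Occ.desc_fam (hF : c.Occ F) (hv : v ∈ F.Q) : ReflTransGen c.Child F (c.fam v) := by
  obtain ⟨-, h1, h2⟩ := fam_spec (c := c) v
  rcases hF.total (occ_fam v) hv h1 with h | h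
  · exact h
  · rcases reflTransGen_iff_eq_or_transGen.1 h with h | h
    · rw [h]
    · have := top_le_of_desc h
      have := hF.wf.above v hv
      omega

theorem Occ.mem_iff (hF : c.Occ F) : v ∈ F.Q ↔ ReflTransGen c.Child F (c.fam v) :=
  ⟨hF.desc_fam, fun h => subset_of_desc h (fam_spec v).2.1⟩

theorem Occ.fam_eq (hF : c.Occ F) (hv : v ∈ F.Q) (hlt : c.lev v < c.top F) : c.fam v = F := by
  rcases reflTransGen_iff_eq_or_transGen.1 (hF.desc_fam hv) with h | h
  · exact h
  · have h1 := top_le_of_desc h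
    have h2 := (wf_fam (c := c) v).above v (fam_spec v).2.1
    omega

theorem Occ.exists_parent (hF : c.Occ F) (hl : 0 < F.l) : ∃ P, c.Occ P ∧ c.Child P F := by
  obtain ⟨v, hv⟩ := hF
  rcases ReflTransGen.cases_tail hv with h | ⟨P, hP, h⟩
  · rw [h] at hl
    simp [root] at hl
  · exact ⟨P, ⟨v, hP⟩, h⟩

/-- Both parents contain `F`, so they are comparable. If `P'` were a proper descendant of `P`, its
bottom would be at least `top P = F.l = top P'`, but a family is cut off well above its bottom. -/
theorem parent_unique {P P' : Fam V} (hP : c.Occ P) (hP' : c.Occ P') (h : c.Child P F)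
    (h' : c.Child P' F) : P = P' := by
  obtain ⟨x, hx⟩ := h.wf.nonempty
  have key : ∀ {P P' : Fam V}, c.Child P F → c.Child P' F → TransGen c.Child P P' → False := by
    intro P P' h h' hd
    have h1 := top_le_of_desc hd
    have h2 := h'.wf_left.le_top
    have h3 := c.wid_le_gap
    have h4 := c.sc_le_wid h.wf.lt_num
    have h5 := c.pos
    rw [← h.l_eq, h'.l_eq] at h1
    omega
  rcases hP.total hP' (h.nxt_eq hx).1 (h'.nxt_eq hx).1 with hd | hd <;>
  rcases reflTransGen_iff_eq_or_transGen.1 hd with hd | hd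
  exacts [hd.symm, (key h h' hd).elim, hd, (key h' h hd).elim]

/-- Edges between different regions lead from a region to one following it. -/
theorem child_of_adj (h : c.G.Adj x y) (hxy : c.lev x ≤ c.lev y) (hne : c.fam x ≠ c.fam y) :
    c.Child (c.fam x) (c.fam y) ∧ c.lev y = (c.fam y).l ∧ c.lev x + 1 = c.lev y := by
  obtain ⟨-, hy, hylt⟩ := fam_spec (c := c) y
  have hwf := wf_fam (c := c) y
  have h1 := hwf.above y hy
  have h2 := c.isLevel.adj _ _ h
  have h3 : c.lev x < (c.fam y).l := by
    by_contra! hle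
    exact hne ((occ_fam y).fam_eq (hwf.closed y hy x h.symm hle) (by omega))
  obtain ⟨P, hP, hch⟩ := (occ_fam (c := c) y).exists_parent (by omega)
  have h4 := hch.l_eq
  have h5 := hP.wf.le_top
  have h6 := c.wid_le_gap
  have h7 := c.sc_le_wid hP.wf.lt_num
  have h8 := c.pos
  have hx : c.fam x = P := hP.fam_eq
    (hP.wf.closed y (hch.nxt_eq hy).1 x h.symm (by omega)) (by omega)
  exact ⟨by rwa [hx], by omega, by omega⟩

theorem WF.lt_mem_omP (hF : c.WF F) (hx : x ∈ F.Q) (hlt : c.lev x ≤ c.top F) : x ∈ c.OmP F := by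
  have h1 := c.sc_le_wid hF.lt_num
  have h2 := c.pos
  exact .inr ⟨hx, by omega⟩

variable (c) in
/-- Vertices of the same bag. -/
def SameBag (x y : V) : Prop := c.fam x = c.fam y ∧ Conn c.G (c.OmP (c.fam x)) x y

variable (c) in
/-- The partition into bags. -/
def bagSetoid : Setoid V where
  r := c.SameBag
  iseqv :=
    { refl x := ⟨rfl, Conn.refl
        ((wf_fam x).lt_mem_omP (fam_spec x).2.1 (fam_spec x).2.2.le)⟩
      symm h := ⟨h.1.symm, by rw [← h.1]; exact h.2.symm⟩
      trans h h' := ⟨h.1.trans h'.1, h.2.trans (by rw [h.1]; exact h'.2)⟩ }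

variable (c) in
/-- The nodes of the quotient graph. -/
abbrev Node : Type _ := Quotient c.bagSetoid

variable (c) in
/-- The node whose bag contains a given vertex. -/
def node (v : V) : c.Node := Quotient.mk c.bagSetoid v

theorem node_eq_iff : c.node x = c.node y ↔ c.SameBag x y := Quotient.eq (r := c.bagSetoid)

theorem exists_node (h : c.Node) : ∃ v, c.node v = h := Quotient.exists_rep h

variable (c) in
/-- The quotient graph. -/
def quot : SimpleGraph c.Node where
  Adj g h := g ≠ h ∧ ∃ x y, c.node x = g ∧ c.node y = h ∧ c.G.Adj x y
  symm := ⟨fun _ _ ⟨hne, x, y, hx, hy, h⟩ => ⟨hne.symm, y, x, hy, hx, h.symm⟩⟩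
  loopless := ⟨fun _ h => h.1 rfl⟩

variable (c) in
/-- The partition of the vertices into bags. -/
def part : GraphPartition c.G c.quot where
  bag h := {v | c.node v = h}
  existsUnique_mem_bag a := ⟨c.node a, rfl, fun _ h => h.symm⟩
  eq_or_adj a b hab g h hg hh := by
    by_cases hgh : g = h
    · exact .inl hgh
    · exact .inr ⟨hgh, a, b, hg, hh, hab⟩

theorem part_isHonest : c.part.IsHonest :=
  ⟨fun h => exists_node h, fun _ _ ⟨_, x, y, hx, hy, h⟩ => ⟨x, hx, y, hy, h⟩⟩

/-- A bag need not induce a connected subgraph, but it lies in a component of `OmP`, whose height is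
at most `4 * gap`: the cut is at most `2 * gap` above the bottom, and the margins are small against
`gap`. -/
theorem part_isBounded : c.part.IsBounded (c.t * (9 * c.K + 2 * (4 * c.gap))) := by
  rintro h x rfl y hy
  obtain ⟨-, hconn⟩ := node_eq_iff.1 (show c.node x = c.node y from hy.symm)
  have hF := wf_fam (c := c) x
  have h1 := hF.cutLevel.le_add
  have h2 := c.wid_le_gap
  have h3 := c.sc_le_wid hF.lt_num
  have h4 := c.sc_succ (c.fam x).i
  refine (c.isLevel.near_of_conn c.pos c.two_le c.not_minor
    (n := (c.fam x).l - c.sc ((c.fam x).i + 1)) (hconn.mono ?_)).edist_le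
  rintro z (hz | hz)
  · exact slab_subset le_rfl (by omega) hz
  · have := hF.above z hz.1
    have := hz.2
    exact ⟨by omega, by omega⟩

/-- Adjacent vertices of the same region lie in the same bag. -/
theorem node_eq_of_adj (h : c.G.Adj x y) (hxy : c.fam x = c.fam y) : c.node x = c.node y := by
  have hx := fam_spec (c := c) x
  have hy := fam_spec (c := c) y
  refine node_eq_iff.2 ⟨hxy, Conn.of_adj h ((wf_fam x).lt_mem_omP hx.2.1 hx.2.2.le) ?_⟩
  rw [hxy]
  exact (wf_fam y).lt_mem_omP hy.2.1 hy.2.2.le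

/-- A family that is not attached to several bags is attached to at most one. -/
theorem node_eq_of_child {u u' v v' : V} (hch : c.Child F F') (hm : ¬ F'.Q ⊆ c.Mul F)
    (hu : c.fam u = F) (hu' : c.fam u' = F) (hv : v ∈ F'.Q) (hv' : v' ∈ F'.Q)
    (hvl : c.lev v = c.top F) (hvl' : c.lev v' = c.top F) (huv : c.G.Adj u v)
    (huv' : c.G.Adj u' v') : c.node u = c.node u' := by
  have hF := hch.wf_left
  have hv'' := hch.nxt_eq hv
  have hvm := fun h => hm ((hch.mul_iff hv).1 h)
  have hconn : Conn c.G (Above c.lev (c.top F)) v v' := by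
    rw [hv''.2.2, nxt_of_notMem hvm] at hv'
    exact hv'
  have hOm : Conn c.G (c.OmP F) v v' := by
    by_contra hcon
    exact hvm ⟨hv''.1, hv''.2.1, v, v', hvl, hvl', Conn.refl hv''.2.1, hconn, hcon⟩
  have hs := fam_spec (c := c) u
  have hs' := fam_spec (c := c) u'
  rw [hu] at hs
  rw [hu'] at hs'
  refine node_eq_iff.2 ⟨hu.trans hu'.symm, ?_⟩
  rw [hu]
  exact ((Conn.of_adj huv (hF.lt_mem_omP hs.2.1 hs.2.2.le) hOm.left_mem).trans hOm).trans
    (Conn.of_adj huv'.symm hOm.right_mem (hF.lt_mem_omP hs'.2.1 hs'.2.2.le))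

end Frame

end FatMinor

/-! ### Cores of bags and tubes of families -/

namespace FatMinor

open SimpleGraph Relation

namespace Frame

variable {V : Type*} {c : Frame V} {F F' : Fam V} {u v x y : V}

variable (c) in
/-- The scale used by the families that follow `F` and attach to several bags. -/
noncomputable def mscale (F : Fam V) : ℕ := c.scale (c.Mul F) (c.top F)

variable (c) in
/-- The upper end of the sets that represent the bags in the region of `F`. -/
noncomputable def low (F : Fam V) : ℕ := c.top F - c.sc (c.mscale F) - 2 * c.K

variable (c) in
/-- The connected set representing a bag. -/
def core (h : c.Node) : Set V :=
  {u | ∃ s, c.node s = h ∧ c.lev s = (c.fam s).l ∧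
    Conn c.G (c.Om (c.fam s) (c.low (c.fam s)) (c.sc (c.fam s).i)) s u}

variable (c) in
/-- The region above the bottom level of `F` together with the part of the window around the bottom
level attached to it. -/
def tube (F : Fam V) : Set V :=
  F.Q ∪ {u | ∃ s ∈ F.Q, c.lev s = F.l ∧ Conn c.G
    (Slab c.lev (F.l - (c.sc (F.i + 1) - c.K)) (F.l + (c.sc (F.i + 1) - c.K))) s u}

theorem mscale_lt (hF : c.WF F) : c.mscale F < c.num := (scale_spec hF.exists_scale).1

theorem WF.bounds (hF : c.WF F) : 0 < c.K ∧ 10 * c.K ≤ c.sc F.i ∧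
    c.sc (F.i + 1) = c.sc F.i + 10 * c.K ∧ c.sc F.i + 30 * c.K ≤ c.wid ∧ 10 * c.wid ≤ c.gap ∧
    F.l + c.gap ≤ c.top F ∧ c.sc (c.mscale F) + 30 * c.K ≤ c.wid ∧
    c.low F + c.sc (c.mscale F) + 2 * c.K = c.top F :=
  have h1 := c.sc_le_wid (mscale_lt hF)
  have h2 := c.wid_le_gap
  have h3 := hF.le_top
  ⟨c.pos, c.le_sc _, c.sc_succ _, c.sc_le_wid hF.lt_num, h2, h3, h1, by unfold low; omega⟩

theorem MChild.nxt_eq (h : c.MChild F F') (hx : x ∈ F'.Q) : x ∈ c.Mul F ∧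
    F' = ⟨{w | w ∈ c.Mul F ∧ Conn c.G (Above c.lev (c.top F - c.sc (c.mscale F))) x w},
      c.top F, c.mscale F⟩ := by
  refine ⟨h.2 hx, ?_⟩
  rw [(h.1.nxt_eq hx).2.2, nxt_of_mem (h.2 hx)]
  rfl

theorem MChild.i_eq (h : c.MChild F F') : F'.i = c.mscale F := by
  obtain ⟨x, hx⟩ := h.1.wf.nonempty
  rw [(h.nxt_eq hx).2]

theorem MChild.eq_of_conn {A B : Fam V} (hA : c.MChild F A) (hB : c.MChild F B) (hx : x ∈ A.Q)
    (hy : y ∈ B.Q) (h : Conn c.G (Above c.lev (c.top F - c.sc (c.mscale F))) x y) : A = B := by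
  rw [(hA.nxt_eq hx).2, (hB.nxt_eq hy).2]
  congr 1
  ext w
  exact ⟨fun h' => ⟨h'.1, h.symm.trans h'.2⟩, fun h' => ⟨h'.1, h.trans h'.2⟩⟩

theorem WF.exists_of_mem_tube (hF : c.WF F) (hx : x ∈ c.tube F)
    (hl : c.lev x ≤ F.l + (c.sc (F.i + 1) - c.K)) : ∃ s ∈ F.Q, c.lev s = F.l ∧ Conn c.G
    (Slab c.lev (F.l - (c.sc (F.i + 1) - c.K)) (F.l + (c.sc (F.i + 1) - c.K))) s x := by
  rcases hx with hx | hx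
  · obtain ⟨s, hs, hsl, h⟩ := hF.exists_bottom hx
    refine ⟨s, hs, hsl, h.symm.mono fun z hz => ?_⟩
    have := hF.above z hz.1
    exact ⟨by omega, by have := hz.2; omega⟩
  · exact hx

theorem WF.le_of_mem_tube (hF : c.WF F) (hx : x ∈ c.tube F) : F.l ≤ c.lev x + c.wid := by
  have := hF.bounds
  rcases hx with hx | ⟨s, -, -, hx⟩
  · have := hF.above x hx
    omega
  · have := hx.right_mem.1
    omega

/-- Such siblings share one scale. Near their common bottom level, a walk of length less than `K`
between the tubes would connect them at radius `sc (i + 1)`, by stability also at radius `sc i`, and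
the siblings would have been grouped together. Higher up, the tubes lie in different components
above the bottom level. -/
theorem tube_farApart {A B : Fam V} (hA : c.MChild F A) (hB : c.MChild F B) (hne : A ≠ B) :
    FarApart c.G c.K (c.tube A) (c.tube B) := by
  have hF := hA.1.wf_left
  have hAl := hA.1.l_eq
  have hBl := hB.1.l_eq
  have hb := hA.1.wf.bounds
  have hb' := hF.bounds
  have key : ∀ x ∈ c.tube A, ∀ y ∈ c.tube B,
      c.lev x ≤ A.l + (c.sc (A.i + 1) - c.K) → c.lev y ≤ B.l + (c.sc (B.i + 1) - c.K) →
      ∀ k < c.K, ¬ Near c.G k x y := by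
    intro x hx y hy hxl hyl k hk hn
    obtain ⟨s, hs, hsl, hsx⟩ := hA.1.wf.exists_of_mem_tube hx hxl
    obtain ⟨r, hr, hrl, hry⟩ := hB.1.wf.exists_of_mem_tube hy hyl
    have h1 := hsx.right_mem
    rw [hA.i_eq] at *
    rw [hB.i_eq] at *
    rw [hAl] at *
    rw [hBl] at *
    set i := c.mscale F with hi
    set m := c.top F with hm
    have hsub : Slab c.lev (m - (c.sc (i + 1) - c.K)) (m + (c.sc (i + 1) - c.K)) ⊆
      Slab c.lev (m - c.sc (i + 1)) (m + c.sc (i + 1)) := slab_subset (by omega) (by omega)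
    have hxy : Conn c.G (Slab c.lev (m - c.sc (i + 1)) (m + c.sc (i + 1))) x y :=
      (c.isLevel.conn_of_near hn).mono (slab_subset (by have := h1.1; omega)
        (by have := h1.2; omega))
    have hsr := (scale_spec hF.exists_scale).2 s ⟨hA.2 hs, hsl⟩ r ⟨hB.2 hr, hrl⟩
      (((hsx.mono hsub).trans hxy).trans (hry.mono hsub).symm)
    exact hne (hA.eq_of_conn hB hs hr (hsr.mono fun z hz => hz.1))
  have hii : A.i = B.i := hA.i_eq.trans hB.i_eq.symm
  rw [farApart_iff]
  intro x hx y hy k hk hn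
  have key' : ∀ z ∈ A.Q, z ∈ c.tube B → False := by
    intro z hz hz'
    rcases hz' with hz' | ⟨s, hs, hsl, hsz⟩
    · have := (hA.1.nxt_eq hz).2.2.trans (hB.1.nxt_eq hz').2.2.symm
      exact hne this
    · have h2 := hsz.right_mem.2
      exact key z (.inl hz) z (.inr ⟨s, hs, hsl, hsz⟩) (by rw [hAl, hii, ← hBl]; omega)
        (by omega) 0 c.pos (Near.refl _ _)
  have key'' : ∀ z ∈ B.Q, z ∈ c.tube A → False := by
    intro z hz hz'
    rcases hz' with hz' | ⟨s, hs, hsl, hsz⟩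
    · have := (hA.1.nxt_eq hz').2.2.trans (hB.1.nxt_eq hz).2.2.symm
      exact hne this
    · have h2 := hsz.right_mem.2
      exact key z (.inr ⟨s, hs, hsl, hsz⟩) z (.inl hz) (by omega)
        (by rw [hBl, ← hii, ← hAl]; omega) 0 c.pos (Near.refl _ _)
  by_cases hxl : c.lev x ≤ A.l + (c.sc (A.i + 1) - c.K)
  · by_cases hyl : c.lev y ≤ B.l + (c.sc (B.i + 1) - c.K)
    · exact key x hx y hy hxl hyl k hk hn
    · have hyQ : y ∈ B.Q := by
        rcases hy with hy | ⟨s, hs, hsl, hsy⟩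
        · exact hy
        · exact absurd hsy.right_mem.2 hyl
      refine key'' x ?_ hx
      refine hB.1.wf.mem_of_conn hyQ ((c.isLevel.conn_of_near hn.symm).mono fun z hz => ?_)
      have := hz.1
      simp only [Above, Set.mem_ofPred_eq]
      rw [← hii] at hyl
      omega
  · have hxQ : x ∈ A.Q := by
      rcases hx with hx | ⟨s, hs, hsl, hsx⟩
      · exact hx
      · exact absurd hsx.right_mem.2 hxl
    refine key' y ?_ hy
    refine hA.1.wf.mem_of_conn hxQ ((c.isLevel.conn_of_near hn).mono fun z hz => ?_)
    have := hz.1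
    simp only [Above, Set.mem_ofPred_eq]
    omega

theorem Child.tube_subset (h : c.Child F F') : c.tube F' ⊆ F.Q := by
  have h1 := h.wf_left.bounds
  have h2 := h.wf.bounds
  have h3 := h.l_eq
  rintro x (hx | ⟨s, hs, hsl, hsx⟩)
  · exact (h.nxt_eq hx).1
  · refine h.wf_left.mem_of_conn (h.nxt_eq hs).1 (hsx.mono fun z hz => ?_)
    have := hz.1
    simp only [Above, Set.mem_ofPred_eq]
    omega

theorem tube_subset_of_desc (h : ReflTransGen c.Child F F') : c.tube F' ⊆ c.tube F := by
  induction h with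
  | refl => rfl
  | tail _ h ih => exact h.tube_subset.trans (Set.subset_union_left.trans ih)

/-- Two elements that descend from a common one are comparable, or they descend from different
immediate descendants of some element. -/
theorem exists_branching {X : Type*} {r : X → X → Prop} {a b d : X} (ha : ReflTransGen r d a)
    (hb : ReflTransGen r d b) (hab : ¬ ReflTransGen r a b) (hba : ¬ ReflTransGen r b a) :
    ∃ o a' b', r o a' ∧ r o b' ∧ a' ≠ b' ∧ ReflTransGen r a' a ∧ ReflTransGen r b' b := by
  induction ha using ReflTransGen.head_induction_on with
  | refl => exact absurd hb hab
  | @head d e h ha ih =>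
    by_cases heb : ReflTransGen r e b
    · exact ih heb
    · rcases ReflTransGen.cases_head hb with rfl | ⟨e', he', hb'⟩
      · exact absurd (.head h ha) hba
      · exact ⟨d, e, e', h, he', fun h => heb (h ▸ hb'), ha, hb'⟩

theorem desc_of_mdesc (h : ReflTransGen c.MChild F F') : ReflTransGen c.Child F F' :=
  ReflTransGen.mono (fun _ _ h => h.1) _ _ h

/-- Incomparable families have tubes that are far apart. -/
theorem tube_farApart_of_incomparable {A B : Fam V} (hA : ReflTransGen c.MChild F A)
    (hB : ReflTransGen c.MChild F B) (hAB : ¬ ReflTransGen c.MChild A B)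
    (hBA : ¬ ReflTransGen c.MChild B A) : FarApart c.G c.K (c.tube A) (c.tube B) := by
  obtain ⟨o, a', b', ha, hb, hne, ha', hb'⟩ := exists_branching hA hB hAB hBA
  exact (tube_farApart ha hb hne).mono (tube_subset_of_desc (desc_of_mdesc ha'))
    (tube_subset_of_desc (desc_of_mdesc hb'))

variable (c) in
/-- The family of a node. -/
noncomputable def nfam : c.Node → Fam V := Quotient.lift c.fam fun _ _ h => h.1

theorem nfam_node (x : V) : c.nfam (c.node x) = c.fam x := rfl

theorem wf_nfam (h : c.Node) : c.WF (c.nfam h) := by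
  obtain ⟨x, rfl⟩ := exists_node h
  exact wf_fam x

theorem WF.om_low_subset (hF : c.WF F) : c.Om F (c.low F) (c.sc F.i) ⊆ c.OmP F := by
  have := hF.bounds
  exact c.om_mono (by omega) (by omega)

/-- Sets attached to different bags of the same region are far apart. -/
theorem farApart_of_node_ne {A B : Set V} (hxy : c.fam x = c.fam y) (hne : c.node x ≠ c.node y)
    (hA : ∀ a ∈ A, a ∈ c.Om (c.fam x) (c.top (c.fam x) + c.wid - c.K)
      (c.sc ((c.fam x).i + 1) - c.K) ∧ Conn c.G (c.OmP (c.fam x)) x a)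
    (hB : ∀ b ∈ B, Conn c.G (c.OmP (c.fam y)) y b) : FarApart c.G c.K A B := by
  rw [farApart_iff]
  intro a ha b hb k hk hn
  refine hne (node_eq_iff.2 ⟨hxy, (hA a ha).2.trans
    (((wf_fam x).conn_of_near hk.le ?_ (hA a ha).1 hn).trans ?_)⟩)
  · omega
  · rw [hxy]
    exact (hB b hb).symm

theorem mem_core (h : u ∈ c.core (c.node x)) :
    u ∈ c.Om (c.fam x) (c.low (c.fam x)) (c.sc (c.fam x).i) ∧
      Conn c.G (c.OmP (c.fam x)) x u := by
  obtain ⟨s, hs, -, hsu⟩ := h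
  obtain ⟨hs1, hs2⟩ := node_eq_iff.1 hs
  rw [hs1] at hs2 hsu
  exact ⟨hsu.right_mem, hs2.symm.trans (hsu.mono (wf_fam x).om_low_subset)⟩

theorem core_lev {h : c.Node} (hu : u ∈ c.core h) :
    (c.nfam h).l ≤ c.lev u + c.sc (c.nfam h).i ∧ c.lev u < c.low (c.nfam h) := by
  obtain ⟨x, rfl⟩ := exists_node h
  have h1 := (wf_fam (c := c) x).bounds
  rw [nfam_node]
  rcases (mem_core hu).1 with h | h
  · have := h.1
    have := h.2
    omega
  · have := (wf_fam (c := c) x).above u h.1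
    have := h.2
    omega

/-- The core leaves `Q` only through bottom vertices, and its parts outside `Q` stay in the window
of radius `sc i`, which is narrower than the window of the tube. -/
theorem core_subset_tube (h : c.Node) : c.core h ⊆ c.tube (c.nfam h) := by
  rintro u ⟨s, rfl, hsl, hsu⟩
  have hF := wf_fam (c := c) s
  have hb := hF.bounds
  rw [nfam_node]
  refine hsu.mem_of_closed (T := c.tube (c.fam s)) (.inl (fam_spec s).2.1) ?_
  intro a ha b hab hb'
  by_cases hbQ : b ∈ (c.fam s).Q
  · exact .inl hbQ
  right
  rcases hb' with hb' | hb'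
  swap
  · exact absurd hb'.1 hbQ
  have hb'' : b ∈ Slab c.lev ((c.fam s).l - (c.sc ((c.fam s).i + 1) - c.K))
      ((c.fam s).l + (c.sc ((c.fam s).i + 1) - c.K)) := slab_subset (by omega) (by omega) hb'
  by_cases haQ : a ∈ (c.fam s).Q
  · have h1 : ¬ (c.fam s).l ≤ c.lev b := fun h => hbQ (hF.closed a haQ b hab h)
    have h2 := c.isLevel.adj _ _ hab.symm
    have h3 := hF.above a haQ
    exact ⟨a, haQ, by omega, Conn.of_adj hab ⟨by omega, by omega⟩ hb''⟩
  · rcases ha with ha | ⟨r, hr, hrl, hra⟩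
    · exact absurd ha haQ
    · exact ⟨r, hr, hrl, hra.trans (Conn.of_adj hab hra.right_mem hb'')⟩

theorem exists_bottom_node (h : c.Node) {x : V} (hx : x ∈ (c.nfam h).Q) {y : V}
    (hy : c.node y = h) (hyx : Conn c.G (c.OmP (c.nfam h)) y x)
    (hl : c.lev x < c.top (c.nfam h)) {m : ℕ} (hm : c.lev x < m) (hm' : m ≤ c.top (c.nfam h)) :
    ∃ s, c.node s = h ∧ c.lev s = (c.nfam h).l ∧
      Conn c.G (c.Om (c.nfam h) m (c.sc (c.nfam h).i)) x s := by
  subst hy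
  rw [nfam_node] at *
  have hF := wf_fam (c := c) y
  have hb := hF.bounds
  obtain ⟨s, hs, hsl, hxs⟩ := hF.exists_bottom_om hx (m := m) (a := c.sc (c.fam y).i) hm
  have hfs : c.fam s = c.fam y := (occ_fam y).fam_eq hs (by omega)
  refine ⟨s, (node_eq_iff.2 ⟨hfs.symm, hyx.trans (hxs.mono ?_)⟩).symm, hsl, hxs⟩
  exact c.om_mono (by omega) (by omega)

/-- By `stable_omP`, the bottom vertices of a bag are already joined in the low region with narrow
window, so the core is a single component of it. -/
theorem sconn_core (h : c.Node) : SConn c.G (c.core h) := by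
  obtain ⟨x, rfl⟩ := exists_node h
  have hF := wf_fam (c := c) x
  have hb := hF.bounds
  obtain ⟨-, hx, hxl⟩ := fam_spec (c := c) x
  obtain ⟨s, hs, hsl, -⟩ := exists_bottom_node (c.node x) (x := x) hx rfl
    (Conn.refl (hF.lt_mem_omP hx hxl.le)) hxl hxl le_rfl
  obtain ⟨hs1, hs2⟩ := node_eq_iff.1 hs
  rw [nfam_node, ← hs1] at hsl
  have hmem : s ∈ c.Om (c.fam s) (c.low (c.fam s)) (c.sc (c.fam s).i) :=
    .inl ⟨by omega, by omega⟩
  have : c.core (c.node x) =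
      {u | Conn c.G (c.Om (c.fam s) (c.low (c.fam s)) (c.sc (c.fam s).i)) s u} := by
    ext u
    constructor
    · rintro ⟨r, hr, hrl, hru⟩
      obtain ⟨h1, h2⟩ := node_eq_iff.1 (hs.trans hr.symm)
      have hF' := wf_fam (c := c) s
      have hb' := hF'.bounds
      rw [← h1] at hru hrl
      refine Conn.trans (hF'.stable_omP (fam_spec s).2.1 hsl (by rw [h1]; exact (fam_spec r).2.1)
        hrl h2 ?_ le_rfl) hru
      omega
    · exact fun h => ⟨s, hs, hsl, h⟩
  rw [this]
  exact sconn_component hmem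

end Frame

end FatMinor

/-! ### Strands, gates and blocks -/

namespace FatMinor

open SimpleGraph Relation

namespace Frame

variable {V : Type*} {c : Frame V} {F F' : Fam V} {u v u' v' x y : V} {e e' : Sym2 c.Node}
  {S S' : Set V}

variable (c) in
/-- The depth to which connections from the bottom of a family lead down. -/
def down (F : Fam V) : ℕ := c.sc F.i + 2 * c.K + 1

variable (c) in
/-- `S` is a connected set that leads from the vertex `v` at the bottom of its region through its
neighbour `u` down into the region of `u`, and represents the edge `e` of the quotient graph. -/
structure Strand (e : Sym2 c.Node) (S : Set V) (u v : V) : Prop where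
  eq : e = s(c.node u, c.node v)
  adj : c.G.Adj u v
  child : c.Child (c.fam u) (c.fam v)
  lev_eq : c.lev v = (c.fam v).l
  sconn : SConn c.G S
  left_mem : u ∈ S
  right_mem : v ∈ S
  sub : S ⊆ Slab c.lev ((c.fam v).l - c.down (c.fam v)) (c.fam v).l
  exists_low : ∃ w ∈ S, c.lev w + c.down (c.fam v) = (c.fam v).l

/-- An edge between different bags enters the bottom level of a child region from below. The strand
continues it by a descent from its lower end. -/
theorem exists_strand {g h : c.Node} (hgh : c.quot.Adj g h) :
    ∃ S u v, c.Strand s(g, h) S u v := by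
  obtain ⟨hne, u, v, rfl, rfl, huv⟩ := hgh
  wlog hle : c.lev u ≤ c.lev v generalizing u v
  · rw [Sym2.eq_swap]
    exact this v u huv.symm hne.symm (by omega)
  have hfne : c.fam u ≠ c.fam v := fun h => hne (node_eq_of_adj huv h)
  obtain ⟨hch, hv, hu⟩ := child_of_adj huv hle hfne
  have h1 := hch.wf_left.bounds
  have h2 := hch.wf.bounds
  have h3 := hch.l_eq
  obtain ⟨w, hw, p, -, hp⟩ := c.isLevel.descent (n := (c.fam v).l - c.down (c.fam v)) (x := u)
    (by unfold down; omega)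
  refine ⟨{z | z ∈ (p.reverse.concat huv).support}, u, v, rfl, huv, hch, hv, sconn_support _,
    ?_, ?_, ?_, w, ?_, ?_⟩
  · simp [Walk.support_concat]
  · simp [Walk.support_concat]
  · intro z hz
    simp only [Walk.support_concat, Walk.support_reverse, List.mem_append,
      List.mem_reverse, List.mem_singleton, Set.mem_ofPred_eq] at hz
    rcases hz with hz | rfl
    · exact slab_subset le_rfl (by omega) (hp z hz)
    · exact ⟨by omega, by omega⟩
  · simp [Walk.support_concat]
  · unfold down at *; omega

namespace Strand

variable (h : c.Strand e S u v)
include h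

theorem bounds : c.down (c.fam v) + c.gap ≤ (c.fam v).l + c.wid ∧
    (c.fam u).l + c.gap ≤ (c.fam v).l ∧ c.down (c.fam v) + 27 * c.K ≤ c.wid ∧
    (c.fam v).l = c.top (c.fam u) := by
  have h1 := h.child.wf_left.bounds
  have h2 := h.child.wf.bounds
  have h3 := h.child.l_eq
  unfold down
  omega

theorem right_mem_left : v ∈ (c.fam u).Q := (h.child.nxt_eq (fam_spec v).2.1).1

theorem mem_left {a : V} (ha : a ∈ S) : a ∈ (c.fam u).Q := by
  have h1 := h.bounds
  have h2 := h.child.wf_left.bounds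
  refine h.child.wf_left.mem_of_conn h.right_mem_left ((h.sconn.2 v h.right_mem a ha).mono ?_)
  intro z hz
  have := (h.sub hz).1
  simp only [Above, Set.mem_ofPred_eq]
  omega

/-- Together with `conn_right`, this places a strand, with margin `K`, in the `OmP` components of
both its end bags. Hence it is far from everything attached to another bag of either region. -/
theorem conn_left {a : V} (ha : a ∈ S) :
    a ∈ c.Om (c.fam u) (c.top (c.fam u) + c.wid - c.K) (c.sc ((c.fam u).i + 1) - c.K) ∧
      Conn c.G (c.OmP (c.fam u)) u a := by
  have h1 := h.bounds
  have h2 := h.child.wf_left.bounds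
  have hlev : ∀ z ∈ S, c.lev z ≤ c.top (c.fam u) := fun z hz => by
    have := (h.sub hz).2
    omega
  refine ⟨.inr ⟨h.mem_left ha, ?_⟩, (h.sconn.2 u h.left_mem a ha).mono fun z hz =>
    h.child.wf_left.lt_mem_omP (h.mem_left hz) (hlev z hz)⟩
  have := hlev a ha
  omega

theorem conn_right {a : V} (ha : a ∈ S) :
    a ∈ c.Om (c.fam v) (c.top (c.fam v) + c.wid - c.K) (c.sc ((c.fam v).i + 1) - c.K) ∧
      Conn c.G (c.OmP (c.fam v)) v a := by
  have h2 := h.child.wf.bounds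
  have hsub : S ⊆ Slab c.lev ((c.fam v).l - (c.sc ((c.fam v).i + 1) - c.K))
      ((c.fam v).l + (c.sc ((c.fam v).i + 1) - c.K)) :=
    h.sub.trans (slab_subset (by unfold down; omega) (by omega))
  refine ⟨.inl (hsub ha), (h.sconn.2 v h.right_mem a ha).mono ((hsub.trans ?_).trans
    Set.subset_union_left)⟩
  exact slab_subset (by omega) (by omega)

theorem subset_tube : S ⊆ c.tube (c.fam v) := by
  intro a ha
  have h2 := h.child.wf.bounds
  refine .inr ⟨v, (fam_spec v).2.1, h.lev_eq, (h.sconn.2 v h.right_mem a ha).mono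
    (h.sub.trans (slab_subset ?_ (by omega)))⟩
  unfold down; omega

theorem inter_core_right : (S ∩ c.core (c.node v)).Nonempty := by
  have h2 := h.child.wf.bounds
  exact ⟨v, h.right_mem, v, rfl, h.lev_eq, Conn.refl (.inl ⟨by rw [h.lev_eq]; omega,
    by rw [h.lev_eq]; omega⟩)⟩

/-- The scale of the child is `mscale` of the parent, and `down` exceeds that scale plus `2 * K` by
one. So the strand ends strictly below `low` of the parent region, where the core of the lower bag
has absorbed the component. -/
theorem inter_core_left (hm : (c.fam v).Q ⊆ c.Mul (c.fam u)) :
    (S ∩ c.core (c.node u)).Nonempty := by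
  have hch : c.MChild (c.fam u) (c.fam v) := ⟨h.child, hm⟩
  have h1 := h.child.wf_left.bounds
  have h2 := h.child.wf.bounds
  have h3 := h.bounds
  obtain ⟨w, hwS, hw⟩ := h.exists_low
  have hi := hch.i_eq
  have hlow : c.lev w < c.low (c.fam u) := by
    unfold down at hw
    rw [hi] at hw
    omega
  obtain ⟨s, hs, hsl, hws⟩ := exists_bottom_node (c.node u) (x := w) (h.mem_left hwS) rfl
    (h.conn_left hwS).2 (by rw [nfam_node]; omega) (m := c.low (c.fam u)) hlow
    (by rw [nfam_node]; omega)
  obtain ⟨h5, -⟩ := node_eq_iff.1 hs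
  rw [nfam_node, ← h5] at hsl hws
  exact ⟨w, hwS, s, hs, hsl, hws.symm⟩

/-- A strand is far from the cores of other bags of its upper region. -/
theorem farApart_core_right {k : c.Node} (hk : c.nfam k = c.fam v) (hne : k ≠ c.node v) :
    FarApart c.G c.K S (c.core k) := by
  obtain ⟨x, rfl⟩ := exists_node k
  exact farApart_of_node_ne hk.symm hne.symm (fun a ha => h.conn_right ha)
    fun b hb => (mem_core hb).2

theorem farApart_core_left {k : c.Node} (hk : c.nfam k = c.fam u) (hne : k ≠ c.node u) :
    FarApart c.G c.K S (c.core k) := by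
  obtain ⟨x, rfl⟩ := exists_node k
  exact farApart_of_node_ne hk.symm hne.symm (fun a ha => h.conn_left ha)
    fun b hb => (mem_core hb).2

theorem farApart_right (h' : c.Strand e' S' u' v') (hf : c.fam v = c.fam v')
    (hne : c.node v ≠ c.node v') : FarApart c.G c.K S S' :=
  farApart_of_node_ne hf hne (fun _ ha => h.conn_right ha) fun _ hb => (h'.conn_right hb).2

theorem farApart_left (h' : c.Strand e' S' u' v') (hf : c.fam u = c.fam u')
    (hne : c.node u ≠ c.node u') : FarApart c.G c.K S S' :=
  farApart_of_node_ne hf hne (fun _ ha => h.conn_left ha) fun _ hb => (h'.conn_left hb).2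

end Strand

theorem farApart_of_lev {A B : Set V} {n : ℕ} (hA : ∀ a ∈ A, c.lev a ≤ n)
    (hB : ∀ b ∈ B, n + c.K ≤ c.lev b) : FarApart c.G c.K A B := by
  rw [farApart_iff]
  intro a ha b hb k hk hn
  have h1 := (c.isLevel.near hn).1
  have h2 := hA a ha
  have h3 := hB b hb
  omega

theorem farApart_core {g h : c.Node} (hgh : c.nfam g = c.nfam h) (hne : g ≠ h) :
    FarApart c.G c.K (c.core g) (c.core h) := by
  obtain ⟨x, rfl⟩ := exists_node g
  obtain ⟨y, rfl⟩ := exists_node h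
  have hb := (wf_fam (c := c) x).bounds
  refine farApart_of_node_ne hgh hne (fun a ha => ⟨?_, (mem_core ha).2⟩)
    fun b hb => (mem_core hb).2
  exact c.om_mono (by omega) (by omega) (mem_core ha).1

/-- Cores are far apart from everything attached to a following family. -/
theorem farApart_core_tube {h : c.Node} (hch : TransGen c.Child (c.nfam h) F)
    (hnot : ¬ c.Child (c.nfam h) F) : FarApart c.G c.K (c.core h) (c.tube F) := by
  obtain ⟨P, hP, hPF⟩ := TransGen.tail'_iff.1 hch
  rcases reflTransGen_iff_eq_or_transGen.1 hP with rfl | hP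
  · exact absurd hPF hnot
  have h1 := top_le_of_desc hP
  have h2 := hPF.wf_left.bounds
  have h3 := hPF.wf.bounds
  have h4 := hPF.l_eq
  have h5 := (wf_nfam h).bounds
  refine farApart_of_lev (n := c.top (c.nfam h)) (fun a ha => ?_) fun b hb => ?_
  · have := core_lev ha
    omega
  · have := hPF.wf.le_of_mem_tube hb
    omega

/-- Strands are far apart from everything attached to a family following their upper region. -/
theorem Strand.farApart_tube (h : c.Strand e S u v) (hch : TransGen c.Child (c.fam v) F) :
    FarApart c.G c.K S (c.tube F) := by
  have hF := wf_of_desc (wf_fam v) hch.to_reflTransGen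
  have h1 := top_le_of_desc hch
  have h2 := h.child.wf.bounds
  refine farApart_of_lev (n := (c.fam v).l) (fun a ha => (h.sub ha).2) fun b hb => ?_
  have := hF.le_of_mem_tube hb
  omega

/-- The core of the child goes down at most `sc (mscale)` below the cut, and `low` lies `2 * K`
deeper. -/
theorem farApart_core_of_mchild {g h : c.Node} (hch : c.MChild (c.nfam g) (c.nfam h)) :
    FarApart c.G c.K (c.core g) (c.core h) := by
  have h1 := (wf_nfam g).bounds
  have h2 := (wf_nfam h).bounds
  have h3 := hch.1.l_eq
  have h4 := hch.i_eq
  refine farApart_of_lev (n := c.low (c.nfam g)) (fun a ha => (core_lev ha).2.le) fun b hb => ?_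
  have := (core_lev hb).1
  rw [h4] at this
  omega

theorem farApart_core_of_mdesc {g h : c.Node} (hne : g ≠ h)
    (hd : ReflTransGen c.MChild (c.nfam g) (c.nfam h)) :
    FarApart c.G c.K (c.core g) (c.core h) := by
  rcases reflTransGen_iff_eq_or_transGen.1 hd with hd | hd
  · exact farApart_core hd.symm hne
  · by_cases hch : c.MChild (c.nfam g) (c.nfam h)
    · exact farApart_core_of_mchild hch
    · obtain ⟨P, hP, hPh⟩ := TransGen.head'_iff.1 hd
      refine (farApart_core_tube (TransGen.head' hP.1 (desc_of_mdesc hPh))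
        fun hc => hch ⟨hc, ?_⟩).mono subset_rfl (core_subset_tube h)
      have hsub := subset_of_desc (desc_of_mdesc hPh)
      exact hsub.trans hP.2

theorem farApart_core_core (hg : ReflTransGen c.MChild F (c.nfam g))
    (hh : ReflTransGen c.MChild F (c.nfam h)) (hne : g ≠ h) :
    FarApart c.G c.K (c.core g) (c.core h) := by
  by_cases h1 : ReflTransGen c.MChild (c.nfam g) (c.nfam h)
  · exact farApart_core_of_mdesc hne h1
  by_cases h2 : ReflTransGen c.MChild (c.nfam h) (c.nfam g)
  · exact (farApart_core_of_mdesc hne.symm h2).symm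
  exact (tube_farApart_of_incomparable hg hh h1 h2).mono (core_subset_tube g) (core_subset_tube h)

/-- Incomparable families have far apart tubes, and families further apart in the chain are
separated by levels. There remain bags in one of the strand's own two regions, which `OmP`
separates. -/
theorem Strand.farApart_core (hs : c.Strand e S u v) (hF : c.Occ F) {k : c.Node}
    (hv : ReflTransGen c.MChild F (c.fam v)) (hk : ReflTransGen c.MChild F (c.nfam k))
    (hku : k ≠ c.node u) (hkv : k ≠ c.node v) : FarApart c.G c.K S (c.core k) := by
  by_cases h1 : ReflTransGen c.MChild (c.fam v) (c.nfam k)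
  · rcases reflTransGen_iff_eq_or_transGen.1 h1 with h1 | h1
    · exact hs.farApart_core_right h1 hkv
    · exact (hs.farApart_tube (TransGen.mono (fun _ _ h => h.1) _ _ h1)).mono subset_rfl
        (core_subset_tube k)
  by_cases h2 : ReflTransGen c.MChild (c.nfam k) (c.fam v)
  · rcases reflTransGen_iff_eq_or_transGen.1 h2 with h2 | h2
    · exact absurd (h2 ▸ .refl) h1
    by_cases hch : c.Child (c.nfam k) (c.fam v)
    · exact hs.farApart_core_left
        (parent_unique (hF.desc (desc_of_mdesc hk)) (occ_fam u) hch hs.child) hku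
    · exact (farApart_core_tube (TransGen.mono (fun _ _ h => h.1) _ _ h2) hch).symm.mono
        hs.subset_tube subset_rfl
  exact (tube_farApart_of_incomparable hv hk h1 h2).mono hs.subset_tube (core_subset_tube k)

/-- Only strands into the same upper region need care. If their upper bags coincide, their lower
bags lie in the unique parent region and must differ. -/
theorem Strand.farApart (h : c.Strand e S u v) (h' : c.Strand e' S' u' v')
    (hv : ReflTransGen c.MChild F (c.fam v)) (hv' : ReflTransGen c.MChild F (c.fam v'))
    (hne : e ≠ e') : FarApart c.G c.K S S' := by
  by_cases h1 : ReflTransGen c.MChild (c.fam v) (c.fam v')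
  · rcases reflTransGen_iff_eq_or_transGen.1 h1 with h1 | h1
    · by_cases hvv : c.node v = c.node v'
      · refine h.farApart_left h' (parent_unique (occ_fam u) (occ_fam u') h.child
          (h1 ▸ h'.child)) fun huu => hne ?_
        rw [h.eq, h'.eq, huu, hvv]
      · exact h.farApart_right h' h1.symm hvv
    · exact (h.farApart_tube (TransGen.mono (fun _ _ h => h.1) _ _ h1)).mono subset_rfl
        h'.subset_tube
  by_cases h2 : ReflTransGen c.MChild (c.fam v') (c.fam v)
  · rcases reflTransGen_iff_eq_or_transGen.1 h2 with h2 | h2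
    · exact absurd (h2 ▸ .refl) h1
    · exact ((h'.farApart_tube (TransGen.mono (fun _ _ h => h.1) _ _ h2)).mono subset_rfl
        h.subset_tube).symm
  exact (tube_farApart_of_incomparable hv hv' h1 h2).mono h.subset_tube h'.subset_tube

variable (c) in
/-- The nodes whose bags lie in `F`. -/
def below (F : Fam V) : Set c.Node := {h | ReflTransGen c.Child F (c.nfam h)}

variable (c) in
/-- The nodes outside `F` with a neighbour in `F`. -/
def gate (F : Fam V) : Set c.Node := {h | h ∉ c.below F ∧ ∃ g ∈ c.below F, c.quot.Adj h g}

variable (c) in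
/-- The families that are attached to at most one bag. -/
def IsTop (F : Fam V) : Prop := c.Occ F ∧ ∀ P, c.Occ P → c.Child P F → ¬ F.Q ⊆ c.Mul P

variable (c) in
/-- The nodes that are not separated from `F` by a family attached to at most one bag, together
with the node to which `F` is attached. -/
def block (F : Fam V) : Set c.Node := {h | ReflTransGen c.MChild F (c.nfam h)} ∪ c.gate F

theorem Strand.fam_eq_of_gate (hs : c.Strand e S u v) (hF : c.Occ F) (hu : c.node u ∉ c.below F)
    (hv : c.node v ∈ c.below F) : c.fam v = F := by
  rcases ReflTransGen.cases_tail hv with h | ⟨P, hP, h⟩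
  · exact h
  · obtain rfl := parent_unique (hF.desc hP) (occ_fam u) h hs.child
    exact absurd hP hu

theorem Strand.below_of_left (hs : c.Strand e S u v) (hu : c.node u ∈ c.below F) :
    c.node v ∈ c.below F := ReflTransGen.tail hu hs.child

/-- A node of the gate is joined to nodes of `F` from below. -/
theorem exists_strand_of_gate {g h : c.Node} (hF : c.Occ F) (hh : h ∉ c.below F)
    (hg : g ∈ c.below F) (hgh : c.quot.Adj h g) :
    ∃ S u v, c.Strand s(h, g) S u v ∧ c.node u = h ∧ c.node v = g ∧ c.fam v = F := by
  obtain ⟨S, u, v, hs⟩ := exists_strand hgh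
  rcases Sym2.eq_iff.1 hs.eq with ⟨rfl, rfl⟩ | ⟨rfl, rfl⟩
  · exact ⟨S, u, v, hs, rfl, rfl, hs.fam_eq_of_gate hF hh hg⟩
  · exact absurd (hs.below_of_left hg) hh

/-- All gate nodes lie in the region of the unique parent, to which `F` is attached at one bag only.
-/
theorem IsTop.gate_subsingleton (hF : c.IsTop F) : (c.gate F).Subsingleton := by
  rintro g ⟨hg, k, hk, hgk⟩ h ⟨hh, k', hk', hhk⟩
  obtain ⟨S, u, v, hs, rfl, rfl, hv⟩ := exists_strand_of_gate hF.1 hg hk hgk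
  obtain ⟨S', u', v', hs', rfl, rfl, hv'⟩ := exists_strand_of_gate hF.1 hh hk' hhk
  have h1 := hs.child
  have h2 := hs'.child
  rw [hv] at h1
  rw [hv'] at h2
  refine node_eq_of_child h1 (hF.2 _ (occ_fam _) h1) rfl
    (parent_unique (occ_fam _) (occ_fam _) h2 h1) (hv ▸ (fam_spec v).2.1) (hv' ▸ (fam_spec v').2.1) ?_ ?_
    hs.adj hs'.adj
  · rw [hs.lev_eq, hv, h1.l_eq]
  · rw [hs'.lev_eq, hv', h1.l_eq]

/-- Strands lead from a region to a child region, so levels and uniqueness of parents leave only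
these two kinds of edges in a block. -/
theorem Strand.cases (hs : c.Strand e S u v) (hF : c.IsTop F) (hu : c.node u ∈ c.block F)
    (hv : c.node v ∈ c.block F) : ReflTransGen c.MChild F (c.fam v) ∧
      (c.MChild (c.fam u) (c.fam v) ∧ ReflTransGen c.MChild F (c.fam u) ∨
        c.node u ∈ c.gate F ∧ c.fam v = F) := by
  rcases hv with hv | hv
  · refine ⟨hv, ?_⟩
    rcases hu with hu | hu
    · left
      refine ⟨?_, hu⟩
      rcases ReflTransGen.cases_tail hv with h | ⟨P, hP, h⟩
      · have h1 := l_le_of_desc (desc_of_mdesc hu)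
        have h2 := hs.bounds
        have h3 := hs.child.wf.bounds
        rw [nfam_node] at h h1
        rw [← h] at h1
        omega
      · obtain rfl := parent_unique (hF.1.desc (desc_of_mdesc hP)) (occ_fam u) h.1 hs.child
        exact h
    · exact .inr ⟨hu, hs.fam_eq_of_gate hF.1 hu.1 (desc_of_mdesc hv)⟩
  · rcases hu with hu | hu
    · exact absurd (hs.below_of_left (desc_of_mdesc hu)) hv.1
    · have h1 := hF.gate_subsingleton hu hv
      have h2 := (node_eq_iff.1 h1).1
      have h3 := hs.bounds
      have h4 := hs.child.wf.bounds
      rw [h2] at h3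
      omega

/-- The nodes of a block and the edges between them are represented by sets that are far apart. -/
theorem exists_thick (hF : c.IsTop F) : ∃ U E, Thick c.G c.quot c.K (c.block F) U E := by
  classical
  have hE : ∃ E : Sym2 c.Node → Set V, ∀ g h, c.quot.Adj g h →
      ∃ u v, c.Strand s(g, h) (E s(g, h)) u v := by
    refine ⟨fun e => if h : ∃ S u v, c.Strand e S u v then h.choose else ∅, fun g h hgh => ?_⟩
    have hex := exists_strand hgh
    dsimp only
    rw [dif_pos hex]
    exact hex.choose_spec
  obtain ⟨E, hE⟩ := hE
  obtain ⟨x, hx⟩ := hF.1.wf.nonempty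
  -- `L` replaces the core of the gate node. The scale of `F` is unrelated to `low` of its parent,
  -- so strands into `F` need not reach that core, but they all reach level `F.l - down F`. No other
  -- node needs such a set, since the gate has at most one node.
  set L : Set V := {z | c.lev z ≤ F.l - c.down F ∧ c.G.Reachable x z} with hL
  have hb := hF.1.wf.bounds
  have hbelow : ∀ {h}, ReflTransGen c.MChild F (c.nfam h) → h ∈ c.below F :=
    fun h => desc_of_mdesc h
  -- If there is a gate node, the subtraction in `L` is not truncated; otherwise `L` represents no
  -- node.
  have hgate : ∀ h ∈ c.gate F, c.down F ≤ F.l ∧ 0 < F.l := by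
    rintro h ⟨hh, k, hk, hhk⟩
    obtain ⟨S, u, v, hs, -, -, hv⟩ := exists_strand_of_gate hF.1 hh hk hhk
    have h1 := hs.bounds
    have h2 := hs.child.wf.bounds
    rw [hv] at h1
    omega
  have hcL : ∀ h, ReflTransGen c.MChild F (c.nfam h) → c.down F ≤ F.l →
      FarApart c.G c.K L (c.core h) := by
    intro h hh hd
    refine farApart_of_lev (n := F.l - c.down F) (fun a ha => ha.1) fun b hb' => ?_
    have h1 := (core_lev hb').1
    rcases reflTransGen_iff_eq_or_transGen.1 hh with h2 | h2
    · rw [h2] at h1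
      unfold down at hd ⊢
      omega
    · have h3 := top_le_of_desc (TransGen.mono (fun _ _ h => h.1) _ _ h2)
      have h4 := (wf_nfam h).bounds
      omega
  refine ⟨fun h => if h ∈ c.below F then c.core h else L, E, ?_, ?_, ?_, ?_, ?_, ?_⟩
  · intro h hh
    split_ifs with hd
    · exact sconn_core h
    · rcases hh with hh | hh
      · exact absurd (hbelow hh) hd
      obtain ⟨y, hy, p, -⟩ := c.isLevel.descent (x := x) (n := F.l - c.down F)
        (by have := hF.1.wf.above x hx; omega)
      have := c.isLevel.sconn_low hy.le
      convert this using 1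
      ext z
      exact ⟨fun h => ⟨h.1, p.reachable.symm.trans h.2⟩, fun h => ⟨h.1, p.reachable.trans h.2⟩⟩
  · intro g hg h hh hgh
    obtain ⟨u, v, hs⟩ := hE g h hgh
    exact hs.sconn
  · intro g hg h hh hgh
    obtain ⟨u, v, hs⟩ := hE g h hgh
    have huv : c.node u ∈ c.block F ∧ c.node v ∈ c.block F ∧ (g = c.node u ∨ g = c.node v) := by
      rcases Sym2.eq_iff.1 hs.eq with ⟨rfl, rfl⟩ | ⟨rfl, rfl⟩
      exacts [⟨hg, hh, .inl rfl⟩, ⟨hh, hg, .inr rfl⟩]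
    obtain ⟨hu, hv, hg'⟩ := huv
    obtain ⟨hv', hc⟩ := hs.cases hF hu hv
    rcases hg' with hg' | hg'
    · rcases hc with ⟨hm, hu'⟩ | ⟨hu', hv''⟩
      · rw [if_pos (hg' ▸ hbelow hu')]
        have := hs.inter_core_left hm.2
        rwa [← hg'] at this
      · rw [if_neg (hg' ▸ hu'.1)]
        obtain ⟨w, hw, hwl⟩ := hs.exists_low
        refine ⟨w, hw, by rw [← hv'']; omega, ?_⟩
        have hvQ : v ∈ F.Q := hv'' ▸ (fam_spec v).2.1
        exact (hF.1.wf.conn x hx v hvQ).reachable.trans (hs.sconn.2 v hs.right_mem w hw).reachable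
    · rw [if_pos (hg' ▸ hbelow hv')]
      have := hs.inter_core_right
      rwa [← hg'] at this
  · intro g hg h hh hne
    rcases hg with hg | hg <;> rcases hh with hh | hh
    · rw [if_pos (hbelow hg), if_pos (hbelow hh)]
      exact farApart_core_core hg hh hne
    · rw [if_pos (hbelow hg), if_neg hh.1]
      exact (hcL g hg (hgate h hh).1).symm
    · rw [if_neg hg.1, if_pos (hbelow hh)]
      exact hcL h hh (hgate g hg).1
    · exact absurd (hF.gate_subsingleton hg hh) hne
  · intro g hg h hh hgh k hk hkg hkh
    obtain ⟨u, v, hs⟩ := hE g h hgh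
    have huv : c.node u ∈ c.block F ∧ c.node v ∈ c.block F ∧ k ≠ c.node u ∧ k ≠ c.node v := by
      rcases Sym2.eq_iff.1 hs.eq with ⟨rfl, rfl⟩ | ⟨rfl, rfl⟩
      exacts [⟨hg, hh, hkg, hkh⟩, ⟨hh, hg, hkh, hkg⟩]
    obtain ⟨hu, hv, hku, hkv⟩ := huv
    obtain ⟨hv', hc⟩ := hs.cases hF hu hv
    rcases hk with hk | hk
    · rw [if_pos (hbelow hk)]
      exact hs.farApart_core hF.1 hv' hk hku hkv
    · rw [if_neg hk.1]
      rcases hc with ⟨hm, hu'⟩ | ⟨hu', -⟩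
      · refine (farApart_of_lev (n := F.l - c.down F) (fun a ha => ha.1) fun b hb' => ?_).symm
        have h1 := l_le_of_desc (desc_of_mdesc hu')
        have h2 := hs.bounds
        have h3 := (hs.sub hb').1
        omega
      · exact absurd (hF.gate_subsingleton hk hu') hku
  · intro g hg h hh hgh g' hg' h' hh' hgh' hne
    obtain ⟨u, v, hs⟩ := hE g h hgh
    obtain ⟨u', v', hs'⟩ := hE g' h' hgh'
    have aux : ∀ {g h : c.Node} {S u v}, c.Strand s(g, h) S u v → g ∈ c.block F → h ∈ c.block F →
        ReflTransGen c.MChild F (c.fam v) := by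
      intro g h S u v hs hg hh
      rcases Sym2.eq_iff.1 hs.eq with ⟨rfl, rfl⟩ | ⟨rfl, rfl⟩
      exacts [(hs.cases hF hg hh).1, (hs.cases hF hh hg).1]
    exact hs.farApart hs' (aux hs hg hh) (aux hs' hg' hh') hne

end Frame

end FatMinor

/-! ### Models of `2`-connected multigraphs across a one-vertex separation -/

namespace FatMinor

open SimpleGraph

section Gate

variable {W : Type*} {H : SimpleGraph W} {D X T : Set W}

/-- A path with both ends outside a set `T` that can be entered through one vertex only avoids
`T`. -/
theorem notMem_of_isPath (hX : X.Subsingleton) (hT : ∀ x ∉ T, ∀ y ∈ T, H.Adj x y → x ∈ X)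
    {a b : W} (p : H.Walk a b) (hp : p.IsPath) (ha : a ∉ T) (hb : b ∉ T) :
    ∀ z ∈ p.support, z ∉ T := by
  intro z hz hzT
  obtain ⟨q, r, -, -, rfl⟩ := hp.mem_support_iff_exists_append.1 hz
  obtain ⟨x, hx, y, hy, hxy, hxq, -⟩ := (Conn.of_walk q).exists_step (T := Tᶜ) ha (by simpa)
  obtain ⟨x', hx', y', hy', hxy', -, hyr⟩ := (Conn.of_walk r).exists_step (T := T) hzT hb
  have h1 := hT x hx y (by simpa using hy) hxy
  have h2 := hT y' hy' x' hx' hxy'.symm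
  obtain rfl := hX h1 h2
  exact hp.ne_of_mem_support_of_append (fun h => hy' (by rwa [h])) hxq hyr rfl

/-- The other side of the separation has the same separator, so `disjoint_of_forall` serves both
sides. -/
theorem adj_compl_union (hD : ∀ x ∉ D, ∀ y ∈ D, H.Adj x y → x ∈ X) :
    ∀ x ∉ (D ∪ X)ᶜ, ∀ y ∈ (D ∪ X)ᶜ, H.Adj x y → x ∈ X := by
  intro x hx y hy hxy
  have hy' : y ∉ D := fun h => hy (.inl h)
  rcases not_not.1 hx with hx | hx
  · exact absurd (.inr (hD y hy' x hx hxy.symm)) hy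
  · exact hx

variable {α β : Type*} {J : Graph α β}

/-- If all branch sets that avoid `X` avoid a set `T` that can be entered through the vertex in `X`
only, then so do the branch paths. -/
theorem Model.disjoint_of_forall (M : Model J H) (hJ : J.Loopless) (hX : X.Subsingleton)
    (hT : ∀ x ∉ T, ∀ y ∈ T, H.Adj x y → x ∈ X)
    (hU : ∀ x ∈ J.vertexSet, Disjoint (M.branchSet x) X → Disjoint (M.branchSet x) T) :
    ∀ e ∈ J.edgeSet, Disjoint (M.branchPath e).verts T := by
  have hend : ∀ e x y, J.IsLink e x y →
      ∀ a ∈ (M.branchPath e).verts, a ∈ M.branchSet x → a ∉ T := by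
    intro e x y hxy a ha hax haT
    obtain ⟨a', b, p, -, -, hpe, hp, hpb⟩ := M.exists_path hJ hxy
    rw [hpe, Walk.verts_toSubgraph] at ha
    by_cases hd : Disjoint (M.branchSet x) X
    · exact Set.disjoint_left.1 (hU x hxy.left_mem hd) hax haT
    obtain ⟨k, hk, hkX⟩ := Set.not_disjoint_iff.1 hd
    have hyX : Disjoint (M.branchSet y) X := by
      rw [Set.disjoint_left]
      intro k' hk' hk'X
      obtain rfl := hX hkX hk'X
      exact Set.disjoint_left.1 (M.disjoint x hxy.left_mem y hxy.right_mem hxy.ne) hk hk'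
    have hbT : b ∉ T := Set.disjoint_left.1 (hU y hxy.right_mem hyX)
      ((hpb b p.end_mem_support).2 rfl)
    obtain rfl := (hp a ha).1 hax
    obtain ⟨u, hu, v, hv, huv, -, hvp⟩ := (Conn.of_walk p).exists_step haT hbT
    have hvX := hT v hv u hu huv.symm
    obtain rfl := hX hkX hvX
    rw [(hp k hvp).1 hk] at hv
    exact hv haT
  intro e he
  obtain ⟨x, y, hxy⟩ := J.exists_isLink_of_mem_edgeSet he
  obtain ⟨a, b, p, hp, -, hpe, hpa, hpb⟩ := M.exists_path hJ hxy
  rw [Set.disjoint_left]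
  intro z hz
  have ha : a ∈ (M.branchPath e).verts := by simp [hpe]
  have hb : b ∈ (M.branchPath e).verts := by simp [hpe]
  rw [hpe, Walk.verts_toSubgraph] at hz
  exact notMem_of_isPath hX hT p hp
    (hend e x y hxy a ha ((hpa a p.start_mem_support).2 rfl))
    (hend e y x hxy.symm b hb ((hpb b p.end_mem_support).2 rfl)) z hz

/-- A model of a `2`-connected multigraph lies essentially on one side of a set of nodes with at
most one neighbour. -/
theorem IsTwoConnected.subset_or_disjoint (hJ : IsTwoConnected J) (M : Model J H)
    (hX : X.Subsingleton)
    (hD : ∀ x ∉ D, ∀ y ∈ D, H.Adj x y → x ∈ X) :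
    (∀ e ∈ J.edgeSet, (M.branchPath e).verts ⊆ D ∪ X) ∨
      ∀ e ∈ J.edgeSet, Disjoint (M.branchPath e).verts D := by
  have hside : ∀ S, SConn H S → Disjoint S X → S ⊆ D ∨ Disjoint S D := by
    intro S hS hSX
    by_contra! hcon
    obtain ⟨a, ha, haD⟩ := Set.not_subset.1 hcon.1
    obtain ⟨b, hb, hbD⟩ := Set.not_disjoint_iff.1 hcon.2
    obtain ⟨u, hu, v, hv, huv, -, hvS⟩ := (hS.2 b hb a ha).exists_step hbD haD
    exact Set.disjoint_left.1 hSX hvS (hD v hv u hu huv.symm)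
  have hloop := hJ.loopless
  have hU : ∀ x ∈ J.vertexSet, SConn H (M.branchSet x) :=
    fun x hx => sconn_iff_connected.2 (M.connected x hx)
  by_cases h1 : ∀ x ∈ J.vertexSet, Disjoint (M.branchSet x) X → M.branchSet x ⊆ D
  · left
    intro e he
    have := M.disjoint_of_forall (T := (D ∪ X)ᶜ) hJ.loopless hX (adj_compl_union hD)
      (fun x hx hxX => Set.disjoint_left.2 fun z hz hz' => hz' (.inl (h1 x hx hxX hz))) e he
    exact Set.disjoint_compl_right_iff_subset.1 this
  by_cases h2 : ∀ x ∈ J.vertexSet, Disjoint (M.branchSet x) X → Disjoint (M.branchSet x) D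
  · exact .inr (M.disjoint_of_forall hJ.loopless hX hD h2)
  exfalso
  push Not at h1 h2
  obtain ⟨y₁, hy₁, hy₁X, hy₁D⟩ := h1
  obtain ⟨y₂, hy₂, hy₂X, hy₂D⟩ := h2
  replace hy₂D := (hside _ (hU y₂ hy₂) hy₂X).resolve_right hy₂D
  have hcross : ∀ e y z, J.IsLink e y z → M.branchSet y ⊆ D → ¬ M.branchSet z ⊆ D →
      ∃ k ∈ X, k ∈ (M.branchPath e).verts ∪ M.branchSet y ∪ M.branchSet z := by
    intro e y z hyz hy hz
    obtain ⟨a, b, p, hp, -, hpe, hpa, hpb⟩ := M.exists_path hJ.loopless hyz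
    have hp' : SConn H (M.branchPath e).verts := by
      rw [hpe, Walk.verts_toSubgraph]
      exact sconn_support p
    have hS := (hp'.union (hU y hyz.left_mem)
      ⟨a, by simp [hpe], (hpa a p.start_mem_support).2 rfl⟩).union
      (hU z hyz.right_mem) ⟨b, .inl (by simp [hpe]), (hpb b p.end_mem_support).2 rfl⟩
    by_contra! hcon
    rcases hside _ hS (Set.disjoint_right.2 hcon) with h | h
    · exact hz (Set.subset_union_right.trans h)
    · obtain ⟨w, hw⟩ := (hU y hyz.left_mem).1
      exact Set.disjoint_left.1 h (.inl (.inr hw)) (hy hw)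
  let T : Set J.vertexSet := {y | M.branchSet y ⊆ D}
  have hstep : ∀ x y z : J.vertexSet, y ≠ x → z ≠ x → y ∈ T → z ∉ T →
      ∃ e y z, J.IsLink e y z ∧ M.branchSet y ⊆ D ∧ ¬ M.branchSet z ⊆ D ∧ y ≠ x ∧ z ≠ x := by
    intro x y z hy hz hyT hzT
    obtain ⟨u, hu, v, hv, huv, hux, hvx⟩ :=
      ((sconn_iff_connected.2 (hJ.connected_delete x)).2 y hy z hz).exists_step hyT hzT
    obtain ⟨-, e, he⟩ := huv
    exact ⟨e, u, v, he, hu, hv, fun h => hux (Subtype.ext h), fun h => hvx (Subtype.ext h)⟩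
  -- If the separating node lies in the branch set of `x`, then after deletion of `x` some edge of
  -- `J` still leads from one side to the other. By `hcross`, its path or one of its end sets
  -- contains the separating node, which is impossible.
  by_cases hx : ∃ x ∈ J.vertexSet, ¬ Disjoint (M.branchSet x) X
  · obtain ⟨x, hx, hxX⟩ := hx
    obtain ⟨k, hk, hkX⟩ := Set.not_disjoint_iff.1 hxX
    obtain ⟨e, y, z, he, hy, hz, hyx, hzx⟩ := hstep ⟨x, hx⟩ ⟨y₂, hy₂⟩ ⟨y₁, hy₁⟩
      (fun h => hxX (by rw [← Subtype.mk.inj h]; exact hy₂X))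
      (fun h => hxX (by rw [← Subtype.mk.inj h]; exact hy₁X)) hy₂D hy₁D
    obtain ⟨k', hk'X, hk'⟩ := hcross e y z he hy hz
    obtain rfl := hX hkX hk'X
    rcases hk' with (hk' | hk') | hk'
    · exact Set.disjoint_left.1 (M.avoid e y z he x hx hyx.symm hzx.symm) hk' hk
    · exact Set.disjoint_left.1 (M.disjoint y he.left_mem x hx hyx) hk' hk
    · exact Set.disjoint_left.1 (M.disjoint z he.right_mem x hx hzx) hk' hk
  push Not at hx
  have hcross' : ∀ e y z, J.IsLink e y z → M.branchSet y ⊆ D → ¬ M.branchSet z ⊆ D →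
      ∃ k ∈ X, k ∈ (M.branchPath e).verts := by
    intro e y z hyz hy hz
    obtain ⟨k, hk, hk'⟩ := hcross e y z hyz hy hz
    refine ⟨k, hk, ?_⟩
    rcases hk' with (hk' | hk') | hk'
    · exact hk'
    · exact absurd hk (Set.disjoint_left.1 (hx y hyz.left_mem) hk')
    · exact absurd hk (Set.disjoint_left.1 (hx z hyz.right_mem) hk')
  -- Now the separating node is an inner node of every crossing branch path, so only one edge
  -- crosses. A third vertex of `J` would give another crossing edge after deletion of a suitable
  -- end of the first, and with only two vertices a parallel edge would cross as well.
  have huniq : ∀ e y z, J.IsLink e y z → M.branchSet y ⊆ D → ¬ M.branchSet z ⊆ D →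
      ∀ e' y' z', J.IsLink e' y' z' → M.branchSet y' ⊆ D → ¬ M.branchSet z' ⊆ D → e = e' := by
    intro e y z he hy hz e' y' z' he' hy' hz'
    by_contra hne
    obtain ⟨k, hk, hke⟩ := hcross' e y z he hy hz
    obtain ⟨k', hk', hke'⟩ := hcross' e' y' z' he' hy' hz'
    obtain rfl := hX hk hk'
    refine Set.disjoint_left.1 (M.internally_disjoint e y z he e' he'.edge_mem hne) ⟨hke, ?_⟩ hke'
    rintro (h | h)
    · exact Set.disjoint_left.1 (hx y he.left_mem) h hk
    · exact Set.disjoint_left.1 (hx z he.right_mem) h hk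
  obtain ⟨y, hy, z, hz, hyz, -, -⟩ :=
    (Conn.univ_of_reachable (hJ.connected.preconnected ⟨y₂, hy₂⟩ ⟨y₁, hy₁⟩)).exists_step
      (T := T) hy₂D hy₁D
  obtain ⟨-, e, he⟩ := hyz
  have hthird : ∀ w ∈ J.vertexSet, w ≠ y → w ≠ z → False := by
    intro w hw hwy hwz
    by_cases hwD : M.branchSet w ⊆ D
    · obtain ⟨e', y', z', he', hy', hz', hyy, hzy⟩ := hstep y ⟨w, hw⟩ z
        (fun h => hwy (congrArg Subtype.val h)) (fun h => hz (h ▸ hy)) hwD hz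
      obtain rfl := huniq e y z he hy hz e' y' z' he' hy' hz'
      rcases he.left_eq_or_eq he' with h | h
      exacts [hyy h.symm, hzy h.symm]
    · obtain ⟨e', y', z', he', hy', hz', hyy, hzy⟩ := hstep z y ⟨w, hw⟩
        (fun h => hz (h ▸ hy)) (fun h => hwz (congrArg Subtype.val h)) hy hwD
      obtain rfl := huniq e y z he hy hz e' y' z' he' hy' hz'
      rcases he.symm.left_eq_or_eq he' with h | h
      exacts [hyy h.symm, hzy h.symm]
  obtain ⟨f, hf, hfe⟩ := hJ.nontrivial_edgeSet.exists_ne e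
  obtain ⟨p, q, hpq⟩ := J.exists_isLink_of_mem_edgeSet hf
  have hends : ∀ w ∈ J.vertexSet, w = y ∨ w = z := by
    intro w hw
    by_contra! h
    exact hthird w hw h.1 h.2
  rcases hends p hpq.left_mem with rfl | rfl <;> rcases hends q hpq.right_mem with rfl | rfl
  · exact hpq.ne rfl
  · exact hfe (huniq _ _ _ hpq hy hz _ _ _ he hy hz)
  · exact hfe (huniq _ _ _ hpq.symm hy hz _ _ _ he hy hz)
  · exact hpq.ne rfl

end Gate

end FatMinor

/-! ### Locating a model in a block, and the remaining cases -/

namespace FatMinor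

open SimpleGraph Relation

theorem IsTwoConnected.exists_inc {α β : Type*} {J : Graph α β} (hJ : IsTwoConnected J) {x : α}
    (hx : x ∈ J.vertexSet) : ∃ e, J.Inc e x := by
  have := hJ.loopless
  obtain ⟨y, hy, hyx⟩ := (J.vertexSet_nontrivial_of_edgeSet_nonempty_of_loopless
    hJ.nontrivial_edgeSet.nonempty).exists_ne x
  obtain ⟨a, ha, b, -, hab, -, -⟩ :=
    (Conn.univ_of_reachable (hJ.connected.preconnected ⟨x, hx⟩ ⟨y, hy⟩)).exists_step
      (T := {⟨x, hx⟩}) rfl (fun h => hyx (congrArg Subtype.val h))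
  obtain ⟨-, e, he⟩ := hab
  rw [Set.mem_singleton_iff.1 ha] at he
  exact ⟨e, he.inc_left⟩

namespace Frame

variable {V : Type*} {c : Frame V} {F F' : Fam V}

theorem l_lt_of_child (h : c.Child F F') : F.l < F'.l := by
  have h1 := h.wf_left.bounds
  have h2 := h.l_eq
  omega

theorem isTop_root (v : V) : c.IsTop (c.root v) := by
  refine ⟨occ_root v, fun P _ h => ?_⟩
  have := l_lt_of_child h
  simp [root] at this

theorem mdesc_or_exists (h : ReflTransGen c.Child F F') : ReflTransGen c.MChild F F' ∨
    ∃ A B, ReflTransGen c.Child F A ∧ c.Child A B ∧ ¬ B.Q ⊆ c.Mul A ∧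
      ReflTransGen c.Child B F' := by
  induction h with
  | refl => exact .inl .refl
  | @tail P F' hP h ih =>
    rcases ih with ih | ⟨A, B, hA, hAB, hm, hB⟩
    · by_cases hm : F'.Q ⊆ c.Mul P
      · exact .inl (ih.tail ⟨h, hm⟩)
      · exact .inr ⟨P, F', hP, h, hm, .refl⟩
    · exact .inr ⟨A, B, hA, hAB, hm, hB.tail h⟩

/-- Parents are unique, so the chain from `F` to `F'` is the only one, and none of its steps leads
to a family attached to at most one bag. -/
theorem not_desc_of_mdesc (hF : c.Occ F) (h : ReflTransGen c.MChild F F') {A B : Fam V}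
    (hA : ReflTransGen c.Child F A) (hAB : c.Child A B) (hm : ¬ B.Q ⊆ c.Mul A) :
    ¬ ReflTransGen c.Child B F' := by
  induction h with
  | refl =>
    intro hB
    have h1 := l_le_of_desc hA
    have h2 := l_lt_of_child hAB
    have h3 := l_le_of_desc hB
    omega
  | @tail P F' hP h ih =>
    intro hB
    have hPo := hF.desc (desc_of_mdesc hP)
    rcases ReflTransGen.cases_tail hB with rfl | ⟨P', hP', h'⟩
    · obtain rfl := parent_unique hPo (hF.desc hA) h.1 hAB
      exact hm h.2
    · obtain rfl := parent_unique hPo ((hF.desc hA).desc (.head hAB hP')) h.1 h'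
      exact ih hP'

theorem isTop_of_child (hF : c.Occ F) (h : c.Child F F') (hm : ¬ F'.Q ⊆ c.Mul F) :
    c.IsTop F' := by
  refine ⟨hF.desc (.single h), fun P hP hPF => ?_⟩
  rwa [parent_unique hP hF hPF h]

theorem adj_below (F : Fam V) :
    ∀ x ∉ c.below F, ∀ y ∈ c.below F, c.quot.Adj x y → x ∈ c.gate F :=
  fun _ hx y hy hxy => ⟨hx, y, hy, hxy⟩

variable {α β : Type*} {J : Graph α β}

/-- Every model of a `2`-connected multigraph in the quotient graph runs within a block. -/
theorem exists_block (hJ : IsTwoConnected J) (M : Model J c.quot) : ∃ F, c.IsTop F ∧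
    (∀ e ∈ J.edgeSet, (M.branchPath e).verts ⊆ c.block F) ∧
    ∀ x ∈ J.vertexSet, SConn c.quot (M.branchSet x ∩ c.block F) := by
  classical
  -- Take such an `F` with the highest bottom level. A root family qualifies, and levels are bounded
  -- because a branch path has two nodes, of which at most one is in the gate. By maximality, the
  -- branch paths avoid every family below `F` that is attached to at most one bag.
  let S : Set ℕ := {n | ∃ F, c.IsTop F ∧
    (∀ e ∈ J.edgeSet, (M.branchPath e).verts ⊆ c.below F ∪ c.gate F) ∧ F.l = n}
  obtain ⟨e, he⟩ := hJ.nontrivial_edgeSet.nonempty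
  obtain ⟨x, y, hxy⟩ := J.exists_isLink_of_mem_edgeSet he
  obtain ⟨a, b, p, -, hab, hpe, -, -⟩ := M.exists_path hJ.loopless hxy
  obtain ⟨v, rfl⟩ := exists_node a
  obtain ⟨w, rfl⟩ := exists_node b
  have ha : c.node v ∈ (M.branchPath e).verts := by simp [hpe]
  have hb : c.node w ∈ (M.branchPath e).verts := by simp [hpe]
  have hne : S.Nonempty := by
    refine ⟨_, c.root v, isTop_root v, ?_, rfl⟩
    refine (hJ.subset_or_disjoint M (isTop_root v).gate_subsingleton (adj_below _)).resolve_right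
      fun h => Set.disjoint_left.1 (h e he) ha (fam_spec v).1
  have hbdd : BddAbove S := by
    refine ⟨max (c.lev v) (c.lev w), ?_⟩
    rintro _ ⟨F, hF, hFe, rfl⟩
    have hle : ∀ u, c.node u ∈ c.below F → F.l ≤ c.lev u := fun u hu =>
      hF.1.wf.above u (hF.1.mem_iff.2 hu)
    rcases hFe e he ha with ha' | ha'
    · exact le_max_of_le_left (hle v ha')
    · rcases hFe e he hb with hb' | hb'
      · exact le_max_of_le_right (hle w hb')
      · exact absurd (hF.gate_subsingleton ha' hb') hab
  obtain ⟨F, hF, hFe, hFl⟩ := Nat.sSup_mem hne hbdd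
  have hmax : ∀ A B, ReflTransGen c.Child F A → c.Child A B → ¬ B.Q ⊆ c.Mul A →
      ∀ e ∈ J.edgeSet, Disjoint (M.branchPath e).verts (c.below B) := by
    intro A B hA hAB hm
    have hB := isTop_of_child (hF.1.desc hA) hAB hm
    refine (hJ.subset_or_disjoint M hB.gate_subsingleton (adj_below _)).resolve_left fun h => ?_
    have h1 := le_csSup hbdd (show B.l ∈ S from ⟨B, hB, h, rfl⟩)
    have h2 := l_le_of_desc hA
    have h3 := l_lt_of_child hAB
    omega
  have hsub : ∀ e ∈ J.edgeSet, (M.branchPath e).verts ⊆ c.block F := by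
    intro e he h hh
    rcases hFe e he hh with hd | hg
    · rcases mdesc_or_exists hd with hd | ⟨A, B, hA, hAB, hm, hB⟩
      · exact .inl hd
      · exact absurd hB (Set.disjoint_left.1 (hmax A B hA hAB hm e he) hh)
    · exact .inr hg
  refine ⟨F, hF, hsub, fun x hx => ⟨?_, ?_⟩⟩
  · obtain ⟨e, y, hxy⟩ := hJ.exists_inc hx
    obtain ⟨a, b, p, -, -, hpe, hp, -⟩ := M.exists_path hJ.loopless hxy
    exact ⟨a, (hp a p.start_mem_support).2 rfl, hsub e hxy.edge_mem (by simp [hpe])⟩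
  · rintro g ⟨hg, hgF⟩ h ⟨hh, hhF⟩
    obtain ⟨p, hp⟩ := (sconn_iff_connected.2 (M.connected x hx)).2 g hg h hh
    -- A branch set may leave the block, but a path in it between nodes of the block cannot: every
    -- way out passes a single separating node, which would have to be used twice.
    refine ⟨p.bypass, fun z hz => ⟨hp z (p.support_bypass_subset_support hz), ?_⟩⟩
    have hbl : c.block F ⊆ c.below F ∪ c.gate F :=
      Set.union_subset_union_left _ fun k hk => desc_of_mdesc hk
    have hz' := notMem_of_isPath hF.gate_subsingleton (adj_compl_union (adj_below F)) p.bypass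
      p.bypass_isPath (fun h => h (hbl hgF)) (fun h => h (hbl hhF)) z hz
    rcases not_not.1 hz' with hd | hgate
    · rcases mdesc_or_exists hd with hd | ⟨A, B, hA, hAB, hm, hB⟩
      · exact .inl hd
      · have hout : ∀ k ∈ c.block F, k ∉ c.below B := by
          rintro k (hk | hk) hkB
          · exact not_desc_of_mdesc hF.1 hk hA hAB hm hkB
          · exact hk.1 ((hA.tail hAB).trans hkB)
        exact absurd hB (notMem_of_isPath
          (isTop_of_child (hF.1.desc hA) hAB hm).gate_subsingleton (adj_below B) p.bypass
          p.bypass_isPath (hout g hgF) (hout h hhF) z hz)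
    · exact .inr hgate

theorem isFatMinor_of_isMinor (hJ : IsTwoConnected J) (hM : IsMinor J c.quot) :
    IsFatMinor c.K J c.G := by
  obtain ⟨M⟩ := hM
  obtain ⟨F, hF, hP, hU⟩ := exists_block hJ M
  obtain ⟨U, E, hT⟩ := exists_thick hF
  exact hT.isFatMinor c.pos M hJ.loopless hP hU

end Frame

section CompleteBipartite

variable {t : ℕ}

theorem sconn_K2 {S : Set (K2 t).vertexSet} {i : Fin 2} {j : Fin t}
    (hi : ⟨.inl i, trivial⟩ ∈ S) (hj : ⟨.inr j, trivial⟩ ∈ S) :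
    SConn (K2 t).toSimpleGraph S := by
  have hadj : ∀ i j, (K2 t).toSimpleGraph.Adj ⟨.inl i, trivial⟩ ⟨.inr j, trivial⟩ :=
    fun i j => ⟨fun h => Sum.inl_ne_inr (congrArg Subtype.val h), s(.inl i, .inr j), rfl,
      K2_mem_edgeSet.2 ⟨i, j, rfl⟩⟩
  have h : ∀ x ∈ S, Conn (K2 t).toSimpleGraph S ⟨.inl i, trivial⟩ x := by
    rintro ⟨i' | j', _⟩ hx
    · exact (Conn.of_adj (hadj i j) hi hj).trans (Conn.of_adj (hadj i' j).symm hj hx)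
    · exact Conn.of_adj (hadj i j') hi hx
  exact ⟨⟨_, hi⟩, fun x hx y hy => (h x hx).symm.trans (h y hy)⟩

theorem loopless_K2 : (K2 t).Loopless :=
  ⟨fun _ x h => SimpleGraph.irrefl _ ((SimpleGraph.mem_edgeSet _).1 (h.1 ▸ h.2 :
    s(x, x) ∈ (completeBipartiteGraph (Fin 2) (Fin t)).edgeSet))⟩

theorem isTwoConnected_K2 (ht : 2 ≤ t) : IsTwoConnected (K2 t) where
  loopless := loopless_K2
  nontrivial_edgeSet := by
    refine ⟨s(.inl 0, .inr ⟨0, by omega⟩), K2_mem_edgeSet.2 ⟨_, _, rfl⟩,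
      s(.inl 1, .inr ⟨0, by omega⟩), K2_mem_edgeSet.2 ⟨_, _, rfl⟩, ?_⟩
    simp
  connected := by
    have h := sconn_K2 (t := t) (S := Set.univ) (i := 0) (j := ⟨0, by omega⟩) trivial trivial
    refine (SimpleGraph.connected_iff _).2 ⟨fun x y => (h.2 x trivial y trivial).reachable,
      h.1.to_type⟩
  connected_delete := by
    rintro ⟨i | j, -⟩
    · obtain ⟨i', hi⟩ := exists_ne i
      exact sconn_iff_connected.1 (sconn_K2 (i := i') (j := ⟨0, by omega⟩)
        (fun h => hi (Sum.inl_injective (congrArg Subtype.val h)))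
        fun h => Sum.inr_ne_inl (congrArg Subtype.val h))
    · have : Nontrivial (Fin t) := Fin.nontrivial_iff_two_le.2 ht
      obtain ⟨j', hj⟩ := exists_ne j
      exact sconn_iff_connected.1 (sconn_K2 (i := 0) (j := j')
        (fun h => Sum.inl_ne_inr (congrArg Subtype.val h))
        fun h => hj (Sum.inr_injective (congrArg Subtype.val h)))

end CompleteBipartite

section Degenerate

variable {V : Type*} {G : SimpleGraph V} {K t : ℕ}

theorem IsMinor.isFatMinor_zero {α β : Type*} {J : Graph α β} (h : IsMinor J G) :
    IsFatMinor 0 J G := by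
  obtain ⟨M⟩ := h
  exact ⟨M, ⟨fun _ _ _ _ _ _ _ _ _ => by simp, fun _ _ _ _ _ _ _ _ _ => by simp,
    fun _ _ _ _ _ _ _ _ _ => by simp⟩⟩

/-- The partition into singletons. -/
def singletonPartition (G : SimpleGraph V) : GraphPartition G G where
  bag h := {h}
  existsUnique_mem_bag a := ⟨a, rfl, fun _ h => h.symm⟩
  eq_or_adj := by rintro a b hab g h rfl rfl; exact .inr hab

/-- The partition into components. -/
def componentPartition (G : SimpleGraph V) :
    GraphPartition G (⊥ : SimpleGraph G.ConnectedComponent) where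
  bag h := {v | G.connectedComponentMk v = h}
  existsUnique_mem_bag a := ⟨_, rfl, fun _ h => h.symm⟩
  eq_or_adj := by
    rintro a b hab g h rfl rfl
    exact .inl (ConnectedComponent.sound hab.reachable)

theorem sconn_singleton (x : V) : SConn G {x} := by
  refine ⟨⟨x, rfl⟩, ?_⟩
  rintro _ rfl _ rfl
  exact Conn.refl rfl

/-- Two far apart vertices are themselves the hubs, and one connection needs no separation from
others. For `t = 0` no connection is needed, so the bound even forces `G` to have at most one
component. -/
theorem edist_lt_of_le_one (hK : 0 < K) (ht : t ≤ 1) (hG : ¬ IsFatMinor K (K2 t) G) {x y : V}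
    (h : 0 < t → G.Reachable x y) : G.edist x y < (3 * K : ℕ) := by
  by_contra! hle
  refine hG (isFatMinor_K2 hK (sconn_singleton x) (sconn_singleton y) ?_ (fun _ => Set.univ)
    (fun j => ⟨x, rfl, y, rfl, Conn.univ_of_reachable (h j.pos)⟩) fun j k hjk => ?_)
  · rintro _ rfl _ rfl
    exact hle
  · exact absurd (show j = k from Fin.ext (by omega)) hjk

theorem Model.edgeSet_eq_empty {α β : Type*} {J : Graph α β} (hJ : J.Loopless)
    (M : Model J (⊥ : SimpleGraph V)) : J.edgeSet = ∅ := by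
  rw [Set.eq_empty_iff_forall_notMem]
  intro e he
  obtain ⟨x, y, hxy⟩ := J.exists_isLink_of_mem_edgeSet he
  obtain ⟨a, b, p, -, hab, -⟩ := M.exists_path hJ hxy
  cases p with
  | nil => exact hab rfl
  | cons h _ => exact h

end Degenerate

end FatMinor

theorem theorem3p1 (t : ℕ) :
    ∃ R : ℕ → ℕ, ∀ (K : ℕ) (V : Type u) (G : SimpleGraph V),
      ¬ FatMinor.IsFatMinor K (FatMinor.K2 t) G →
        ∃ (W : Type u) (H : SimpleGraph W) (P : FatMinor.GraphPartition G H),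
          P.IsHonest ∧ P.IsBounded (R K) ∧
          (∀ (α : Type v) (β : Type w) (J : Graph α β), FatMinor.IsTwoConnected J →
            FatMinor.IsMinor J H → FatMinor.IsFatMinor K J G) ∧
          ¬ FatMinor.IsMinor (FatMinor.K2 t) H := by
  open FatMinor in
  -- The summand `3 * K` serves `t ≤ 1`; the other is the bound of `part_isBounded` with `gap`
  -- written out.
  refine ⟨fun K => 3 * K +
    t * (9 * K + 2 * (4 * (2 * (10 * K * (t * (t * t) * t + 3)) * (t + 3)))), ?_⟩
  intro K V G hG
  -- For `K = 0` fatness is void, and the partition into singletons works.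
  rcases Nat.eq_zero_or_pos K with rfl | hK
  · refine ⟨V, G, singletonPartition G, ⟨fun h => ⟨h, rfl⟩, fun g h hgh => ⟨g, rfl, h, rfl, hgh⟩⟩,
      ?_, fun α β J _ hM => hM.isFatMinor_zero, fun hM => hG hM.isFatMinor_zero⟩
    rintro h _ rfl _ rfl
    simp
  rcases Nat.lt_or_ge 1 t with ht | ht
  · obtain ⟨lev, hlev⟩ := exists_isLevel G
    let c : Frame V := ⟨G, lev, K, t, hlev, hK, ht, hG⟩
    refine ⟨c.Node, c.quot, c.part, Frame.part_isHonest, ?_,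
      fun α β J hJ hM => Frame.isFatMinor_of_isMinor (c := c) hJ hM,
      fun hM => hG (Frame.isFatMinor_of_isMinor (c := c) (isTwoConnected_K2 ht) hM)⟩
    intro h a ha b hb
    refine (Frame.part_isBounded (c := c) h a ha b hb).trans ?_
    exact_mod_cast Nat.le_add_left _ _
  -- For `t ≤ 1` the components have bounded diameter, and the edgeless quotient has no
  -- `2`-connected minor. It has no `K_{2,1}` minor for lack of edges, and no `K_{2,0}` minor
  -- because for `t = 0` it has at most one node.
  · refine ⟨G.ConnectedComponent, ⊥, componentPartition G,
      ⟨fun h => h.exists_rep, fun g h hgh => hgh.elim⟩, ?_, ?_, ?_⟩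
    · intro h a ha b hb
      have := edist_lt_of_le_one hK ht hG (x := a) (y := b)
        fun _ => SimpleGraph.ConnectedComponent.exact (ha.trans hb.symm)
      exact this.le.trans (by exact_mod_cast Nat.le_add_right _ _)
    · rintro α β J hJ ⟨M⟩
      exact absurd (M.edgeSet_eq_empty hJ.loopless) hJ.nontrivial_edgeSet.nonempty.ne_empty
    · rintro ⟨M⟩
      have h0 := M.edgeSet_eq_empty loopless_K2
      have ht0 : ¬ 0 < t := fun h => by
        have : s(.inl 0, .inr ⟨0, h⟩) ∈ (K2 t).edgeSet := K2_mem_edgeSet.2 ⟨_, _, rfl⟩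
        rw [h0] at this
        exact this
      obtain ⟨⟨g, hg⟩⟩ := (M.connected (.inl 0) trivial).nonempty
      obtain ⟨⟨h, hh⟩⟩ := (M.connected (.inl 1) trivial).nonempty
      obtain ⟨x, rfl⟩ := g.exists_rep
      obtain ⟨y, rfl⟩ := h.exists_rep
      have hxy := edist_lt_of_le_one hK ht hG (x := x) (y := y) fun h => absurd h ht0
      have hr : G.Reachable x y := SimpleGraph.reachable_of_edist_ne_top (hxy.trans_le le_top).ne
      refine Set.disjoint_left.1 (M.disjoint (.inl 0) trivial (.inl 1) trivial (by simp)) hg ?_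
      rw [show (Quot.mk _ x : G.ConnectedComponent) = Quot.mk _ y from
        SimpleGraph.ConnectedComponent.sound hr]
      exact hh
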